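/- \textbf{Setting.} A finite two-player zero-sum extensive-form game of height $H\ge 1$ with perfect recall consists of: a finite tree of states $\mathcal S$ with root $s_1$, of depths $0,\dots,H-1$; partitions of $\mathcal S$ into the information sets $\mathcal X$ of the min-player and $\mathcal Y$ of the max-player; finite action sets $\mathcal A,\mathcal B$; transition probabilities $p(\cdot\mid s,a,b)$ from each state of depth $h<H-1$ to states of depth $h+1$, supported on the children of $s$ reached by $(a,b)$; and losses $\ell(s,a,b)\in[0,1]$. Perfect recall means that each $x\in\mathcal X$ determines the unique path $(x_0,a_0,\dots,x_{h-1},a_{h-1},x)$ of information sets and own actions leading to it, and likewise for $\mathcal Y$. In an episode, at each depth $h=0,\dots,H-1$ the players see the information sets $x_h,y_h$ of the current state $s_h$, draw independently $a_h\sim\mu(\cdot\mid x_h)$, $b_h\sim\nu(\cdot\mid y_h)$, observe $\ell_h=\ell(s_h,a_h,b_h)$, and the state moves according to $p$. Let $K=|\mathcal A||\mathcal X|+|\mathcal B||\mathcal Y|$, let $\ell(\mu,\nu)=\mathbb E_{\mu,\nu}\big[\sum_{h=0}^{H-1}\ell_h\big]$, and \[\mathrm{EG}(\mu,\nu)=\max_{\nu'}\ell(\mu,\nu')-\min_{\mu'}\ell(\mu',\nu).\]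 The sequence form of a policy $\mu$ is $\mu_{\to x_h}(a_h)=\prod_{h'=0}^{h}\mu(a_{h'}\mid x_{h'})$ along the unique path leading to $x_h$; similarly for $\nu$. \textbf{Algorithm.} Given $\eta,\tau>0$, an integer $T_0\ge 2$ and $\delta>0$, put $\eta^t=\eta\,(t+T_0)^{-3/4}$, $\tau^t=\tau\log\!\big(\tfrac{t+T_0}{\delta}\big)(t+T_0)^{-1/4}$. Let $\Psi(m)=-\sum_i\log m_i$ on vectors with positive entries, with Bregman divergence $D_\Psi(m,m')=\Psi(m)-\Psi(m')-\langle\nabla\Psi(m'),m-m'\rangle$. The min-player starts from the uniform policy $\mu^0$. At every iteration $t=0,1,2,\dots$ one episode is played with $(\mu^t,\nu^t)$, and then \[\mu^{t+1}=\operatorname*{argmin}_{\mu}\; D_\Psi(\mu_\to,\mu^t_\to)+\eta^t\langle\hat\ell^t_{\min},\mu_\to\rangle,\qquad \hat\ell^t_{\min}=\sum_{h=0}^{H-1}\frac{\ell^t_h}{\mu^t_{\to x^t_h}(a^t_h)}\mathbf 1_{(x^t_h,a^t_h)}+\tau^t\nabla\Psi(\mu^t_\to),\] the minimum being over policies with positive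 probabilities. The max-player does the same for $\nu^t$ on $(\mathcal Y,\mathcal B)$, with $1-\ell^t_h$ in place of $\ell^t_h$. \textbf{Theorem.} For every $K$ and every $\delta>0$ there is a constant $c=c(K,\delta)>0$ such that the following holds for every finite two-player zero-sum extensive-form game with perfect recall with $|\mathcal A||\mathcal X|+|\mathcal B||\mathcal Y|=K$. If both players run the algorithm with parameters $\eta,\tau>0$ and $T_0\in\mathbb N$, $T_0\ge2$, satisfying \[\frac1{\eta\tau}\le c,\qquad \eta\le c,\qquad \eta\tau\le\frac{T_0}{\log(T_0)^4},\qquad T_0\le\log(1/\delta)^2\,\tau^4,\] then with probability at least $1-\delta$, simultaneously for all $t\in\mathbb N$, \[\mathrm{EG}(\mu^t,\nu^t)\le 2K\tau\log\!\Big(\frac{t+T_0}{\delta}\Big)(t+T_0)^{-1/4}.\] -/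

import Mathlib

open MeasureTheory

/-- A forest of decision points: `prev x` is the decision point and the action taken there that
immediately precede `x` (`none` if `x` is initial), and `depth x` is the number of decision points
strictly before `x`. -/
structure DecisionTree (X A : Type*) where
  prev : X → Option (X × A)
  depth : X → ℕ
  depth_of_none : ∀ x, prev x = none → depth x = 0
  depth_of_some : ∀ x p, prev x = some p → depth x = depth p.1 + 1

/-- A (behavioural) policy: a probability distribution `μ(· | x)` on actions for every `x`. -/
def IsPolicy {X A : Type*} [Fintype A] (μ : X → A → ℝ) : Prop :=
  (∀ x a, 0 ≤ μ x a) ∧ ∀ x, ∑ a, μ x a = 1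

/-- A policy that gives positive probability to every action. -/
def IsInteriorPolicy {X A : Type*} [Fintype A] (μ : X → A → ℝ) : Prop :=
  IsPolicy μ ∧ ∀ x a, 0 < μ x a

/-- The uniform policy. -/
noncomputable def uniformPolicy (X A : Type*) [Fintype A] : X → A → ℝ :=
  fun _ _ => 1 / (Fintype.card A : ℝ)

/-- The sequence form of a policy: the product of the probabilities `μ(a' | x')` along the unique
path `(x₁, a₁, …, x, a)` that leads to `x` and then plays `a`. -/
noncomputable def DecisionTree.seqForm {X A : Type*} (T : DecisionTree X A) (μ : X → A → ℝ)
    (x : X) (a : A) : ℝ :=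
  μ x a * match _h : T.prev x with
    | none => 1
    | some p => T.seqForm μ p.1 p.2
termination_by T.depth x
decreasing_by
  have := T.depth_of_some x p _h
  omega

/-- The log-barrier `Ψ(m) = -∑ log m(x, a)`, on vectors with positive entries. -/
noncomputable def logBarrier {X A : Type*} [Fintype X] [Fintype A] (m : X → A → ℝ) : ℝ :=
  -∑ x, ∑ a, Real.log (m x a)

/-- The gradient of the log-barrier. -/
noncomputable def logBarrierGrad {X A : Type*} (m : X → A → ℝ) : X → A → ℝ :=
  fun x a => -(m x a)⁻¹

/-- The scalar product on vectors indexed by pairs `(x, a)`. -/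
def pairing {X A : Type*} [Fintype X] [Fintype A] (f m : X → A → ℝ) : ℝ :=
  ∑ x, ∑ a, f x a * m x a

/-- The Bregman divergence of the log-barrier. -/
noncomputable def logBarrierDiv {X A : Type*} [Fintype X] [Fintype A] (m m' : X → A → ℝ) : ℝ :=
  logBarrier m - logBarrier m' - pairing (logBarrierGrad m') (m - m')

/-- `μ'` is the mirror descent update of `μ` with learning rate `c` and step `ξ`, for the dilated
log-barrier: it minimizes `D_Ψ(·, μ) + c ⟨ξ, ·⟩`, computed on sequence forms. The minimum is over
the policies on which the barrier is finite. -/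
def DecisionTree.IsMirrorStep {X A : Type*} [Fintype X] [Fintype A] (T : DecisionTree X A)
    (c : ℝ) (ξ : X → A → ℝ) (μ μ' : X → A → ℝ) : Prop :=
  IsInteriorPolicy μ' ∧
    IsMinOn
      (fun κ : X → A → ℝ =>
        logBarrierDiv (T.seqForm κ) (T.seqForm μ) + c * pairing ξ (T.seqForm κ))
      {κ | IsInteriorPolicy κ} μ'

/-- A finite two-player zero-sum extensive-form game with perfect recall: states `S`, information
sets `X` with actions `A` (min-player), information sets `Y` with actions `B` (max-player).
Depths are counted from `0`, so that an episode visits states of depth `0, …, H - 1`. -/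
structure ExtensiveGame (S X Y A B : Type*) [Fintype S] where
  H : ℕ
  H_pos : 0 < H
  /-- The tree of states; a state other than the root is reached from one state by one pair of
  actions. -/
  tree : DecisionTree S (A × B)
  root : S
  prev_eq_none_iff : ∀ s, tree.prev s = none ↔ s = root
  depth_lt : ∀ s, tree.depth s < H
  /-- `trans s a b s'` is the probability of moving to `s'` when `(a, b)` is played at `s`. -/
  trans : S → A → B → S → ℝ
  trans_nonneg : ∀ s a b s', 0 ≤ trans s a b s'
  trans_sum : ∀ s a b, tree.depth s + 1 < H → ∑ s', trans s a b s' = 1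
  trans_tree : ∀ s a b s', trans s a b s' ≠ 0 → tree.prev s' = some (s, (a, b))
  /-- The loss of the min-player; the depth is determined by the state. -/
  loss : S → A → B → ℝ
  loss_mem : ∀ s a b, loss s a b ∈ Set.Icc (0 : ℝ) 1
  /-- The partition of the states into the information sets of the min-player. -/
  infoMin : S → X
  infoMin_surjective : Function.Surjective infoMin
  minTree : DecisionTree X A
  /-- Perfect recall: an information set determines the previous one and the action played. -/
  recall_min : ∀ s,
    minTree.prev (infoMin s) = (tree.prev s).map fun p => (infoMin p.1, p.2.1)
  /-- The partition of the states into the information sets of the max-player. -/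
  infoMax : S → Y
  infoMax_surjective : Function.Surjective infoMax
  maxTree : DecisionTree Y B
  recall_max : ∀ s,
    maxTree.prev (infoMax s) = (tree.prev s).map fun p => (infoMax p.1, p.2.2)

namespace ExtensiveGame

variable {S X Y A B : Type*} [Fintype S]

/-- A play of one episode: the state and the two actions `(s_h, a_h, b_h)` at each depth. -/
abbrev Play (G : ExtensiveGame S X Y A B) : Type _ := Fin G.H → S × A × B

open Classical in
/-- The probability that the environment produces the state of `z` at depth `h`, given the
states and actions of `z` at the previous depth. -/
noncomputable def arrivalProb (G : ExtensiveGame S X Y A B) (z : G.Play) (h : Fin G.H) : ℝ :=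
  if (h : ℕ) = 0 then (if (z h).1 = G.root then 1 else 0)
  else
    let y := z ⟨(h : ℕ) - 1, lt_of_le_of_lt (Nat.sub_le _ _) h.isLt⟩
    G.trans y.1 y.2.1 y.2.2 (z h).1

/-- The probability of the play `z` when the players follow the policies `μ` and `ν`. -/
noncomputable def playProb (G : ExtensiveGame S X Y A B) (μ : X → A → ℝ) (ν : Y → B → ℝ)
    (z : G.Play) : ℝ :=
  ∏ h : Fin G.H,
    (G.arrivalProb z h * μ (G.infoMin (z h).1) (z h).2.1 * ν (G.infoMax (z h).1) (z h).2.2)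

/-- The loss received at depth `h` along the play `z`. -/
def playLoss (G : ExtensiveGame S X Y A B) (z : G.Play) (h : Fin G.H) : ℝ :=
  G.loss (z h).1 (z h).2.1 (z h).2.2

/-- The expected total loss of an episode. -/
noncomputable def value [Fintype A] [Fintype B] (G : ExtensiveGame S X Y A B)
    (μ : X → A → ℝ) (ν : Y → B → ℝ) : ℝ :=
  ∑ z : G.Play, G.playProb μ ν z * ∑ h, G.playLoss z h

/-- The exploitability gap `max_{ν'} ℓ(μ, ν') - min_{μ'} ℓ(μ', ν)`. -/
noncomputable def exploitabilityGap [Fintype A] [Fintype B] (G : ExtensiveGame S X Y A B)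
    (μ : X → A → ℝ) (ν : Y → B → ℝ) : ℝ :=
  sSup ((fun ν' => G.value μ ν') '' {ν' | IsPolicy ν'}) -
    sInf ((fun μ' => G.value μ' ν) '' {μ' | IsPolicy μ'})

open Classical in
/-- The importance-sampling estimate of the min-player, from one play of the policy `μ`. -/
noncomputable def estimateMin (G : ExtensiveGame S X Y A B) (μ : X → A → ℝ) (z : G.Play) :
    X → A → ℝ :=
  fun x a => ∑ h : Fin G.H,
    if G.infoMin (z h).1 = x ∧ (z h).2.1 = a then
      G.playLoss z h / G.minTree.seqForm μ x a
    else 0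

open Classical in
/-- The importance-sampling estimate of the max-player, whose loss at each depth is `1 - ℓ`. -/
noncomputable def estimateMax (G : ExtensiveGame S X Y A B) (ν : Y → B → ℝ) (z : G.Play) :
    Y → B → ℝ :=
  fun y b => ∑ h : Fin G.H,
    if G.infoMax (z h).1 = y ∧ (z h).2.2 = b then
      (1 - G.playLoss z h) / G.maxTree.seqForm ν y b
    else 0

end ExtensiveGame

/-- The learning rate `η^t`. -/
noncomputable def learningRate (η : ℝ) (T₀ t : ℕ) : ℝ :=
  η * ((t : ℝ) + T₀) ^ (-(3 / 4) : ℝ)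

/-- The regularization strength `τ^t`. -/
noncomputable def regStrength (δ τ : ℝ) (T₀ t : ℕ) : ℝ :=
  τ * Real.log (((t : ℝ) + T₀) / δ) * ((t : ℝ) + T₀) ^ (-(1 / 4) : ℝ)

/-- The two players run the regularized mirror descent with the dilated log-barrier: `μ t` and
`ν t` are their policies at iteration `t`, and `Z t` is the play of iteration `t`, which given the
past `ℱ t` is drawn by following `μ t` and `ν t` in the game. -/
structure ExtensiveGame.IsRun {S X Y A B : Type*}
    [Fintype S] [Fintype X] [Fintype Y] [Fintype A] [Fintype B]
    (G : ExtensiveGame S X Y A B) (δ η τ : ℝ) (T₀ : ℕ)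
    {Ω : Type*} {mΩ : MeasurableSpace Ω} (P : Measure Ω) (ℱ : Filtration ℕ mΩ)
    (Z : ℕ → Ω → G.Play) (μ : ℕ → Ω → X → A → ℝ) (ν : ℕ → Ω → Y → B → ℝ) : Prop where
  measurable_min : ∀ t x a, Measurable[ℱ t] fun ω => μ t ω x a
  measurable_max : ∀ t y b, Measurable[ℱ t] fun ω => ν t ω y b
  measurable_play : ∀ t z, MeasurableSet[ℱ (t + 1)] {ω | Z t ω = z}
  law_play : ∀ t z,
    P[Set.indicator {ω | Z t ω = z} (fun _ => (1 : ℝ)) | ℱ t]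
      =ᵐ[P] fun ω => G.playProb (μ t ω) (ν t ω) z
  start_min : ∀ ω, μ 0 ω = uniformPolicy X A
  start_max : ∀ ω, ν 0 ω = uniformPolicy Y B
  step_min : ∀ t ω, G.minTree.IsMirrorStep (learningRate η T₀ t)
    (G.estimateMin (μ t ω) (Z t ω) +
      regStrength δ τ T₀ t • logBarrierGrad (G.minTree.seqForm (μ t ω)))
    (μ t ω) (μ (t + 1) ω)
  step_max : ∀ t ω, G.maxTree.IsMirrorStep (learningRate η T₀ t)
    (G.estimateMax (ν t ω) (Z t ω) +
      regStrength δ τ T₀ t • logBarrierGrad (G.maxTree.seqForm (ν t ω)))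
    (ν t ω) (ν (t + 1) ω)

/-! The two players are merged into one vector `z` of sequence forms, in a polytope `Q` with tangent
space `V`. The bilinear loss becomes an alternating form for which `form z (z - z')` is the gain of
the two players when they deviate to `z'`, so it suffices to bound this quantity over `Q`. A run is
then a single log-barrier mirror descent on `Q`, with estimates of `form z` that are unbiased along
`V`.

The iterates are compared with a deterministic path `c t` in `Q`: implicit natural-gradient steps
with the same `η t`, `τ t`, started at the analytic centre (`exists_flow`). Since the form is
alternating, an implicit step is a uniquely solvable linear system, and the game term cancels when
two successive steps are compared. Hence the relative speed `v / c` contracts at rate `η τ` and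
stays below `η τ / 8` (`flow_speed_le`). Slowness of the path means, through its own equation, that
the gap near it is of order `K τ` (`form_gap_le`).

Let `X t` be the barrier divergence from `c t` to the iterate and `S t` its symmetrization. One step
gives `X (t+1) ≤ X t - (η τ / 2) S t + η M t + O(η² (τ + K)²)` with centred noise `M t`
(`barrierDiv_step`). Importance-sampling estimates `f` are large where `z` is small, but `∑ f i * z
i` is bounded, so `M t` is controlled by the relative distance to the path; as long as `X t ≤ R`,
its square is at most a constant times `S t`. The noise is therefore absorbed by the drift inside an
exponential moment: `exp (r t * X t)`, integrated over the event that `X` has not exceeded `R`,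
stays below a constant (`setLIntegral_exp_le`). Markov's inequality at the first crossing, with
summable weights, bounds all `X t` at once (`le_measureReal_forall_le`).

When `τ t ≥ 1` the claim is trivial, since the gap is at most `2 K`. When `τ t < 1` the divergence
is kept below `(τ t / 48)²`, hence the iterate within relative distance `τ t / 16` of the path. The
exponents `3/4` and `1/4` are what this needs: `r t` is of order `τ t / η t`, so the exponent
available is of order `(τ t)³ / η t`, where the powers of time cancel and the cube of `log ((t + T₀)
/ δ)` remains, more than the union bound costs. The conditions on the parameters force `T₀` and the
initial regularization to be large (`exists_isSchedule`). -/

section Scalar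

/-! ### Scalar inequalities for one coordinate. -/

lemma log_one_add_ge {a : ℝ} (ha : |a| ≤ 1 / 2) : a - 2 * a ^ 2 ≤ Real.log (1 + a) := by
  have h := abs_le.1 ha
  have hpos : 0 < 1 + a := by linarith
  have h1 : 1 - (1 + a)⁻¹ ≤ Real.log (1 + a) := Real.one_sub_inv_le_log_of_pos hpos
  refine le_trans ?_ h1
  have : 1 - (1 + a)⁻¹ - (a - 2 * a ^ 2) = a ^ 2 * (1 + 2 * a) / (1 + a) := by
    field_simp; ring
  have h2 : 0 ≤ a ^ 2 * (1 + 2 * a) / (1 + a) :=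
    div_nonneg (mul_nonneg (sq_nonneg a) (by linarith)) hpos.le
  linarith

/-- Coordinatewise comparison of the divergences before and after a step. -/
lemma div_step_coord {c z a b η τ f : ℝ} (hc : 0 < c) (hz : 0 < z) (ha : |a| ≤ 1 / 2)
    (hb : 0 < 1 + b) :
    (c * (1 + a) / (z * (1 + b)) - 1 - Real.log (c * (1 + a) / (z * (1 + b))))
        - (c / z - 1 - Real.log (c / z)) ≤
      (1 / (z * (1 + b)) - (1 - η * τ) / z - η * f) * (c * (1 + a) - z) + b ^ 2 / (1 + b)
        - η * τ * (c / z + z / c - 2) + a * (c / z + z / c - 2) + 2 * a ^ 2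
        - η * τ * a * (c / z) + η * (f * (c - z)) + η * (f * (c * a))
        + (a - η * τ) * (c - z) / c := by
  have hα := abs_le.1 ha
  have hpa : 0 < 1 + a := by linarith
  have h1 : Real.log (c * (1 + a) / (z * (1 + b)))
      = Real.log (c / z) + Real.log (1 + a) - Real.log (1 + b) := by
    rw [Real.log_div (by positivity) (by positivity), Real.log_mul hc.ne' hpa.ne',
      Real.log_mul hz.ne' hb.ne', Real.log_div hc.ne' hz.ne']
    ring
  have h2 := log_one_add_ge ha
  have h3 : Real.log (1 + b) ≤ b := by
    have := Real.log_le_sub_one_of_pos hb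
    linarith
  rw [h1]
  -- A pure identity. The terms are grouped so that, after summation over coordinates, the first
  -- vanishes by optimality of the mirror step and the last is given by the equation of the flow.
  have key : (c * (1 + a) / (z * (1 + b)) - 1) - (c / z - 1) - a + b =
      (1 / (z * (1 + b)) - (1 - η * τ) / z - η * f) * (c * (1 + a) - z) + b ^ 2 / (1 + b)
        - η * τ * (c / z + z / c - 2) + a * (c / z + z / c - 2)
        - η * τ * a * (c / z) + η * (f * (c - z)) + η * (f * (c * a))
        + (a - η * τ) * (c - z) / c := by
    field_simp
    ring
  linarith

/-- If `|b| > g`, then `b² / (1 + b) ≥ |b|² / (1 + |b|) ≥ |b| g / (1 + g)`. The free threshold `g`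
serves to balance the two terms. -/
lemma abs_le_of_sq_div {b g : ℝ} (hb : 0 < 1 + b) (hg : 0 < g) :
    |b| ≤ g + b ^ 2 / (1 + b) * ((1 + g) / g) := by
  have h0 : 0 ≤ b ^ 2 / (1 + b) * ((1 + g) / g) := by positivity
  by_cases h : |b| ≤ g
  · linarith
  push Not at h
  have h1 : |b| ^ 2 / (1 + |b|) ≤ b ^ 2 / (1 + b) := by
    rw [sq_abs]
    apply div_le_div_of_nonneg_left (sq_nonneg b) hb
    linarith [le_abs_self b]
  have h2 : |b| ≤ |b| ^ 2 / (1 + |b|) * ((1 + g) / g) := by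
    rw [div_mul_div_comm, le_div_iff₀ (by positivity)]
    nlinarith [abs_nonneg b]
  have h3 : |b| ^ 2 / (1 + |b|) * ((1 + g) / g) ≤ b ^ 2 / (1 + b) * ((1 + g) / g) :=
    mul_le_mul_of_nonneg_right h1 (by positivity)
  linarith

lemma div_add_div_sub_two_eq {c z : ℝ} (hc : 0 < c) (hz : 0 < z) :
    c / z + z / c - 2 = (c - z) ^ 2 / (c * z) := by
  field_simp
  ring

lemma div_add_div_sub_two_nonneg {c z : ℝ} (hc : 0 < c) (hz : 0 < z) :
    0 ≤ c / z + z / c - 2 := by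
  rw [div_add_div_sub_two_eq hc hz]
  positivity

lemma sub_one_sub_log_nonneg {q : ℝ} (hq : 0 < q) : 0 ≤ q - 1 - Real.log q := by
  linarith [Real.log_le_sub_one_of_pos hq]

/-- This is `log x ≤ x - 1` at `x = √q`. It turns a divergence of size `e²` into a relative error of
order `e`. -/
lemma sqrt_sub_one_sq_le {q : ℝ} (hq : 0 < q) : (√q - 1) ^ 2 ≤ q - 1 - Real.log q := by
  have h : Real.log q ≤ 2 * (√q - 1) := by
    have h1 : Real.log q = 2 * Real.log √q := by
      rw [Real.log_sqrt hq.le]; ring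
    rw [h1]
    have := Real.log_le_sub_one_of_pos (Real.sqrt_pos.2 hq)
    linarith
  have h2 := Real.sq_sqrt hq.le
  nlinarith

end Scalar

/-! ### The log-barrier divergence and the relative distances it controls. -/

section Divergence

variable {I : Type*} [Fintype I]

/-- The Bregman divergence of the log-barrier, in terms of the ratios of the coordinates. -/
noncomputable def barrierDiv (c z : I → ℝ) : ℝ :=
  ∑ i, (c i / z i - 1 - Real.log (c i / z i))

/-- The symmetrized Bregman divergence of the log-barrier. -/
noncomputable def barrierSym (c z : I → ℝ) : ℝ :=
  ∑ i, (c i / z i + z i / c i - 2)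

lemma barrierDiv_nonneg {c z : I → ℝ} (hc : ∀ i, 0 < c i) (hz : ∀ i, 0 < z i) :
    0 ≤ barrierDiv c z :=
  Finset.sum_nonneg fun i _ => sub_one_sub_log_nonneg (div_pos (hc i) (hz i))

lemma barrierSym_nonneg {c z : I → ℝ} (hc : ∀ i, 0 < c i) (hz : ∀ i, 0 < z i) :
    0 ≤ barrierSym c z :=
  Finset.sum_nonneg fun i _ => div_add_div_sub_two_nonneg (hc i) (hz i)

lemma barrierDiv_le_barrierSym {c z : I → ℝ} (hc : ∀ i, 0 < c i) (hz : ∀ i, 0 < z i) :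
    barrierDiv c z ≤ barrierSym c z := by
  refine Finset.sum_le_sum fun i _ => ?_
  have h := Real.one_sub_inv_le_log_of_pos (div_pos (hc i) (hz i))
  rw [inv_div] at h
  linarith

lemma coord_le_barrierDiv {c z : I → ℝ} (hc : ∀ i, 0 < c i) (hz : ∀ i, 0 < z i) (i : I) :
    c i / z i - 1 - Real.log (c i / z i) ≤ barrierDiv c z :=
  Finset.single_le_sum (f := fun i => c i / z i - 1 - Real.log (c i / z i))
    (fun j _ => sub_one_sub_log_nonneg (div_pos (hc j) (hz j))) (Finset.mem_univ i)

lemma coord_le_barrierSym {c z : I → ℝ} (hc : ∀ i, 0 < c i) (hz : ∀ i, 0 < z i) (i : I) :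
    c i / z i + z i / c i - 2 ≤ barrierSym c z :=
  Finset.single_le_sum (f := fun i => c i / z i + z i / c i - 2)
    (fun j _ => div_add_div_sub_two_nonneg (hc j) (hz j)) (Finset.mem_univ i)

lemma ratio_le_of_barrierDiv_le {c z : I → ℝ} (hc : ∀ i, 0 < c i) (hz : ∀ i, 0 < z i)
    {R : ℝ} (h : barrierDiv c z ≤ R) (i : I) : c i / z i ≤ 2 * R + 2 := by
  have h1 := coord_le_barrierDiv hc hz i
  have hq := div_pos (hc i) (hz i)
  set q := c i / z i
  have h2 : Real.log q ≤ q / 2 := by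
    have h3 : Real.log (q / 2) ≤ q / 2 - 1 := Real.log_le_sub_one_of_pos (by positivity)
    rw [Real.log_div hq.ne' (by norm_num)] at h3
    have := Real.log_two_lt_d9
    linarith
  linarith

lemma abs_ratio_sub_one_le {c z : I → ℝ} (hc : ∀ i, 0 < c i) (hz : ∀ i, 0 < z i)
    {e : ℝ} (he0 : 0 ≤ e) (he : e ≤ 1) (h : barrierDiv c z ≤ e ^ 2) (i : I) :
    |c i / z i - 1| ≤ 3 * e := by
  have hq := div_pos (hc i) (hz i)
  have h1 := (sqrt_sub_one_sq_le hq).trans ((coord_le_barrierDiv hc hz i).trans h)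
  set q := c i / z i
  have h6 := abs_le_of_sq_le_sq h1 he0
  have h2 := abs_le.1 h6
  have h3 := Real.sq_sqrt hq.le
  have h4 : q - 1 = (√q - 1) * (√q + 1) := by nlinarith
  rw [h4, abs_mul]
  have h5 : |√q + 1| ≤ 3 := by
    rw [abs_of_nonneg (by positivity)]
    linarith [h2.2]
  calc |√q - 1| * |√q + 1| ≤ e * 3 := mul_le_mul h6 h5 (abs_nonneg _) he0
    _ = 3 * e := by ring

lemma abs_ratio_sub_one_le_of_le {c z : I → ℝ} (hc : ∀ i, 0 < c i) (hz : ∀ i, 0 < z i)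
    {R : ℝ} (hR : 0 ≤ R) (h : barrierDiv c z ≤ R) (i : I) : |c i / z i - 1| ≤ 2 * R + 2 := by
  have h1 := ratio_le_of_barrierDiv_le hc hz h i
  have hq := div_pos (hc i) (hz i)
  rw [abs_le]
  constructor <;> linarith

/-- With `q` the ratio, `(q - 1)² = q (q + 1/q - 2)`: the first factor is bounded by the level `R`,
the second is a summand of the symmetrized divergence. This is what bounds the variance of the noise
by the drift. -/
lemma ratio_sub_one_sq_le {c z : I → ℝ} (hc : ∀ i, 0 < c i) (hz : ∀ i, 0 < z i)
    {R : ℝ} (hR : 0 ≤ R) (h : barrierDiv c z ≤ R) (i : I) :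
    (c i / z i - 1) ^ 2 ≤ (2 * R + 2) * barrierSym c z := by
  have h1 := ratio_le_of_barrierDiv_le hc hz h i
  have h2 := coord_le_barrierSym hc hz i
  have h0 := div_add_div_sub_two_nonneg (hc i) (hz i)
  have h3 : (c i / z i - 1) ^ 2 = c i / z i * (c i / z i + z i / c i - 2) := by
    have := (hc i).ne'
    have := (hz i).ne'
    field_simp
    ring
  rw [h3]
  exact mul_le_mul h1 h2 h0 (by linarith)

end Divergence

/-! ### Abstract saddle-point problems and one step of mirror descent. -/

/-- A bilinear saddle-point problem: a polytope with tangent space `V`, and an alternating form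
such that `form z (z - z')` is the advantage of deviating from `z` to `z'`. -/
structure SaddleProblem (I : Type*) [Fintype I] where
  V : Submodule ℝ (I → ℝ)
  Q : Set (I → ℝ)
  isCompact : IsCompact Q
  nonneg : ∀ z ∈ Q, ∀ i, 0 ≤ z i
  le_one : ∀ z ∈ Q, ∀ i, z i ≤ 1
  sub_mem : ∀ z ∈ Q, ∀ z' ∈ Q, z - z' ∈ V
  add_mem : ∀ z ∈ Q, ∀ w ∈ V, (∀ i, 0 ≤ z i + w i) → z + w ∈ Q
  form : (I → ℝ) →ₗ[ℝ] (I → ℝ) →ₗ[ℝ] ℝ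
  form_self : ∀ u, form u u = 0
  bound : ℝ
  one_le_bound : 1 ≤ bound
  abs_form_le : ∀ z ∈ Q, ∀ z' ∈ Q, ∀ u w, (∀ i, |u i| ≤ z i) → (∀ i, |w i| ≤ z' i) →
    |form u w| ≤ bound

namespace SaddleProblem

variable {I : Type*} [Fintype I] (G : SaddleProblem I)

lemma bound_pos : 0 < G.bound := lt_of_lt_of_le one_pos G.one_le_bound

lemma abs_form_le_mul {z z' u w : I → ℝ} (hz : z ∈ G.Q) (hz' : z' ∈ G.Q) {α β : ℝ}
    (hα : 0 ≤ α) (hβ : 0 ≤ β) (hu : ∀ i, |u i| ≤ α * z i) (hw : ∀ i, |w i| ≤ β * z' i) :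
    |G.form u w| ≤ α * β * G.bound := by
  rcases hα.eq_or_lt with rfl | hα
  · have : u = 0 := by
      ext i
      simpa using hu i
    simp [this]
  rcases hβ.eq_or_lt with rfl | hβ
  · have : w = 0 := by
      ext i
      simpa using hw i
    simp [this]
  have h := G.abs_form_le z hz z' hz' (α⁻¹ • u) (β⁻¹ • w)
    (fun i => by
      simp only [Pi.smul_apply, smul_eq_mul, abs_mul, abs_inv, abs_of_pos hα]
      rw [inv_mul_le_iff₀ hα]
      exact hu i)
    (fun i => by
      simp only [Pi.smul_apply, smul_eq_mul, abs_mul, abs_inv, abs_of_pos hβ]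
      rw [inv_mul_le_iff₀ hβ]
      exact hw i)
  simp only [map_smul, LinearMap.smul_apply, smul_eq_mul, abs_mul, abs_inv, abs_of_pos hα,
    abs_of_pos hβ] at h
  rw [inv_mul_le_iff₀ hβ, inv_mul_le_iff₀ hα] at h
  linarith

/-- `v` is the displacement from `c` of the implicit natural-gradient step. -/
def IsFlowStep (η τ : ℝ) (c v : I → ℝ) : Prop :=
  -- The metric `∑ v w / c²` and the barrier gradient are taken at the old point `c`, the form at
  -- the new point `c + v`.
  v ∈ G.V ∧ ∀ w ∈ G.V, ∑ i, (v i / c i - η * τ) * w i / c i = -η * G.form (c + v) w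

/-- `z'` is the mirror step from `z` for the loss estimate `f`, in terms of the first-order
optimality condition. -/
def IsBarrierStep (η τ : ℝ) (f z z' : I → ℝ) : Prop :=
  ∀ w ∈ G.V, ∑ i, (1 / z' i - (1 - η * τ) / z i - η * f i) * w i = 0

/-- The move of a mirror step is small in the local norm. -/
lemma barrierStep_move_le {η τ : ℝ} {f z z' : I → ℝ} (hη : 0 < η) (hτ : 0 < τ)
    (hρ : η * τ + η * G.bound ≤ 1 / 4) (hz : z ∈ G.Q) (hz' : z' ∈ G.Q)
    (hzp : ∀ i, 0 < z i) (hzp' : ∀ i, 0 < z' i) (hf : ∀ i, 0 ≤ f i)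
    (hfz : ∑ i, f i * z i ≤ G.bound) (hstep : G.IsBarrierStep η τ f z z') :
    ∑ i, (z' i / z i - 1) ^ 2 / (z' i / z i) ≤
      8 * Fintype.card I * (η * τ + η * G.bound) ^ 2 := by
  set ρ := η * τ + η * G.bound with hρdef
  have hρ0 : 0 < ρ := by have := G.bound_pos; positivity
  have h0 := hstep _ (G.sub_mem z' hz' z hz)
  -- Optimality tested on `z' - z`.
  have h1 : ∑ i, (z' i / z i - 1) ^ 2 / (z' i / z i) =
      ∑ i, (η * τ - η * (f i * z i)) * (z' i / z i - 1) := by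
    have : ∑ i, (z' i / z i - 1) ^ 2 / (z' i / z i) =
        ∑ i, ((η * τ - η * (f i * z i)) * (z' i / z i - 1)
          - (1 / z' i - (1 - η * τ) / z i - η * f i) * (z' - z) i) := by
      refine Finset.sum_congr rfl fun i _ => ?_
      have := (hzp i).ne'
      have := (hzp' i).ne'
      simp only [Pi.sub_apply]
      field_simp
      ring
    rw [this, Finset.sum_sub_distrib, h0, sub_zero]
  have h2 : ∀ i, (η * τ - η * (f i * z i)) * (z' i / z i - 1) ≤
      4 * ρ ^ 2 + 1 / 2 * ((z' i / z i - 1) ^ 2 / (z' i / z i)) := by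
    intro i
    have hfi : f i * z i ≤ G.bound := (Finset.single_le_sum
      (f := fun i => f i * z i) (fun j _ => mul_nonneg (hf j) (hzp j).le)
      (Finset.mem_univ i)).trans hfz
    have hfi0 : 0 ≤ f i * z i := mul_nonneg (hf i) (hzp i).le
    have hw : |η * τ - η * (f i * z i)| ≤ ρ := by
      rw [abs_le]
      have : 0 < η * τ := by positivity
      have : η * (f i * z i) ≤ η * G.bound := by gcongr
      have : 0 ≤ η * (f i * z i) := by positivity
      constructor <;> linarith
    have hq : 0 < z' i / z i := div_pos (hzp' i) (hzp i)
    -- With `g = 4ρ`, the coefficient `ρ (1 + g) / g = (1 + 4ρ) / 4` is at most `1/2`, so half of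
    -- the left side absorbs the term.
    have hb := abs_le_of_sq_div (b := z' i / z i - 1) (g := 4 * ρ) (by linarith) (by positivity)
    rw [add_sub_cancel] at hb
    have hX : 0 ≤ (z' i / z i - 1) ^ 2 / (z' i / z i) := by positivity
    set X := (z' i / z i - 1) ^ 2 / (z' i / z i)
    calc (η * τ - η * (f i * z i)) * (z' i / z i - 1)
        ≤ |η * τ - η * (f i * z i)| * |z' i / z i - 1| := by
          rw [← abs_mul]; exact le_abs_self _
      _ ≤ ρ * (4 * ρ + X * ((1 + 4 * ρ) / (4 * ρ))) :=
          mul_le_mul hw hb (abs_nonneg _) hρ0.le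
      _ = 4 * ρ ^ 2 + X * ((1 + 4 * ρ) / 4) := by field_simp
      _ ≤ 4 * ρ ^ 2 + 1 / 2 * X := by nlinarith
  have h3 : ∑ i, (z' i / z i - 1) ^ 2 / (z' i / z i) ≤
      ∑ i, (4 * ρ ^ 2 + 1 / 2 * ((z' i / z i - 1) ^ 2 / (z' i / z i))) := by
    conv_lhs => rw [h1]
    exact Finset.sum_le_sum fun i _ => h2 i
  rw [Finset.sum_add_distrib, ← Finset.mul_sum _ _ (1 / 2 : ℝ)] at h3
  simp only [Finset.sum_const, Finset.card_univ, nsmul_eq_mul] at h3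
  linarith

/-- One step of the tracking of the deterministic flow by the mirror descent. -/
theorem barrierDiv_step {η τ s : ℝ} {f c v z z' : I → ℝ} (hη : 0 < η) (hτ : 0 < τ)
    (hρ : η * τ + η * G.bound ≤ 1 / 4) (hs0 : 0 ≤ s) (hs : s ≤ η * τ / 8)
    (hc : c ∈ G.Q) (hcv : c + v ∈ G.Q) (hz : z ∈ G.Q) (hz' : z' ∈ G.Q)
    (hcp : ∀ i, 0 < c i) (hzp : ∀ i, 0 < z i) (hzp' : ∀ i, 0 < z' i)
    (hv : ∀ i, |v i / c i| ≤ s) (hf : ∀ i, 0 ≤ f i)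
    (hfz : ∑ i, f i * z i ≤ G.bound) (hflow : G.IsFlowStep η τ c v)
    (hstep : G.IsBarrierStep η τ f z z') :
    barrierDiv (c + v) z' ≤ barrierDiv c z - η * τ / 2 * barrierSym c z
      + η * (∑ i, f i * (c i - z i) - G.form z (c - z))
      + (9 * Fintype.card I + 1) * (η * τ + η * G.bound) ^ 2 := by
  set ρ := η * τ + η * G.bound with hρdef
  have hB := G.bound_pos
  have hητ : 0 < η * τ := by positivity
  have hηB : 0 < η * G.bound := by positivity
  have hmove := G.barrierStep_move_le hη hτ hρ hz hz' hzp hzp' hf hfz hstep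
  have hS0 := barrierSym_nonneg hcp hzp
  -- The mirror step is tested on `c + v - z`, the flow step on `c - z`.
  have e1 := hstep _ (by
    have := G.sub_mem _ hcv z hz
    exact this)
  have e2 := hflow.2 _ (G.sub_mem c hc z hz)
  have hsum : barrierDiv (c + v) z' - barrierDiv c z ≤
      ∑ i, ((1 / z' i - (1 - η * τ) / z i - η * f i) * (c + v - z) i
        + (z' i / z i - 1) ^ 2 / (z' i / z i)
        - η * τ * (c i / z i + z i / c i - 2) + v i / c i * (c i / z i + z i / c i - 2)
        + 2 * (v i / c i) ^ 2
        - η * τ * (v i / c i) * (c i / z i) + η * (f i * (c i - z i)) + η * (f i * v i)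
        + (v i / c i - η * τ) * (c - z) i / c i) := by
    rw [barrierDiv, barrierDiv, ← Finset.sum_sub_distrib]
    refine Finset.sum_le_sum fun i _ => ?_
    have h := div_step_coord (η := η) (τ := τ) (f := f i) (a := v i / c i)
      (b := z' i / z i - 1) (hcp i) (hzp i) ((hv i).trans (by linarith))
      (by rw [add_sub_cancel]; exact div_pos (hzp' i) (hzp i))
    have h1 : c i * (1 + v i / c i) = c i + v i := by
      have := (hcp i).ne'
      field_simp
    have h2 : z i * (z' i / z i) = z' i := by
      have := (hzp i).ne'
      field_simp
    have h3 : c i * (v i / c i) = v i := by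
      have := (hcp i).ne'
      field_simp
    rw [add_sub_cancel, h1, h2, h3] at h
    exact h
  simp only [Finset.sum_add_distrib, Finset.sum_sub_distrib] at hsum
  rw [e1, e2] at hsum
  have t1 : ∑ i, η * τ * (c i / z i + z i / c i - 2) = η * τ * barrierSym c z := by
    rw [barrierSym, Finset.mul_sum]
  have t2 : ∑ i, v i / c i * (c i / z i + z i / c i - 2) ≤ s * barrierSym c z := by
    rw [barrierSym, Finset.mul_sum]
    refine Finset.sum_le_sum fun i _ => ?_
    exact mul_le_mul_of_nonneg_right ((le_abs_self _).trans (hv i))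
      (div_add_div_sub_two_nonneg (hcp i) (hzp i))
  have t3 : ∑ i, 2 * (v i / c i) ^ 2 ≤ 2 * Fintype.card I * s ^ 2 := by
    calc ∑ i, 2 * (v i / c i) ^ 2 ≤ ∑ _i : I, 2 * s ^ 2 := by
          refine Finset.sum_le_sum fun i _ => ?_
          have := sq_le_sq' (abs_le.1 (hv i)).1 (abs_le.1 (hv i)).2
          linarith
      _ = _ := by simp; ring
  have hq : ∀ i, c i / z i ≤ 2 + (c i / z i + z i / c i - 2) := fun i => by
    have := div_pos (hzp i) (hcp i)
    linarith
  have t4 : -∑ i, η * τ * (v i / c i) * (c i / z i) ≤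
      η * τ * s * (2 * Fintype.card I + barrierSym c z) := by
    have : η * τ * s * (2 * Fintype.card I + barrierSym c z) =
        ∑ i, η * τ * s * (2 + (c i / z i + z i / c i - 2)) := by
      rw [← Finset.mul_sum, Finset.sum_add_distrib, barrierSym, Finset.sum_const,
        Finset.card_univ, nsmul_eq_mul, mul_comm (2 : ℝ)]
    rw [this, ← Finset.sum_neg_distrib]
    refine Finset.sum_le_sum fun i _ => ?_
    have h1 : -(v i / c i) ≤ s := (neg_le_abs _).trans (hv i)
    have hp := div_pos (hcp i) (hzp i)
    have h2 : -(v i / c i) * (c i / z i) ≤ s * (2 + (c i / z i + z i / c i - 2)) :=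
      (mul_le_mul_of_nonneg_right h1 hp.le).trans (mul_le_mul_of_nonneg_left (hq i) hs0)
    have := mul_le_mul_of_nonneg_left h2 hητ.le
    linarith
  have t5 : ∑ i, η * (f i * v i) ≤ η * s * (2 * G.bound + G.bound * barrierSym c z) := by
    have h1 : ∀ i, f i * v i ≤ s * (f i * z i * (2 + barrierSym c z)) := by
      intro i
      have hfz0 : 0 ≤ f i * z i := mul_nonneg (hf i) (hzp i).le
      have h2 : f i * v i = (f i * z i) * ((v i / c i) * (c i / z i)) := by
        have := (hcp i).ne'
        have := (hzp i).ne'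
        field_simp
      have hp := div_pos (hcp i) (hzp i)
      have h3 : (v i / c i) * (c i / z i) ≤ s * (2 + barrierSym c z) :=
        (mul_le_mul_of_nonneg_right ((le_abs_self _).trans (hv i)) hp.le).trans
          (mul_le_mul_of_nonneg_left
            ((hq i).trans (by linarith [coord_le_barrierSym hcp hzp i])) hs0)
      rw [h2]
      have := mul_le_mul_of_nonneg_left h3 hfz0
      linarith
    calc ∑ i, η * (f i * v i) = η * ∑ i, f i * v i := by rw [Finset.mul_sum]
      _ ≤ η * ∑ i, s * (f i * z i * (2 + barrierSym c z)) := by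
          exact mul_le_mul_of_nonneg_left (Finset.sum_le_sum fun i _ => h1 i) hη.le
      _ = η * s * ((∑ i, f i * z i) * (2 + barrierSym c z)) := by
          rw [← Finset.mul_sum, ← Finset.sum_mul]; ring
      _ ≤ η * s * (G.bound * (2 + barrierSym c z)) := by gcongr
      _ = _ := by ring
  have t6 : -G.form v (c - z) ≤ 2 * s * G.bound := by
    have ha : |G.form v c| ≤ s * 1 * G.bound := G.abs_form_le_mul hc hc hs0 zero_le_one
      (fun i => by
        have := hv i
        rwa [abs_div, abs_of_pos (hcp i), div_le_iff₀ (hcp i)] at this)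
      (fun i => by rw [abs_of_pos (hcp i), one_mul])
    have hb : |G.form v z| ≤ s * 1 * G.bound := G.abs_form_le_mul hc hz hs0 zero_le_one
      (fun i => by
        have := hv i
        rwa [abs_div, abs_of_pos (hcp i), div_le_iff₀ (hcp i)] at this)
      (fun i => by rw [abs_of_pos (hzp i), one_mul])
    rw [map_sub]
    have := abs_le.1 ha
    have := abs_le.1 hb
    linarith
  -- Alternation gives `form c (c - z) = form z (c - z)`, so the path's loss is exchanged for the
  -- iterate's loss, the one that the estimates are unbiased for.
  have t7 : G.form (c + v) (c - z) = G.form z (c - z) + G.form v (c - z) := by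
    have h1 := G.form_self (c - z)
    have h2 : ∀ u, G.form (c - z) u = G.form c u - G.form z u := fun u => by
      rw [map_sub, LinearMap.sub_apply]
    rw [h2] at h1
    rw [map_add, LinearMap.add_apply]
    linarith
  have t8 : ∑ i, η * (f i * (c i - z i)) = η * ∑ i, f i * (c i - z i) := by
    rw [Finset.mul_sum]
  rw [t1, t7, t8] at hsum
  have hn : (0 : ℝ) ≤ Fintype.card I := Nat.cast_nonneg _
  set n : ℝ := (Fintype.card I : ℝ)
  set S := barrierSym c z
  set F := ∑ i, f i * (c i - z i)
  have u1 : η * (-G.form v (c - z)) ≤ η * (2 * s * G.bound) :=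
    mul_le_mul_of_nonneg_left t6 hη.le
  -- The regularization yields a drift `η τ S`; the errors caused by the motion of the path use at
  -- most half of it.
  have u2 : s * S + η * τ * s * S + η * s * (G.bound * S) ≤ η * τ / 2 * S := by
    have : s + η * τ * s + η * s * G.bound ≤ η * τ / 2 := by
      have : s * (η * τ + η * G.bound) ≤ s * 1 := by gcongr; linarith
      linarith
    have := mul_le_mul_of_nonneg_right this hS0
    linarith
  have hρ0 : 0 ≤ ρ := by positivity
  have hsρ : s ≤ ρ / 8 := by linarith
  have v1 : 2 * n * s ^ 2 ≤ n / 32 * ρ ^ 2 := by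
    have : s ^ 2 ≤ (ρ / 8) ^ 2 := by gcongr
    nlinarith
  have v2 : η * τ * s ≤ ρ * (ρ / 8) := by
    gcongr
    linarith
  have v3 : η * G.bound * s ≤ ρ * (ρ / 8) := by
    gcongr
    linarith
  have v4 : η * τ * s * (2 * n) ≤ ρ * (ρ / 8) * (2 * n) := by gcongr
  nlinarith

end SaddleProblem

/-! ### The deterministic path: existence, speed and gap. -/

namespace SaddleProblem

variable {I : Type*} [Fintype I] (G : SaddleProblem I)

/-- The step is the linear equation `b v = φ` on `V`. On the diagonal the alternating part of `b`
vanishes and a weighted Euclidean norm remains, so `b` is injective from `V` to its dual, hence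
surjective by dimension. -/
theorem exists_isFlowStep (η τ : ℝ) {c : I → ℝ} (hc : ∀ i, 0 < c i) :
    ∃ v, G.IsFlowStep η τ c v := by
  let b : (I → ℝ) →ₗ[ℝ] (I → ℝ) →ₗ[ℝ] ℝ := LinearMap.mk₂ ℝ
    (fun v w => ∑ i, v i * w i / c i ^ 2 + η * G.form v w)
    (fun v v' w => by
      simp only [Pi.add_apply, map_add, LinearMap.add_apply, add_mul, add_div,
        Finset.sum_add_distrib]
      ring)
    (fun r v w => by
      simp only [Pi.smul_apply, smul_eq_mul, map_smul, LinearMap.smul_apply, mul_add,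
        Finset.mul_sum]
      congr 1
      · exact Finset.sum_congr rfl fun i _ => by ring
      · ring)
    (fun v w w' => by
      simp only [Pi.add_apply, map_add, mul_add, add_div, Finset.sum_add_distrib]
      ring)
    (fun r v w => by
      simp only [Pi.smul_apply, smul_eq_mul, map_smul, mul_add, Finset.mul_sum]
      congr 1
      · exact Finset.sum_congr rfl fun i _ => by ring
      · ring)
  let φ : (I → ℝ) →ₗ[ℝ] ℝ :=
    { toFun := fun w => ∑ i, η * τ * w i / c i - η * G.form c w
      map_add' := fun w w' => by
        simp only [Pi.add_apply, map_add, mul_add, add_div, Finset.sum_add_distrib]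
        ring
      map_smul' := fun r w => by
        simp only [Pi.smul_apply, smul_eq_mul, map_smul, RingHom.id_apply, mul_sub,
          Finset.mul_sum]
        congr 1
        · exact Finset.sum_congr rfl fun i _ => by ring
        · ring }
  have hinj : Function.Injective (b.domRestrict₁₂ G.V G.V) := by
    rw [injective_iff_map_eq_zero]
    intro v hv
    have h : b v v = 0 := by
      have := congrArg (fun l => l v) hv
      exact this
    have h1 : ∑ i, (v : I → ℝ) i * (v : I → ℝ) i / c i ^ 2 = 0 := by
      have h2 : b v v = ∑ i, (v : I → ℝ) i * (v : I → ℝ) i / c i ^ 2 + η * G.form v v := rfl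
      rw [h2, G.form_self, mul_zero, add_zero] at h
      exact h
    have h3 := (Finset.sum_eq_zero_iff_of_nonneg
      (fun i _ => div_nonneg (mul_self_nonneg _) (sq_nonneg _))).1 h1
    ext i
    have h4 := h3 i (Finset.mem_univ i)
    rw [div_eq_zero_iff] at h4
    rcases h4 with h4 | h4
    · simpa using h4
    · exact absurd h4 (pow_ne_zero 2 (hc i).ne')
  have hsurj := (LinearMap.injective_iff_surjective_of_finrank_eq_finrank
    (Subspace.dual_finrank_eq (K := ℝ) (V := G.V)).symm).1 hinj
  obtain ⟨v, hv⟩ := hsurj (φ.comp G.V.subtype)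
  refine ⟨v, v.2, fun w hw => ?_⟩
  have h : b v w = φ w := by
    have := congrArg (fun l => l ⟨w, hw⟩) hv
    exact this
  have h2 : b v w = ∑ i, (v : I → ℝ) i * w i / c i ^ 2 + η * G.form v w := rfl
  have h3 : φ w = ∑ i, η * τ * w i / c i - η * G.form c w := rfl
  rw [h2, h3] at h
  have h4 : ∑ i, ((v : I → ℝ) i / c i - η * τ) * w i / c i =
      ∑ i, (v : I → ℝ) i * w i / c i ^ 2 - ∑ i, η * τ * w i / c i := by
    rw [← Finset.sum_sub_distrib]
    refine Finset.sum_congr rfl fun i _ => ?_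
    have := (hc i).ne'
    field_simp
  rw [h4, map_add, LinearMap.add_apply]
  linarith

lemma sum_abs_le_sqrt (a : I → ℝ) :
    ∑ i, |a i| ≤ √(Fintype.card I) * √(∑ i, a i ^ 2) := by
  have h := Finset.sum_mul_sq_le_sq_mul_sq Finset.univ (fun _ : I => (1 : ℝ)) (fun i => |a i|)
  simp only [one_mul, one_pow, sq_abs, Finset.sum_const, Finset.card_univ, nsmul_eq_mul,
    mul_one] at h
  rw [← Real.sqrt_mul (Nat.cast_nonneg _)]
  exact Real.le_sqrt_of_sq_le h

lemma sum_abs_mul_abs_le_sqrt (a b : I → ℝ) :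
    ∑ i, |a i| * |b i| ≤ √(∑ i, a i ^ 2) * √(∑ i, b i ^ 2) := by
  have h := Finset.sum_mul_sq_le_sq_mul_sq Finset.univ (fun i : I => |a i|) (fun i => |b i|)
  simp only [sq_abs] at h
  rw [← Real.sqrt_mul (Finset.sum_nonneg fun i _ => sq_nonneg _)]
  exact Real.le_sqrt_of_sq_le h

lemma abs_le_sqrt_sum_sq (a : I → ℝ) (i : I) : |a i| ≤ √(∑ i, a i ^ 2) := by
  apply Real.le_sqrt_of_sq_le
  rw [sq_abs]
  exact Finset.single_le_sum (f := fun i => a i ^ 2) (fun j _ => sq_nonneg _)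
    (Finset.mem_univ i)

/-- The speed of the flow contracts. -/
theorem flow_speed_le {η τ η' τ' s : ℝ} {c v v' : I → ℝ} (hη : 0 < η) (hη' : 0 < η')
    (hηη : η' ≤ η) (hτ : 0 < τ) (hcp : ∀ i, 0 < c i) (hcp' : ∀ i, 0 < (c + v) i)
    (hs : ∀ i, |v i / c i| ≤ s) (hs1 : s + η * τ ≤ 1)
    (h : G.IsFlowStep η τ c v) (h' : G.IsFlowStep η' τ' (c + v) v') :
    √(∑ i, (v' i / (c + v) i) ^ 2) ≤
      (1 + s - η' * τ) * √(∑ i, (v i / c i) ^ 2)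
        + η' * |τ' - τ| * √(Fintype.card I) := by
  set N := √(∑ i, (v i / c i) ^ 2)
  set N' := √(∑ i, (v' i / (c + v) i) ^ 2) with hN'
  have e1 := h.2 v' h'.1
  have e2 := h'.2 v' h'.1
  -- Here implicitness pays: both steps, tested on `v'`, involve the same value `form (c + v) v'`,
  -- which is then eliminated in favour of the ratio of the learning rates.
  have e3 : G.form (c + v + v') v' = G.form (c + v) v' := by
    rw [map_add, LinearMap.add_apply, G.form_self, add_zero]
  rw [e3] at e2
  have e4 : ∑ i, (v' i / (c + v) i - η' * τ') * v' i / (c + v) i =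
      η' / η * ∑ i, (v i / c i - η * τ) * v' i / c i := by
    rw [e1, e2]
    field_simp
  have e5 : ∑ i, (v' i / (c + v) i) ^ 2 =
      ∑ i, (v i / c i) * (v' i / (c + v) i) * (η' / η * (1 + v i / c i) - η' * τ)
        + ∑ i, η' * (τ' - τ) * (v' i / (c + v) i) := by
    rw [Finset.mul_sum] at e4
    have : ∑ i, ((v' i / (c + v) i) ^ 2
        - (v i / c i) * (v' i / (c + v) i) * (η' / η * (1 + v i / c i) - η' * τ)
        - η' * (τ' - τ) * (v' i / (c + v) i)) =
        ∑ i, ((v' i / (c + v) i - η' * τ') * v' i / (c + v) i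
          - η' / η * ((v i / c i - η * τ) * v' i / c i)) := by
      refine Finset.sum_congr rfl fun i _ => ?_
      have h1 := (hcp i).ne'
      have h2 := (hcp' i).ne'
      have h3 : v' i / c i = v' i / (c + v) i * (1 + v i / c i) := by
        simp only [Pi.add_apply] at h2 ⊢
        field_simp
      rw [mul_div_assoc, mul_div_assoc, h3]
      field_simp
      ring
    rw [Finset.sum_sub_distrib, Finset.sum_sub_distrib, Finset.sum_sub_distrib, e4] at this
    linarith
  have hsq : N' ^ 2 = ∑ i, (v' i / (c + v) i) ^ 2 :=
    Real.sq_sqrt (Finset.sum_nonneg fun i _ => sq_nonneg _)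
  have hr : η' / η ≤ 1 := (div_le_one hη).2 hηη
  have hr0 : 0 < η' / η := div_pos hη' hη
  have hfac : ∀ i, |η' / η * (1 + v i / c i) - η' * τ| ≤ 1 + s - η' * τ := by
    intro i
    have ha := abs_le.1 (hs i)
    have h1 : η' / η * (1 + v i / c i) - η' * τ = η' / η * (1 + v i / c i - η * τ) := by
      field_simp
    have h2 : 0 ≤ η' / η * (1 + v i / c i) - η' * τ := by
      rw [h1]
      exact mul_nonneg hr0.le (by linarith)
    rw [abs_of_nonneg h2]
    have h3 : 0 < η * τ := by positivity
    have h4 : η' / η * (1 + v i / c i) ≤ 1 * (1 + s) :=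
      mul_le_mul hr (by linarith) (by linarith) zero_le_one
    linarith
  have b1 : ∑ i, (v i / c i) * (v' i / (c + v) i) * (η' / η * (1 + v i / c i) - η' * τ) ≤
      (1 + s - η' * τ) * (N * N') := by
    calc _ ≤ ∑ i, (1 + s - η' * τ) * (|v i / c i| * |v' i / (c + v) i|) := by
          refine Finset.sum_le_sum fun i _ => ?_
          refine (le_abs_self _).trans ?_
          rw [abs_mul, abs_mul, mul_comm]
          exact mul_le_mul_of_nonneg_right (hfac i) (by positivity)
      _ = (1 + s - η' * τ) * ∑ i, |v i / c i| * |v' i / (c + v) i| := by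
          rw [Finset.mul_sum]
      _ ≤ _ := by
          rcases isEmpty_or_nonempty I with hI | ⟨⟨i⟩⟩
          · simp [N, N']
          · exact mul_le_mul_of_nonneg_left (sum_abs_mul_abs_le_sqrt _ _)
              ((abs_nonneg _).trans (hfac i))
  have b2 : ∑ i, η' * (τ' - τ) * (v' i / (c + v) i) ≤
      η' * |τ' - τ| * (√(Fintype.card I) * N') := by
    calc _ ≤ ∑ i, η' * |τ' - τ| * |v' i / (c + v) i| := by
          refine Finset.sum_le_sum fun i _ => ?_
          refine (le_abs_self _).trans ?_
          rw [abs_mul, abs_mul, abs_of_pos hη']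
      _ = η' * |τ' - τ| * ∑ i, |v' i / (c + v) i| := by rw [Finset.mul_sum]
      _ ≤ _ := mul_le_mul_of_nonneg_left (sum_abs_le_sqrt _) (by positivity)
  have hN0 : 0 ≤ N' := Real.sqrt_nonneg _
  rcases hN0.eq_or_lt with h0 | h0
  · rw [← h0]
    rcases isEmpty_or_nonempty I with hI | ⟨⟨i⟩⟩
    · simp [N]
    · have := (abs_nonneg _).trans (hfac i)
      positivity
  · refine le_of_mul_le_mul_right ?_ h0
    calc N' * N' = N' ^ 2 := by ring
      _ ≤ (1 + s - η' * τ) * (N * N') + η' * |τ' - τ| * (√(Fintype.card I) * N') := by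
          rw [hsq, e5]
          exact add_le_add b1 b2
      _ = _ := by ring

/-- At the analytic centre, the flow is slow. -/
theorem flow_speed_center_le {η τ : ℝ} {c v : I → ℝ} (hη : 0 < η) (hcQ : c ∈ G.Q)
    (hcp : ∀ i, 0 < c i) (hcen : ∀ w ∈ G.V, ∑ i, w i / c i = 0)
    (h : G.IsFlowStep η τ c v) :
    √(∑ i, (v i / c i) ^ 2) ≤ η * G.bound := by
  have e1 := h.2 v h.1
  rw [map_add, LinearMap.add_apply, G.form_self, add_zero] at e1
  have e2 := hcen v h.1
  set N := √(∑ i, (v i / c i) ^ 2)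
  have hsq : N ^ 2 = ∑ i, (v i / c i) ^ 2 :=
    Real.sq_sqrt (Finset.sum_nonneg fun i _ => sq_nonneg _)
  -- At the centre the barrier gradient vanishes on `V`, and `form v v = 0`; only the game term at
  -- `c` is left, which is linear in the relative speed.
  have e3 : N ^ 2 = -η * G.form c v := by
    rw [hsq, ← e1]
    have : ∑ i, (v i / c i - η * τ) * v i / c i =
        ∑ i, (v i / c i) ^ 2 - η * τ * ∑ i, v i / c i := by
      rw [Finset.mul_sum, ← Finset.sum_sub_distrib]
      refine Finset.sum_congr rfl fun i _ => by ring
    rw [this, e2]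
    ring
  have hN0 : 0 ≤ N := Real.sqrt_nonneg _
  have hb : |G.form c v| ≤ 1 * N * G.bound := G.abs_form_le_mul hcQ hcQ zero_le_one hN0
    (fun i => by rw [abs_of_pos (hcp i), one_mul])
    (fun i => by
      have := abs_le_sqrt_sum_sq (fun i => v i / c i) i
      rwa [abs_div, abs_of_pos (hcp i), div_le_iff₀ (hcp i)] at this)
  have hb' := (abs_le.1 hb).1
  rcases hN0.eq_or_lt with h0 | h0
  · rw [← h0]
    have := G.bound_pos
    positivity
  · refine le_of_mul_le_mul_right ?_ h0
    have := mul_le_mul_of_nonneg_left hb' hη.le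
    nlinarith

/-- Existence of the analytic centre. -/
theorem exists_center {z₀ : I → ℝ} (hz₀ : z₀ ∈ G.Q) (hz₀p : ∀ i, 0 < z₀ i) :
    ∃ c ∈ G.Q, (∀ i, 0 < c i) ∧ (∀ w ∈ G.V, ∑ i, w i / c i = 0) ∧
      ∑ i, Real.log (z₀ i) ≤ ∑ i, Real.log (c i) := by
  -- The product is maximized rather than the sum of logarithms, being continuous up to the boundary
  -- of `Q`; a positive maximum puts the maximizer in the interior.
  obtain ⟨c, hc, hmax⟩ := G.isCompact.exists_isMaxOn ⟨z₀, hz₀⟩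
    (f := fun z : I → ℝ => ∏ i, z i) (by fun_prop)
  have hprod : 0 < ∏ i, c i := lt_of_lt_of_le (Finset.prod_pos fun i _ => hz₀p i) (hmax hz₀)
  have hcp : ∀ i, 0 < c i := fun i => lt_of_le_of_ne (G.nonneg c hc i) fun h =>
    hprod.ne' (Finset.prod_eq_zero (Finset.mem_univ i) h.symm)
  have hlog : ∀ z ∈ G.Q, (∀ i, 0 < z i) → ∑ i, Real.log (z i) ≤ ∑ i, Real.log (c i) := by
    intro z hz hzp
    rw [← Real.log_prod (fun i _ => (hzp i).ne'), ← Real.log_prod (fun i _ => (hcp i).ne')]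
    exact Real.log_le_log (Finset.prod_pos fun i _ => hzp i) (hmax hz)
  refine ⟨c, hc, hcp, fun w hw => ?_, hlog z₀ hz₀ hz₀p⟩
  have hd : HasDerivAt (fun s : ℝ => ∑ i, Real.log (c i + s * w i)) (∑ i, w i / c i) 0 := by
    refine HasDerivAt.fun_sum fun i _ => ?_
    have h1 : HasDerivAt (fun s : ℝ => c i + s * w i) (w i) 0 := by
      simpa using ((hasDerivAt_id (0 : ℝ)).mul_const (w i)).const_add (c i)
    have h2 := h1.log (by simpa using (hcp i).ne')
    simpa using h2
  have hev : ∀ᶠ s : ℝ in nhds 0, ∀ i, 0 < c i + s * w i := by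
    rw [Filter.eventually_all]
    intro i
    have : ContinuousAt (fun s : ℝ => c i + s * w i) 0 := by fun_prop
    exact this.eventually_const_lt (by simpa using hcp i)
  have hloc : IsLocalMax (fun s : ℝ => ∑ i, Real.log (c i + s * w i)) 0 := by
    filter_upwards [hev] with s hs
    have hQ := G.add_mem c hc (s • w) (G.V.smul_mem s hw) (fun i => (hs i).le)
    have := hlog _ hQ (fun i => by simpa using hs i)
    simpa using this
  exact hloc.hasDerivAt_eq_zero hd

/-- The deterministic flow, started at the analytic centre, with its speed. -/
theorem exists_flow {η τ : ℕ → ℝ} {c₀ : I → ℝ} (hη : ∀ t, 0 < η t) (hηa : Antitone η)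
    (hτ : ∀ t, 0 < τ t) (hsmall : ∀ t, η t * τ t ≤ 1 / 4)
    (hkey : ∀ t, (1 + η t * τ t / 8 - η (t + 1) * τ t) * (η t * τ t / 8)
      + η (t + 1) * |τ (t + 1) - τ t| * √(Fintype.card I) ≤ η (t + 1) * τ (t + 1) / 8)
    (hτ0 : 8 * G.bound ≤ τ 0) (hc₀ : c₀ ∈ G.Q) (hc₀p : ∀ i, 0 < c₀ i)
    (hcen : ∀ w ∈ G.V, ∑ i, w i / c₀ i = 0) :
    ∃ c v : ℕ → I → ℝ, c 0 = c₀ ∧ ∀ t, c t ∈ G.Q ∧ (∀ i, 0 < c t i) ∧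
      G.IsFlowStep (η t) (τ t) (c t) (v t) ∧ c (t + 1) = c t + v t ∧
      ∀ i, |v t i / c t i| ≤ η t * τ t / 8 := by
  classical
  let step : ℕ → (I → ℝ) → I → ℝ := fun t c =>
    if h : ∃ v, G.IsFlowStep (η t) (τ t) c v then h.choose else 0
  have hstep : ∀ t c, (∀ i, 0 < c i) → G.IsFlowStep (η t) (τ t) c (step t c) := by
    intro t c hc
    have h := G.exists_isFlowStep (η t) (τ t) hc
    simp only [step, dif_pos h]
    exact h.choose_spec
  let c : ℕ → I → ℝ := fun t => Nat.rec c₀ (fun t c => c + step t c) t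
  have hsucc : ∀ t, c (t + 1) = c t + step t (c t) := fun t => rfl
  have main : ∀ t, c t ∈ G.Q ∧ (∀ i, 0 < c t i) ∧
      √(∑ i, (step t (c t) i / c t i) ^ 2) ≤ η t * τ t / 8 := by
    intro t
    induction t with
    | zero =>
      refine ⟨hc₀, hc₀p, ?_⟩
      refine (G.flow_speed_center_le (hη 0) hc₀ hc₀p hcen (hstep 0 c₀ hc₀p)).trans ?_
      have := mul_le_mul_of_nonneg_left hτ0 (hη 0).le
      linarith
    | succ t ih =>
      obtain ⟨hQ, hp, hN⟩ := ih
      have ha : ∀ i, |step t (c t) i / c t i| ≤ η t * τ t / 8 := fun i =>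
        (abs_le_sqrt_sum_sq (fun i => step t (c t) i / c t i) i).trans hN
      have hp' : ∀ i, 0 < (c t + step t (c t)) i := by
        intro i
        have h1 := (abs_le.1 (ha i)).1
        have h2 : (c t + step t (c t)) i = c t i * (1 + step t (c t) i / c t i) := by
          have := (hp i).ne'
          simp only [Pi.add_apply]
          field_simp
        rw [h2]
        exact mul_pos (hp i) (by linarith [hsmall t])
      have hQ' : c t + step t (c t) ∈ G.Q :=
        G.add_mem _ hQ _ (hstep t _ hp).1 fun i => (hp' i).le
      refine ⟨hQ', hp', ?_⟩
      have hsp := G.flow_speed_le (hη t) (hη (t + 1)) (hηa (Nat.le_succ t)) (hτ t) hp hp' ha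
        (by linarith [hsmall t, mul_pos (hη t) (hτ t)]) (hstep t _ hp)
        (hstep (t + 1) _ hp')
      refine hsp.trans (le_trans ?_ (hkey t))
      gcongr
      have h1 : η (t + 1) * τ t ≤ η t * τ t :=
        mul_le_mul_of_nonneg_right (hηa (Nat.le_succ t)) (hτ t).le
      linarith [hsmall t, mul_pos (hη t) (hτ t)]
  exact ⟨c, fun t => step t (c t), rfl, fun t => ⟨(main t).1, (main t).2.1,
    hstep t _ (main t).2.1, hsucc t, fun i =>
      (abs_le_sqrt_sum_sq (fun i => step t (c t) i / c t i) i).trans (main t).2.2⟩⟩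

/-- The gap at a point close to the flow. -/
theorem form_gap_le {η τ e : ℝ} {c v z z' : I → ℝ} (hη : 0 < η) (hτ : 0 < τ)
    (hητ : η * τ ≤ 1 / 8) (he0 : 0 ≤ e) (he : e ≤ 1 / 16)
    (hcp : ∀ i, 0 < c i) (hz : z ∈ G.Q) (hzp : ∀ i, 0 < z i)
    (hz' : z' ∈ G.Q) (hv : ∀ i, |v i / c i| ≤ η * τ / 8)
    (hclose : ∀ i, |(c + v) i / z i - 1| ≤ e) (hflow : G.IsFlowStep η τ c v) :
    G.form z (z - z') ≤ 5 / 4 * Fintype.card I * τ + 2 * e * G.bound := by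
  have e1 := hflow.2 _ (G.sub_mem z hz z' hz')
  -- The flow equation solved for the form: the gap at `c + v` is a sum of relative coordinates with
  -- weights close to `τ`.
  have h1 : G.form (c + v) (z - z') = ∑ i, (τ - v i / c i / η) * (z - z') i / c i := by
    have h2 : G.form (c + v) (z - z') =
        -η⁻¹ * ∑ i, (v i / c i - η * τ) * (z - z') i / c i := by
      rw [e1]
      field_simp
    rw [h2, Finset.mul_sum]
    refine Finset.sum_congr rfl fun i _ => ?_
    have := (hcp i).ne'
    field_simp
    ring
  have h2 : ∀ i, (τ - v i / c i / η) * (z - z') i / c i ≤ 5 / 4 * τ := by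
    intro i
    have ha := abs_le.1 (hv i)
    have ha1 : v i / c i / η ≤ τ / 8 := by
      rw [div_le_iff₀ hη]; linarith
    have ha2 : -(τ / 8) ≤ v i / c i / η := by
      rw [le_div_iff₀ hη]; linarith
    have hq := abs_le.1 (hclose i)
    -- The factor `65/64` is `1 + η τ / 8` at its largest, and `16/15` is `1 / (1 - e)` at `e =
    -- 1/16`.
    have hr : z i / c i ≤ 65 / 64 * (16 / 15) := by
      have h3 : (c + v) i / z i = c i / z i * (1 + v i / c i) := by
        have := (hcp i).ne'
        simp only [Pi.add_apply]
        field_simp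
      have hqp := div_pos (hcp i) (hzp i)
      have h4 : 15 / 16 ≤ c i / z i * (65 / 64) := by
        have : c i / z i * (1 + v i / c i) ≤ c i / z i * (65 / 64) :=
          mul_le_mul_of_nonneg_left (by linarith) hqp.le
        rw [h3] at hq
        linarith
      rw [← inv_div]
      rw [inv_le_comm₀ hqp (by norm_num)]
      norm_num
      linarith
    have hz0 := G.nonneg z' hz' i
    have h5 : (z - z') i / c i ≤ z i / c i := by
      apply div_le_div_of_nonneg_right _ (hcp i).le
      simp only [Pi.sub_apply]
      linarith
    rw [mul_div_assoc]
    calc (τ - v i / c i / η) * ((z - z') i / c i) ≤ (τ - v i / c i / η) * (z i / c i) :=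
          mul_le_mul_of_nonneg_left h5 (by linarith)
      _ ≤ (9 / 8 * τ) * (65 / 64 * (16 / 15)) :=
          mul_le_mul (by linarith) hr (div_pos (hzp i) (hcp i)).le (by linarith)
      _ ≤ 5 / 4 * τ := by linarith
  have h3 : G.form (c + v) (z - z') ≤ 5 / 4 * Fintype.card I * τ := by
    rw [h1]
    calc _ ≤ ∑ _i : I, 5 / 4 * τ := Finset.sum_le_sum fun i _ => h2 i
      _ = _ := by simp; ring
  have hd : ∀ i, |(z - (c + v)) i| ≤ e * z i := by
    intro i
    have h4 : (z - (c + v)) i = -((c + v) i / z i - 1) * z i := by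
      have := (hzp i).ne'
      simp only [Pi.sub_apply, Pi.add_apply]
      field_simp
      ring
    rw [h4, abs_mul, abs_neg, abs_of_pos (hzp i)]
    exact mul_le_mul_of_nonneg_right (hclose i) (hzp i).le
  have h4 : |G.form (z - (c + v)) z| ≤ e * 1 * G.bound :=
    G.abs_form_le_mul hz hz he0 zero_le_one hd (fun i => by
      rw [abs_of_pos (hzp i), one_mul])
  have h5 : |G.form (z - (c + v)) z'| ≤ e * 1 * G.bound :=
    G.abs_form_le_mul hz hz' he0 zero_le_one hd (fun i => by
      rw [abs_of_nonneg (G.nonneg z' hz' i), one_mul])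
  have h6 : G.form z (z - z') = G.form (c + v) (z - z')
      + (G.form (z - (c + v)) z - G.form (z - (c + v)) z') := by
    rw [← map_sub, ← LinearMap.add_apply, ← map_add]
    congr 2
    abel
  have := abs_le.1 h4
  have := abs_le.1 h5
  linarith

end SaddleProblem

/-! ### Exponential moments up to a stopping level, and a maximal inequality. -/

section Probability

/-- The measures `P` restricted to `s` and `P` with density `p` agree on `m`, by definition of
conditional expectation; an `m`-measurable `f` sees no difference. No integrability of `f` is
needed. -/
lemma setLIntegral_eq_of_condExp_indicator {Ω : Type*} {m mΩ : MeasurableSpace Ω}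
    {P : Measure Ω} [IsProbabilityMeasure P] (hm : m ≤ mΩ) {s : Set Ω} (hs : MeasurableSet s) {p : Ω → ℝ}
    (hp : Measurable[m] p) (hp0 : ∀ ω, 0 ≤ p ω)
    (h : P[s.indicator (fun _ => (1 : ℝ)) | m] =ᵐ[P] p) {f : Ω → ENNReal}
    (hf : Measurable[m] f) :
    ∫⁻ ω in s, f ω ∂P = ∫⁻ ω, ENNReal.ofReal (p ω) * f ω ∂P := by
  have hpm : Measurable p := hp.mono hm le_rfl
  have hfm : Measurable f := hf.mono hm le_rfl
  have hint : Integrable (s.indicator (fun _ => (1 : ℝ))) P :=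
    (integrable_const 1).indicator hs
  have hpint : Integrable p P := integrable_condExp.congr h
  have hmeas : (P.restrict s).trim hm = (P.withDensity fun ω => ENNReal.ofReal (p ω)).trim hm := by
    refine @Measure.ext _ m _ _ fun u hu => ?_
    have hu' := hm u hu
    rw [trim_measurableSet_eq hm hu, trim_measurableSet_eq hm hu, Measure.restrict_apply hu',
      withDensity_apply _ hu',
      ← ofReal_integral_eq_lintegral_ofReal hpint.integrableOn
        (Filter.Eventually.of_forall fun ω => hp0 ω)]
    have h1 : ∫ ω in u, p ω ∂P = ∫ ω in u, s.indicator (fun _ => (1 : ℝ)) ω ∂P := by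
      rw [← setIntegral_condExp hm hint hu]
      exact setIntegral_congr_ae hu' (h.mono fun ω hω _ => hω.symm)
    rw [h1, integral_indicator hs, Measure.restrict_restrict hs, setIntegral_const, smul_eq_mul,
      mul_one, measureReal_def, ENNReal.ofReal_toReal (measure_ne_top _ _), Set.inter_comm]
  calc ∫⁻ ω in s, f ω ∂P = ∫⁻ ω, f ω ∂((P.restrict s).trim hm) := (lintegral_trim hm hf).symm
    _ = ∫⁻ ω, f ω ∂(P.withDensity fun ω => ENNReal.ofReal (p ω)) := by
        rw [hmeas, lintegral_trim hm hf]
    _ = _ := by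
        rw [lintegral_withDensity_eq_lintegral_mul _ hpm.ennreal_ofReal hfm]
        rfl

variable {Ω : Type*} {mΩ : MeasurableSpace Ω} {P : Measure Ω} [IsProbabilityMeasure P] {ℱ : Filtration ℕ mΩ}
  {ζ : Type*} [Fintype ζ] {Z : ℕ → Ω → ζ} {p g : ℕ → ζ → Ω → ℝ} {X : ℕ → Ω → ℝ}
  {r k : ℕ → ℝ} {R U : ℝ}

/-- Propagation of an exponential moment of a process that is updated from random plays, as
long as it stays below the level `R`. -/
theorem setLIntegral_exp_le (hZ : ∀ t z, MeasurableSet {ω | Z t ω = z})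
    (hp : ∀ t z, Measurable[ℱ t] (p t z)) (hp0 : ∀ t z ω, 0 ≤ p t z ω)
    (hlaw : ∀ t z, P[Set.indicator {ω | Z t ω = z} (fun _ => (1 : ℝ)) | ℱ t] =ᵐ[P] p t z)
    (hX : ∀ t, Measurable[ℱ t] (X t)) (hg : ∀ t z, Measurable[ℱ t] (g t z))
    (hg0 : ∀ t z ω, 0 ≤ g t z ω) (hk0 : ∀ t, 0 ≤ k t) (hk1 : ∀ t, k t ≤ 1)
    (hinit : ∀ ω, Real.exp (r 0 * X 0 ω) ≤ U)
    (hstep : ∀ t ω, X t ω ≤ R → Real.exp (r (t + 1) * X (t + 1) ω) ≤ g t (Z t ω) ω)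
    (hmean : ∀ t ω, X t ω ≤ R →
      ∑ z, p t z ω * g t z ω ≤ (1 - k t) * Real.exp (r t * X t ω) + k t * U) (t : ℕ) :
    ∫⁻ ω in {ω | ∀ s < t, X s ω ≤ R}, ENNReal.ofReal (Real.exp (r t * X t ω)) ∂P
      ≤ ENNReal.ofReal U := by
  have hprob : ∀ s : Set Ω, P s ≤ 1 := fun s => prob_le_one
  have hΩ : Nonempty Ω := by
    by_contra h
    rw [not_nonempty_iff] at h
    have := measure_univ (μ := P)
    rw [Set.univ_eq_empty_iff.2 h, measure_empty] at this
    exact zero_ne_one this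
  have hU : 0 ≤ U := (Real.exp_pos _).le.trans (hinit hΩ.some)
  have hXm : ∀ t, Measurable (X t) := fun t => (hX t).mono (ℱ.le t) le_rfl
  induction t with
  | zero =>
    calc _ ≤ ∫⁻ _ω in {ω | ∀ s < 0, X s ω ≤ R}, ENNReal.ofReal U ∂P :=
          lintegral_mono fun ω => ENNReal.ofReal_le_ofReal (hinit ω)
      _ ≤ ENNReal.ofReal U := by
          rw [setLIntegral_const]
          exact mul_le_of_le_one_right' (hprob _)
  | succ t ih =>
    -- The event involves times up to `t` only, so it is known before the play of iteration `t` is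
    -- drawn.
    set G : Set Ω := {ω | ∀ s < t + 1, X s ω ≤ R}
    have hG : MeasurableSet[ℱ t] G := by
      have : G = ⋂ s, ⋂ (_ : s < t + 1), {ω | X s ω ≤ R} := by
        ext ω; simp [G]
      rw [this]
      refine MeasurableSet.iInter fun s => MeasurableSet.iInter fun hs => ?_
      have hX' : Measurable[ℱ t] (X s) := (hX s).mono (ℱ.mono (Nat.lt_succ_iff.1 hs)) le_rfl
      exact hX' measurableSet_Iic
    have hG' : MeasurableSet G := ℱ.le t _ hG
    have hGX : ∀ ω ∈ G, X t ω ≤ R := fun ω hω => hω t (Nat.lt_succ_self t)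
    calc ∫⁻ ω in G, ENNReal.ofReal (Real.exp (r (t + 1) * X (t + 1) ω)) ∂P
        ≤ ∫⁻ ω in G, ENNReal.ofReal (g t (Z t ω) ω) ∂P :=
          setLIntegral_mono' hG' fun ω hω => ENNReal.ofReal_le_ofReal (hstep t ω (hGX ω hω))
      -- Splitting by the value of the play makes each integrand measurable with respect to the
      -- past.
      _ = ∫⁻ ω, ∑ z, {ω | Z t ω = z}.indicator
            (G.indicator fun ω => ENNReal.ofReal (g t z ω)) ω ∂P := by
          rw [← lintegral_indicator hG']
          refine lintegral_congr fun ω => ?_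
          rw [Finset.sum_eq_single (Z t ω)]
          · by_cases hω : ω ∈ G <;> simp [hω]
          · intro z _ hz
            simp [Ne.symm hz]
          · simp
      _ = ∑ z, ∫⁻ ω, ENNReal.ofReal (p t z ω) *
            (G.indicator fun ω => ENNReal.ofReal (g t z ω)) ω ∂P := by
          rw [lintegral_finsetSum']
          · refine Finset.sum_congr rfl fun z _ => ?_
            rw [lintegral_indicator (hZ t z)]
            exact setLIntegral_eq_of_condExp_indicator (ℱ.le t) (hZ t z) (hp t z) (hp0 t z)
              (hlaw t z) (Measurable.indicator (hg t z).ennreal_ofReal hG)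
          · intro z _
            exact ((((hg t z).mono (ℱ.le t) le_rfl).ennreal_ofReal.indicator hG').indicator
              (hZ t z)).aemeasurable
      _ = ∫⁻ ω in G, ENNReal.ofReal (∑ z, p t z ω * g t z ω) ∂P := by
          rw [← lintegral_finsetSum', ← lintegral_indicator hG']
          · refine lintegral_congr fun ω => ?_
            by_cases hω : ω ∈ G
            · simp only [Set.indicator_of_mem hω]
              rw [ENNReal.ofReal_sum_of_nonneg fun z _ => mul_nonneg (hp0 t z ω) (hg0 t z ω)]
              exact Finset.sum_congr rfl fun z _ => (ENNReal.ofReal_mul (hp0 t z ω)).symm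
            · simp [hω]
          · intro z _
            exact (((hp t z).mono (ℱ.le t) le_rfl).ennreal_ofReal.mul
              (((hg t z).mono (ℱ.le t) le_rfl).ennreal_ofReal.indicator hG')).aemeasurable
      _ ≤ ∫⁻ ω in G, (ENNReal.ofReal (1 - k t) * ENNReal.ofReal (Real.exp (r t * X t ω))
            + ENNReal.ofReal (k t * U)) ∂P := by
          refine setLIntegral_mono' hG' fun ω hω => ?_
          refine (ENNReal.ofReal_le_ofReal (hmean t ω (hGX ω hω))).trans ?_
          rw [ENNReal.ofReal_add (mul_nonneg (by linarith [hk1 t]) (Real.exp_pos _).le)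
            (mul_nonneg (hk0 t) hU), ENNReal.ofReal_mul (by linarith [hk1 t])]
      _ ≤ ENNReal.ofReal (1 - k t) * ENNReal.ofReal U + ENNReal.ofReal (k t * U) := by
          rw [lintegral_add_right _ measurable_const, lintegral_const_mul' _ _ ENNReal.ofReal_ne_top,
            setLIntegral_const]
          refine add_le_add (mul_le_mul_right (le_trans ?_ ih) _)
            (mul_le_of_le_one_right' (hprob _))
          exact lintegral_mono_set fun ω hω s hs => hω s (Nat.lt_succ_of_lt hs)
      _ = ENNReal.ofReal U := by
          rw [← ENNReal.ofReal_mul (by linarith [hk1 t]), ← ENNReal.ofReal_add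
            (mul_nonneg (by linarith [hk1 t]) hU) (mul_nonneg (hk0 t) hU)]
          congr 1
          ring

/-- A maximal inequality with time-dependent levels, from exponential moments. -/
theorem le_measureReal_forall_le {b w : ℕ → ℝ} {δ : ℝ} (hδ : 0 < δ)
    (hX : ∀ t, Measurable (X t))
    (hmom : ∀ t, ∫⁻ ω in {ω | ∀ s < t, X s ω ≤ R}, ENNReal.ofReal (Real.exp (r t * X t ω)) ∂P
      ≤ ENNReal.ofReal U)
    (hr : ∀ t, 0 ≤ r t) (hb : ∀ t, b t ≤ R)
    (hw : ∀ t, U ≤ δ * w t * Real.exp (r t * b t)) (hw0 : ∀ t, 0 ≤ w t)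
    (hsum : ∀ n, ∑ t ∈ Finset.range n, w t ≤ 1) :
    1 - δ ≤ P.real {ω | ∀ t, X t ω ≤ b t} := by
  set A : ℕ → Set Ω := fun t => {ω | ∀ s < t, X s ω ≤ R} ∩ {ω | b t < X t ω}
  have hA : ∀ t, P (A t) ≤ ENNReal.ofReal (δ * w t) := by
    intro t
    have hGm : MeasurableSet {ω | ∀ s < t, X s ω ≤ R} := by
      have : {ω | ∀ s < t, X s ω ≤ R} = ⋂ s, ⋂ (_ : s < t), {ω | X s ω ≤ R} := by
        ext ω; simp
      rw [this]
      exact MeasurableSet.iInter fun s => MeasurableSet.iInter fun _ => hX s measurableSet_Iic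
    have hAm : MeasurableSet (A t) := hGm.inter (hX t measurableSet_Ioi)
    have he := Real.exp_pos (r t * b t)
    have h1 : ENNReal.ofReal (Real.exp (r t * b t)) * P (A t) ≤ ENNReal.ofReal U := by
      calc _ = ∫⁻ _ω in A t, ENNReal.ofReal (Real.exp (r t * b t)) ∂P := by
            rw [setLIntegral_const]
        _ ≤ ∫⁻ ω in A t, ENNReal.ofReal (Real.exp (r t * X t ω)) ∂P := by
            refine setLIntegral_mono' hAm fun ω hω => ENNReal.ofReal_le_ofReal ?_
            exact Real.exp_le_exp.2 (mul_le_mul_of_nonneg_left (le_of_lt hω.2) (hr t))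
        _ ≤ _ := (lintegral_mono_set Set.inter_subset_left).trans (hmom t)
    have h2 : ENNReal.ofReal U ≤
        ENNReal.ofReal (Real.exp (r t * b t)) * ENNReal.ofReal (δ * w t) := by
      rw [← ENNReal.ofReal_mul he.le]
      exact ENNReal.ofReal_le_ofReal (by rw [mul_comm]; exact hw t)
    exact (ENNReal.mul_le_mul_iff_right (by simpa using he) ENNReal.ofReal_ne_top).1
      (h1.trans h2)
  -- At the first crossing time all earlier values are below `b s ≤ R`, so the moment bound on the
  -- stopped event applies.
  have hsub : {ω | ∀ t, X t ω ≤ b t}ᶜ ⊆ ⋃ t, A t := by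
    intro ω hω
    simp only [Set.mem_compl_iff, Set.mem_ofPred_eq, not_forall, not_le] at hω
    classical
    refine Set.mem_iUnion.2 ⟨Nat.find hω, fun s hs => ?_, Nat.find_spec hω⟩
    exact (not_lt.1 (Nat.find_min hω hs)).trans (hb s)
  have hc : P {ω | ∀ t, X t ω ≤ b t}ᶜ ≤ ENNReal.ofReal δ := by
    calc _ ≤ ∑' t, P (A t) := (measure_mono hsub).trans (measure_iUnion_le _)
      _ ≤ ∑' t, ENNReal.ofReal (δ * w t) := ENNReal.tsum_le_tsum hA
      _ ≤ ENNReal.ofReal δ := by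
          refine ENNReal.tsum_le_of_sum_range_le fun n => ?_
          rw [← ENNReal.ofReal_sum_of_nonneg fun t _ => mul_nonneg hδ.le (hw0 t),
            ← Finset.mul_sum]
          refine ENNReal.ofReal_le_ofReal ?_
          have := mul_le_mul_of_nonneg_left (hsum n) hδ.le
          linarith
  have hm : MeasurableSet {ω | ∀ t, X t ω ≤ b t} := by
    rw [Set.ofPred_forall]
    exact MeasurableSet.iInter fun t => hX t measurableSet_Iic
  have h3 := probReal_compl_eq_one_sub (μ := P) hm
  have h4 : P.real {ω | ∀ t, X t ω ≤ b t}ᶜ ≤ δ := by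
    rw [measureReal_def]
    exact ENNReal.toReal_le_of_le_ofReal hδ.le hc
  linarith

end Probability

/-! ### Schedules and the tracking theorem. -/

/-- The level below which the divergence to the flow is kept: a constant as long as the
regularization is strong, then of the order of its square. -/
noncomputable def divLevel (R : ℝ) (τ : ℕ → ℝ) (t : ℕ) : ℝ :=
  -- By `abs_ratio_sub_one_le` the second level means a relative distance at most `3 τ / 48 = τ /
  -- 16`.
  if 1 ≤ τ t then R else (τ t / 48) ^ 2

/-- The relations between the learning rates `η`, the regularization `τ`, the inverse
temperatures `r`, the contraction rates `k` and the weights `w` that the tracking uses. -/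
structure IsSchedule (K d₀ R δ : ℝ) (η τ r k w : ℕ → ℝ) (u : ℝ) : Prop where
  eta_pos : ∀ t, 0 < η t
  eta_anti : Antitone η
  tau_pos : ∀ t, 0 < τ t
  small : ∀ t, η t * τ t + η t * (2 * K) ≤ 1 / 8
  -- The induction step for the speed bound `η τ / 8` of the path.
  speed : ∀ t, (1 + η t * τ t / 8 - η (t + 1) * τ t) * (η t * τ t / 8)
      + η (t + 1) * |τ (t + 1) - τ t| * √K ≤ η (t + 1) * τ (t + 1) / 8
  tau_zero : 16 * K ≤ τ 0
  tau_succ : ∀ t, τ t ≤ 7 / 5 * τ (t + 1)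
  r_nonneg : ∀ t, 0 ≤ r t
  -- The exponent of the noise stays in `[-1, 1]`, where `exp x ≤ 1 + x + x²`.
  r_small : ∀ t, r (t + 1) * (η t * (4 * K * (2 * R + 2))) ≤ 1
  -- The second-order term of the noise uses at most half of the drift `η τ / 2`.
  r_tau : ∀ t, r (t + 1) * (η t * (16 * K ^ 2 * (2 * R + 2))) ≤ τ t / 4
  k_nonneg : ∀ t, 0 ≤ k t
  k_le_one : ∀ t, k t ≤ 1
  contract : ∀ t, r (t + 1) * (1 - η t * τ t / 4) ≤ (1 - k t) * r t
  drift : ∀ t, r (t + 1) * ((9 * K + 1) * (η t * τ t + η t * (2 * K)) ^ 2) ≤ k t * u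
  init : r 0 * d₀ ≤ u
  -- Markov's inequality at the level of time `t` then costs probability at most `δ * w t`.
  level : ∀ t, Real.exp u ≤ δ * w t * Real.exp (r t * divLevel R τ t)
  w_nonneg : ∀ t, 0 ≤ w t
  w_sum : ∀ n, ∑ t ∈ Finset.range n, w t ≤ 1
  one_le : 1 ≤ R

lemma sum_mul_exp_le {ζ : Type*} [Fintype ζ] {p x : ζ → ℝ} {y : ℝ} (hp : ∀ z, 0 ≤ p z)
    (hp1 : ∑ z, p z = 1) (hx : ∑ z, p z * x z = 0) (hx1 : ∀ z, |x z| ≤ 1)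
    (hy : ∀ z, x z ^ 2 ≤ y) : ∑ z, p z * Real.exp (x z) ≤ Real.exp y := by
  calc ∑ z, p z * Real.exp (x z) ≤ ∑ z, (p z * (1 + y) + p z * x z) := by
        refine Finset.sum_le_sum fun z _ => ?_
        rw [← mul_add]
        refine mul_le_mul_of_nonneg_left ?_ (hp z)
        have := (abs_le.1 (Real.abs_exp_sub_one_sub_id_le (hx1 z))).2
        linarith [hy z]
    _ = 1 + y := by
        rw [Finset.sum_add_distrib, hx, ← Finset.sum_mul, hp1]
        ring
    _ ≤ Real.exp y := by linarith [Real.add_one_le_exp y]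

namespace SaddleProblem

variable {I : Type*} [Fintype I] (G : SaddleProblem I)

/-- The fluctuation of the estimate is controlled by the relative distance to the flow. -/
lemma abs_fluctuation_le {f c z : I → ℝ} {x : ℝ} (hx : 0 ≤ x) (hz : z ∈ G.Q)
    (hzp : ∀ i, 0 < z i) (hf : ∀ i, 0 ≤ f i) (hfz : ∑ i, f i * z i ≤ G.bound)
    (h : ∀ i, |c i / z i - 1| ≤ x) :
    |∑ i, f i * (c i - z i) - G.form z (c - z)| ≤ 2 * G.bound * x := by
  have h0 : ∀ i, |c i - z i| ≤ x * z i := by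
    intro i
    have h4 : c i - z i = (c i / z i - 1) * z i := by
      have := (hzp i).ne'
      field_simp
    rw [h4, abs_mul, abs_of_pos (hzp i)]
    exact mul_le_mul_of_nonneg_right (h i) (hzp i).le
  have h1 : |∑ i, f i * (c i - z i)| ≤ G.bound * x := by
    calc _ ≤ ∑ i, |f i * (c i - z i)| := Finset.abs_sum_le_sum_abs _ _
      _ ≤ ∑ i, f i * z i * x := by
          refine Finset.sum_le_sum fun i _ => ?_
          rw [abs_mul, abs_of_nonneg (hf i)]
          have := mul_le_mul_of_nonneg_left (h0 i) (hf i)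
          linarith
      _ = (∑ i, f i * z i) * x := by rw [Finset.sum_mul]
      _ ≤ _ := mul_le_mul_of_nonneg_right hfz hx
  have h2 : |G.form z (c - z)| ≤ 1 * x * G.bound :=
    G.abs_form_le_mul hz hz zero_le_one hx (fun i => by rw [abs_of_pos (hzp i), one_mul]) h0
  calc _ ≤ |∑ i, f i * (c i - z i)| + |G.form z (c - z)| := abs_sub _ _
    _ ≤ _ := by linarith

/-- As `c` has the larger sum of logarithms, the logarithmic part of the divergence is nonpositive;
the ratios are at most `1 / m`. -/
lemma barrierDiv_center_le {c z : I → ℝ} {m : ℝ} (hm : 0 < m) (hc : c ∈ G.Q)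
    (hcp : ∀ i, 0 < c i) (hz : ∀ i, m ≤ z i)
    (h : ∑ i, Real.log (z i) ≤ ∑ i, Real.log (c i)) :
    barrierDiv c z ≤ Fintype.card I * m⁻¹ := by
  have hzp : ∀ i, 0 < z i := fun i => hm.trans_le (hz i)
  have h1 : ∀ i, c i / z i - 1 - Real.log (c i / z i) ≤
      m⁻¹ + (Real.log (z i) - Real.log (c i)) := by
    intro i
    rw [Real.log_div (hcp i).ne' (hzp i).ne']
    have : c i / z i ≤ 1 / m := div_le_div₀ zero_le_one (G.le_one c hc i) hm (hz i)
    rw [one_div] at this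
    linarith
  calc barrierDiv c z ≤ ∑ i, (m⁻¹ + (Real.log (z i) - Real.log (c i))) :=
        Finset.sum_le_sum fun i _ => h1 i
    _ ≤ _ := by
        rw [Finset.sum_add_distrib, Finset.sum_sub_distrib]
        simp only [Finset.sum_const, Finset.card_univ, nsmul_eq_mul]
        linarith

variable {Ω : Type*} {mΩ : MeasurableSpace Ω} {P : Measure Ω} [IsProbabilityMeasure P]
  {ℱ : Filtration ℕ mΩ} {ζ : Type*} [Fintype ζ]

/-- Regularized mirror descent with unbiased estimates has a small gap, at all times at once. -/
theorem gap_le_of_isSchedule {K δ m R u : ℝ} {η τ r k w : ℕ → ℝ}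
    (hK : K = Fintype.card I) (hbound : G.bound = 2 * K) (hδ : 0 < δ) (hm : 0 < m)
    (hsch : IsSchedule K (K * m⁻¹) R δ η τ r k w u)
    {Z : ℕ → Ω → ζ} {p : ℕ → ζ → Ω → ℝ} {z : ℕ → Ω → I → ℝ} {f : ℕ → ζ → Ω → I → ℝ}
    (hZ : ∀ t j, MeasurableSet {ω | Z t ω = j})
    (hp : ∀ t j, Measurable[ℱ t] (p t j)) (hp0 : ∀ t j ω, 0 ≤ p t j ω)
    (hp1 : ∀ t ω, ∑ j, p t j ω = 1)
    (hlaw : ∀ t j, P[Set.indicator {ω | Z t ω = j} (fun _ => (1 : ℝ)) | ℱ t] =ᵐ[P] p t j)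
    (hzm : ∀ t i, Measurable[ℱ t] fun ω => z t ω i) (hzQ : ∀ t ω, z t ω ∈ G.Q)
    (hzp : ∀ t ω i, 0 < z t ω i) (hz0 : ∀ ω ω', z 0 ω = z 0 ω') (hz0m : ∀ ω i, m ≤ z 0 ω i)
    (hfm : ∀ t j i, Measurable[ℱ t] fun ω => f t j ω i) (hf0 : ∀ t j ω i, 0 ≤ f t j ω i)
    (hfz : ∀ t j ω, ∑ i, f t j ω i * z t ω i ≤ G.bound)
    (hunb : ∀ t ω, ∀ x ∈ G.V, ∑ j, p t j ω * ∑ i, f t j ω i * x i = G.form (z t ω) x)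
    (hstep : ∀ t ω, G.IsBarrierStep (η t) (τ t) (f t (Z t ω) ω) (z t ω) (z (t + 1) ω)) :
    1 - δ ≤ P.real {ω | ∀ t, τ t < 1 → ∀ z' ∈ G.Q,
      G.form (z t ω) (z t ω - z') ≤ 2 * K * τ t} := by
  have hΩ : Nonempty Ω := by
    by_contra h
    rw [not_nonempty_iff] at h
    have := measure_univ (μ := P)
    rw [Set.univ_eq_empty_iff.2 h, measure_empty] at this
    exact zero_ne_one this
  obtain ⟨ω₀⟩ := hΩ
  have hK0 : 0 < K := by
    have := G.bound_pos
    linarith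
  have hR := hsch.one_le
  have hητ : ∀ t, 0 < η t * τ t := fun t => mul_pos (hsch.eta_pos t) (hsch.tau_pos t)
  have hηK : ∀ t, 0 < η t * (2 * K) := fun t => mul_pos (hsch.eta_pos t) (by linarith)
  obtain ⟨c₀, hc₀, hc₀p, hcen, hlog⟩ := G.exists_center (hzQ 0 ω₀) (hzp 0 ω₀)
  obtain ⟨c, v, hc0, hc⟩ := G.exists_flow hsch.eta_pos hsch.eta_anti hsch.tau_pos
    (fun t => by linarith [hsch.small t, hηK t]) (by rw [← hK]; exact hsch.speed)
    (by rw [hbound]; linarith [hsch.tau_zero]) hc₀ hc₀p hcen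
  set X : ℕ → Ω → ℝ := fun t ω => barrierDiv (c t) (z t ω) with hXdef
  set M : ℕ → ζ → Ω → ℝ := fun t j ω =>
    ∑ i, f t j ω i * (c t i - z t ω i) - G.form (z t ω) (c t - z t ω) with hMdef
  set E : ℕ → ℝ := fun t => (9 * K + 1) * (η t * τ t + η t * (2 * K)) ^ 2 with hEdef
  set g : ℕ → ζ → Ω → ℝ := fun t j ω => Real.exp (r (t + 1) *
    (X t ω - η t * τ t / 2 * barrierSym (c t) (z t ω) + η t * M t j ω + E t)) with hgdef
  have hXm : ∀ t, Measurable[ℱ t] (X t) := by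
    intro t
    refine Finset.measurable_fun_sum _ fun i _ => ?_
    have h1 := hzm t i
    have h2 : Measurable[ℱ t] fun ω => c t i / z t ω i := measurable_const.div h1
    exact (h2.sub_const 1).sub (Real.measurable_log.comp h2)
  have hSm : ∀ t, Measurable[ℱ t] fun ω => barrierSym (c t) (z t ω) := by
    intro t
    refine Finset.measurable_fun_sum _ fun i _ => ?_
    exact ((measurable_const.div (hzm t i)).add ((hzm t i).div_const _)).sub_const 2
  have hMm : ∀ t j, Measurable[ℱ t] (M t j) := by
    intro t j
    refine Measurable.sub ?_ ?_
    · exact Finset.measurable_fun_sum _ fun i _ =>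
        (hfm t j i).mul (measurable_const.sub (hzm t i))
    · have h1 : (fun ω => G.form (z t ω) (c t - z t ω)) =
          fun ω => G.form.flip (c t) (z t ω) := by
        funext ω
        rw [map_sub, G.form_self, sub_zero, LinearMap.flip_apply]
      rw [h1]
      have h2 : Continuous (G.form.flip (c t)) := LinearMap.continuous_of_finiteDimensional _
      exact h2.measurable.comp (@measurable_pi_lambda _ _ _ (ℱ t) _ _ (hzm t))
  have hgm : ∀ t j, Measurable[ℱ t] (g t j) := by
    intro t j
    refine Real.measurable_exp.comp (Measurable.const_mul ?_ _)
    exact (((hXm t).sub ((hSm t).const_mul _)).add ((hMm t j).const_mul _)).add_const _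
  have hX0 : ∀ ω, X 0 ω ≤ K * m⁻¹ := by
    intro ω
    rw [hK]
    simp only [hXdef, hc0]
    rw [hz0 ω ω₀]
    exact G.barrierDiv_center_le hm hc₀ hc₀p (hz0m ω₀) hlog
  have hcp := fun t => (hc t).2.1
  have hmom := setLIntegral_exp_le (P := P) (ℱ := ℱ) (Z := Z) (p := p) (g := g) (X := X)
    (r := r) (k := k) (R := R) (U := Real.exp u) hZ hp hp0 hlaw hXm hgm
    (fun t j ω => (Real.exp_pos _).le) hsch.k_nonneg hsch.k_le_one
    (fun ω => Real.exp_le_exp.2 ((mul_le_mul_of_nonneg_left (hX0 ω) (hsch.r_nonneg 0)).trans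
      hsch.init))
    (by
      intro t ω _
      refine Real.exp_le_exp.2 (mul_le_mul_of_nonneg_left ?_ (hsch.r_nonneg _))
      have h1 := G.barrierDiv_step (hsch.eta_pos t) (hsch.tau_pos t)
        (by rw [hbound]; linarith [hsch.small t]) (by linarith [hητ t]) le_rfl (hc t).1
        (by rw [← (hc t).2.2.2.1]; exact (hc (t + 1)).1) (hzQ t ω) (hzQ (t + 1) ω) (hcp t)
        (hzp t ω) (hzp (t + 1) ω) (hc t).2.2.2.2 (hf0 t (Z t ω) ω) (hfz t (Z t ω) ω)
        (hc t).2.2.1 (hstep t ω)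
      rw [← (hc t).2.2.2.1, hbound, ← hK] at h1
      exact h1)
    (by
      intro t ω hω
      have hS := barrierSym_nonneg (hcp t) (hzp t ω)
      have hXS : X t ω ≤ barrierSym (c t) (z t ω) := barrierDiv_le_barrierSym (hcp t) (hzp t ω)
      set S := barrierSym (c t) (z t ω)
      have hr := hsch.r_nonneg (t + 1)
      have hη := hsch.eta_pos t
      have hM1 : ∀ j, |M t j ω| ≤ 4 * K * (2 * R + 2) := by
        intro j
        have := G.abs_fluctuation_le (by linarith) (hzQ t ω) (hzp t ω) (hf0 t j ω) (hfz t j ω)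
          (fun i => abs_ratio_sub_one_le_of_le (hcp t) (hzp t ω) (by linarith) hω i)
        rw [hbound] at this
        linarith
      have hM2 : ∀ j, M t j ω ^ 2 ≤ 16 * K ^ 2 * (2 * R + 2) * S := by
        intro j
        have hRS : 0 ≤ (2 * R + 2) * S := mul_nonneg (by linarith) hS
        have h1 := G.abs_fluctuation_le (Real.sqrt_nonneg ((2 * R + 2) * S)) (hzQ t ω)
          (hzp t ω) (hf0 t j ω) (hfz t j ω)
          (fun i => Real.le_sqrt_of_sq_le (by
            rw [sq_abs]
            exact ratio_sub_one_sq_le (hcp t) (hzp t ω) (by linarith) hω i))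
        rw [hbound] at h1
        have h2 : M t j ω ^ 2 ≤ (2 * (2 * K) * √((2 * R + 2) * S)) ^ 2 := by
          rw [← sq_abs]
          exact pow_le_pow_left₀ (abs_nonneg _) h1 2
        rw [mul_pow, Real.sq_sqrt hRS] at h2
        linarith
      -- The noise is centred because `c t - z t` is tangent, and its square is bounded by `S`; half
      -- of the drift pays for it.
      have h1 : ∑ j, p t j ω * Real.exp (r (t + 1) * (η t * M t j ω)) ≤
          Real.exp (r (t + 1) * (η t * τ t / 4 * S)) := by
        refine sum_mul_exp_le (fun j => hp0 t j ω) (hp1 t ω) ?_ ?_ ?_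
        · have h2 : ∑ j, p t j ω * M t j ω = 0 := by
            simp only [hMdef, mul_sub, Finset.sum_sub_distrib, ← Finset.sum_mul, hp1, one_mul]
            have := hunb t ω _ (G.sub_mem _ (hc t).1 _ (hzQ t ω))
            simp only [Pi.sub_apply] at this
            simp only [mul_sub, Finset.sum_sub_distrib] at this
            rw [this, sub_self]
          calc _ = r (t + 1) * η t * ∑ j, p t j ω * M t j ω := by
                rw [Finset.mul_sum]
                exact Finset.sum_congr rfl fun j _ => by ring
            _ = 0 := by rw [h2, mul_zero]
        · intro j
          rw [abs_mul, abs_mul, abs_of_nonneg hr, abs_of_pos hη]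
          refine le_trans ?_ (hsch.r_small t)
          exact mul_le_mul_of_nonneg_left (mul_le_mul_of_nonneg_left (hM1 j) hη.le) hr
        · intro j
          calc (r (t + 1) * (η t * M t j ω)) ^ 2 = r (t + 1) * η t * (r (t + 1) * η t)
                * M t j ω ^ 2 := by ring
            _ ≤ r (t + 1) * η t * (r (t + 1) * η t) * (16 * K ^ 2 * (2 * R + 2) * S) :=
                mul_le_mul_of_nonneg_left (hM2 j) (by positivity)
            _ = r (t + 1) * η t * S * (r (t + 1) * (η t * (16 * K ^ 2 * (2 * R + 2)))) := by
                ring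
            _ ≤ r (t + 1) * η t * S * (τ t / 4) :=
                mul_le_mul_of_nonneg_left (hsch.r_tau t) (by positivity)
            _ = _ := by ring
      have h2 : ∑ j, p t j ω * g t j ω = Real.exp (r (t + 1) *
          (X t ω - η t * τ t / 2 * S + E t)) *
            ∑ j, p t j ω * Real.exp (r (t + 1) * (η t * M t j ω)) := by
        rw [Finset.mul_sum]
        refine Finset.sum_congr rfl fun j _ => ?_
        rw [mul_left_comm, ← Real.exp_add]
        simp only [hgdef]
        congr 2
        ring
      have hXpos : 0 ≤ X t ω := barrierDiv_nonneg (hcp t) (hzp t ω)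
      calc ∑ j, p t j ω * g t j ω ≤ Real.exp (r (t + 1) *
            (X t ω - η t * τ t / 2 * S + E t)) * Real.exp (r (t + 1) * (η t * τ t / 4 * S)) := by
            rw [h2]
            exact mul_le_mul_of_nonneg_left h1 (Real.exp_pos _).le
        _ = Real.exp (r (t + 1) * (X t ω - η t * τ t / 4 * S) + r (t + 1) * E t) := by
            rw [← Real.exp_add]
            congr 1
            ring
        _ ≤ Real.exp ((1 - k t) * (r t * X t ω) + k t * u) := by
            refine Real.exp_le_exp.2 (add_le_add ?_ (hsch.drift t))
            calc r (t + 1) * (X t ω - η t * τ t / 4 * S)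
                ≤ r (t + 1) * (X t ω - η t * τ t / 4 * X t ω) := by
                  refine mul_le_mul_of_nonneg_left ?_ hr
                  have := mul_le_mul_of_nonneg_left hXS (by linarith [hητ t] :
                    0 ≤ η t * τ t / 4)
                  linarith
              _ = r (t + 1) * (1 - η t * τ t / 4) * X t ω := by ring
              _ ≤ (1 - k t) * r t * X t ω :=
                  mul_le_mul_of_nonneg_right (hsch.contract t) hXpos
              _ = _ := by ring
        -- Convexity of `exp`; the bound `exp u` is a fixed point of the resulting recursion.
        _ ≤ (1 - k t) * Real.exp (r t * X t ω) + k t * Real.exp u := by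
            have := convexOn_exp.2 (Set.mem_univ (r t * X t ω)) (Set.mem_univ u)
              (by linarith [hsch.k_le_one t] : 0 ≤ 1 - k t) (hsch.k_nonneg t) (by ring)
            simpa only [smul_eq_mul] using this)
  have hlevel : ∀ t, divLevel R τ t ≤ R := by
    intro t
    unfold divLevel
    split_ifs with h
    · exact le_rfl
    · push Not at h
      have := hsch.tau_pos t
      have : (τ t / 48) ^ 2 ≤ 1 ^ 2 := by gcongr; linarith
      linarith
  have hmax := le_measureReal_forall_le (P := P) (R := R) (r := r) (U := Real.exp u)
    (b := divLevel R τ) hδ (fun t => (hXm t).mono (ℱ.le t) le_rfl) hmom hsch.r_nonneg hlevel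
    hsch.level hsch.w_nonneg hsch.w_sum
  refine hmax.trans (measureReal_mono ?_ (measure_ne_top _ _))
  intro ω hω t ht z' hz'
  have hXt : barrierDiv (c t) (z t ω) ≤ (τ t / 48) ^ 2 := by
    have := hω t
    rwa [divLevel, if_neg (not_le.2 ht)] at this
  have hK1 : 1 ≤ 2 * K := by
    rw [← hbound]; exact G.one_le_bound
  cases t with
  -- Excluded: `τ 0 ≥ 16 K ≥ 8`, while `τ t < 1`.
  | zero =>
    have := hsch.tau_zero
    linarith
  | succ t =>
    have hτ := hsch.tau_pos (t + 1)
    have hclose := abs_ratio_sub_one_le (hcp (t + 1)) (hzp (t + 1) ω) (by positivity)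
      (by linarith) hXt
    rw [(hc t).2.2.2.1] at hclose
    have hgap := G.form_gap_le (hsch.eta_pos t) (hsch.tau_pos t)
      (by linarith [hsch.small t, hηK t]) (by positivity) (by linarith) (hcp t)
      (hzQ (t + 1) ω) (hzp (t + 1) ω) hz' (hc t).2.2.2.2 hclose (hc t).2.2.1
    rw [hbound, ← hK] at hgap
    -- The gap is read from the flow step that led to `c (t + 1)`, so it involves the previous `τ`:
    -- `(5/4)(7/5) + 1/4 = 2`.
    have h1 := mul_le_mul_of_nonneg_left (hsch.tau_succ t) hK0.le
    linarith

end SaddleProblem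

/-! ### The parameters of the algorithm form a schedule. -/

section Schedule

/-- The scale of the inverse temperatures. -/
noncomputable def tempScale (K d₀ : ℝ) : ℝ := 1 / (128 * K ^ 2 * (2 * (d₀ + 1) + 2))

lemma tempScale_pos {K d₀ : ℝ} (hK : 1 ≤ K) (hd : 0 ≤ d₀) : 0 < tempScale K d₀ := by
  unfold tempScale
  positivity

lemma sum_inv_sq_le_one {T₀ : ℕ} (hT : 2 ≤ T₀) (n : ℕ) :
    ∑ t ∈ Finset.range n, 1 / ((t : ℝ) + T₀) ^ 2 ≤ 1 := by
  have hT' : (2 : ℝ) ≤ T₀ := by exact_mod_cast hT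
  -- Telescoping with `1 / y² ≤ 1 / (y - 1) - 1 / y`.
  have h : ∑ t ∈ Finset.range n, 1 / ((t : ℝ) + T₀) ^ 2 ≤ 1 - 1 / ((n : ℝ) + T₀ - 1) := by
    induction n with
    | zero =>
      simp only [Finset.range_zero, Finset.sum_empty, Nat.cast_zero, zero_add]
      have : 1 / ((T₀ : ℝ) - 1) ≤ 1 := by
        rw [div_le_one (by linarith)]
        linarith
      linarith
    | succ n ih =>
      rw [Finset.sum_range_succ]
      have hn : (0 : ℝ) ≤ n := Nat.cast_nonneg n
      set y : ℝ := (n : ℝ) + T₀ with hy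
      have hy2 : 2 ≤ y := by linarith
      have e : ((n + 1 : ℕ) : ℝ) + T₀ - 1 = y := by push_cast; ring
      rw [e]
      have h1 : 1 / y ^ 2 ≤ 1 / (y - 1) - 1 / y := by
        rw [div_sub_div _ _ (by linarith) (by linarith), div_le_div_iff₀ (by positivity)
          (mul_pos (by linarith) (by linarith))]
        nlinarith
      linarith
  have hn : (0 : ℝ) ≤ n := Nat.cast_nonneg n
  have : 0 ≤ 1 / ((n : ℝ) + T₀ - 1) := div_nonneg zero_le_one (by linarith)
  linarith

/-- It makes the fourth root of time grow by a factor at least `1 + y / 8`, with `y` the inverse of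
the time; the logarithm, being at least `8`, grows by no more, so the regularization decreases. -/
lemma one_add_div_eight_pow_le {y : ℝ} (h0 : 0 ≤ y) (h1 : y ≤ 1) :
    (1 + y / 8) ^ 4 ≤ 1 + y := by
  have h2 : y ^ 2 ≤ y := by nlinarith
  have h3 : y ^ 3 ≤ y := by nlinarith
  have h4 : y ^ 4 ≤ y := by nlinarith
  nlinarith

set_option maxHeartbeats 2000000 in
/-- The schedule with `η t = η / p³` and `τ t = τ L / p`, for `p` a fourth root of the time. -/
theorem isSchedule_of_root {K d₀ δ η τ : ℝ} {p L : ℕ → ℝ} (hK : 1 ≤ K) (hd : 0 ≤ d₀)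
    (hη : 0 < η) (hτ : 1 ≤ τ) (hητ : 15 * K ≤ η * τ)
    (hp2 : ∀ t, 4 ≤ p t ^ 4) (hp0 : ∀ t, 1 ≤ p t) (hp : ∀ t, p (t + 1) ^ 4 = p t ^ 4 + 1)
    (hL8 : ∀ t, 8 ≤ L t) (hLL : ∀ t, L t ≤ L (t + 1))
    (hLs : ∀ t, L (t + 1) ≤ L t + 1 / p t ^ 4)
    (hη1 : 2 * K * η ≤ 1 / 16) (hη2 : 20736 * K * η ≤ tempScale K d₀)
    (hη3 : 2 * (η * (L 0 / p 0)) ≤ tempScale K d₀ / 2)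
    (hσ1 : η * τ * L 0 / p 0 ^ 4 ≤ 1 / 16)
    (hσ2 : 3 * K * (η * τ * L 0 / p 0 ^ 4) ≤ tempScale K d₀ / 2)
    (hs1 : 16 * K ≤ τ * L 0 / p 0) (hs2 : 6912 * d₀ ≤ τ * L 0 / p 0)
    (hδ : ∀ t, Real.exp (-(2 * L t)) ≤ δ * (1 / (p t ^ 4) ^ 2))
    (hw : ∀ n, ∑ t ∈ Finset.range n, 1 / (p t ^ 4) ^ 2 ≤ 1) :
    ∃ r k w : ℕ → ℝ, ∃ u : ℝ, IsSchedule K d₀ (d₀ + 1) δ (fun t => η / p t ^ 3)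
      (fun t => τ * L t / p t) r k w u := by
  set κ := tempScale K d₀ with hκdef
  have hκ : 0 < κ := tempScale_pos hK hd
  have hκ1 : κ * (128 * K ^ 2 * (2 * (d₀ + 1) + 2)) = 1 := by
    rw [hκdef, tempScale]
    field_simp
  have hK0 : 0 < K := by linarith
  have hτ0 : 0 < τ := by linarith
  have hpp : ∀ t, 0 < p t := fun t => by linarith [hp0 t]
  have hLp : ∀ t, 0 < L t := fun t => by linarith [hL8 t]
  set e : ℕ → ℝ := fun t => η / p t ^ 3 with he
  set s : ℕ → ℝ := fun t => τ * L t / p t with hs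
  have he0 : ∀ t, 0 < e t := fun t => div_pos hη (pow_pos (hpp t) 3)
  have hs0 : ∀ t, 0 < s t := fun t => div_pos (mul_pos hτ0 (hLp t)) (hpp t)
  have hσ : ∀ t, e t * s t = η * τ * L t / p t ^ 4 := fun t => by
    simp only [he, hs]
    have := (hpp t).ne'
    field_simp
  have hpmono : ∀ t, p t ≤ p (t + 1) := fun t => by
    refine le_of_pow_le_pow_left₀ (n := 4) (by norm_num) (hpp _).le ?_
    rw [hp]
    linarith
  have hx0 : ∀ t, 0 < p t ^ 4 := fun t => by linarith [hp2 t]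
  have hone : ∀ t, 1 + 1 / p t ^ 4 = p (t + 1) ^ 4 / p t ^ 4 := fun t => by
    rw [hp]
    have := (hpp t).ne'
    field_simp
  have he1 : ∀ t, e (t + 1) ≤ e t := fun t => by
    simp only [he]
    exact div_le_div_of_nonneg_left hη.le (pow_pos (hpp t) 3)
      (pow_le_pow_left₀ (hpp t).le (hpmono t) 3)
  have he2 : ∀ t, e t ≤ (1 + 1 / p t ^ 4) * e (t + 1) := fun t => by
    rw [hone]
    simp only [he]
    have h1 := hpp t
    have h2 := hpp (t + 1)
    have h3 : p (t + 1) ^ 4 / p t ^ 4 * (η / p (t + 1) ^ 3) =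
        η / p t ^ 3 * (p (t + 1) / p t) := by
      field_simp
    rw [h3]
    exact le_mul_of_one_le_right (by positivity) ((one_le_div h1).2 (hpmono t))
  have hs3 : ∀ t, s (t + 1) ≤ s t := fun t => by
    simp only [hs]
    have h1 := hpp t
    have h2 := hpp (t + 1)
    have hy : 1 / p t ^ 4 ≤ 1 := by
      rw [div_le_one (hx0 t)]
      linarith [hp2 t]
    have hy0 : 0 < 1 / p t ^ 4 := div_pos one_pos (hx0 t)
    have h3 : (1 + 1 / p t ^ 4 / 8) * p t ≤ p (t + 1) := by
      refine le_of_pow_le_pow_left₀ (n := 4) (by norm_num) h2.le ?_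
      rw [mul_pow, hp]
      have h4 := mul_le_mul_of_nonneg_right (one_add_div_eight_pow_le hy0.le hy) (hx0 t).le
      have h5 : (1 + 1 / p t ^ 4) * p t ^ 4 = p t ^ 4 + 1 := by
        have := h1.ne'
        field_simp
      linarith
    have h6 : L (t + 1) ≤ L t * (1 + 1 / p t ^ 4 / 8) := by
      have := mul_le_mul_of_nonneg_right (hL8 t) hy0.le
      linarith [hLs t]
    rw [div_le_div_iff₀ h2 h1]
    calc τ * L (t + 1) * p t ≤ τ * (L t * (1 + 1 / p t ^ 4 / 8)) * p t := by gcongr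
      _ = τ * L t * ((1 + 1 / p t ^ 4 / 8) * p t) := by ring
      _ ≤ τ * L t * p (t + 1) :=
        mul_le_mul_of_nonneg_left h3 (mul_pos hτ0 (hLp t)).le
  have hs4 : ∀ t, s t ≤ (1 + 1 / p t ^ 4) * s (t + 1) := fun t => by
    rw [hone]
    simp only [hs]
    have h1 := hpp t
    have h2 := hpp (t + 1)
    have h3 : p (t + 1) ^ 4 / p t ^ 4 * (τ * L (t + 1) / p (t + 1)) =
        τ * L (t + 1) / p t * (p (t + 1) / p t) ^ 3 := by
      field_simp
    rw [h3]
    have h4 : 1 ≤ (p (t + 1) / p t) ^ 3 := one_le_pow₀ ((one_le_div h1).2 (hpmono t))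
    calc τ * L t / p t ≤ τ * L (t + 1) / p t := by
          gcongr
          exact hLL t
      _ ≤ _ := le_mul_of_one_le_right
          (div_pos (mul_pos hτ0 (hLp _)) h1).le h4
  have hsa : Antitone s := antitone_nat_of_succ_le hs3
  have hea : Antitone e := antitone_nat_of_succ_le he1
  have hσa : ∀ t, e t * s t ≤ e 0 * s 0 := fun t =>
    mul_le_mul (hea (Nat.zero_le t)) (hsa (Nat.zero_le t)) (hs0 t).le (he0 0).le
  -- The contraction rate beats the relative change of the parameters in one step, which is about `1
  -- / p t ^ 4`. The constant is `15 K * 8`.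
  have hσx : ∀ t, 120 * K / p t ^ 4 ≤ e t * s t := fun t => by
    rw [hσ]
    refine div_le_div_of_nonneg_right ?_ (hx0 t).le
    have := mul_le_mul hητ (hL8 t) (by norm_num) (by positivity)
    linarith
  have hσx' : ∀ t, 120 * K * (1 / p t ^ 4) ≤ e t * s t := fun t => by
    have := hσx t
    rwa [div_eq_mul_one_div] at this
  have heη : ∀ t, e t ≤ η := fun t => div_le_self hη.le (one_le_pow₀ (hp0 t))
  have hxi : ∀ t, 1 / p t ^ 4 ≤ 1 / 4 := fun t =>
    one_div_le_one_div_of_le (by norm_num) (hp2 t)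
  have hxi0 : ∀ t, 0 < 1 / p t ^ 4 := fun t => div_pos one_pos (hx0 t)
  have hsmall : ∀ t, e t * s t ≤ 1 / 16 := fun t => by
    refine (hσa t).trans ?_
    rw [hσ]
    exact hσ1
  have hs01 : 1 ≤ s 0 := by
    simp only [hs]
    linarith
  have hK2 : K ≤ K ^ 2 := by nlinarith
  -- the inverse temperatures
  set r : ℕ → ℝ := fun t => κ * min 1 (s t) / e t with hr
  have hmin0 : ∀ t, 0 < min 1 (s t) := fun t => lt_min one_pos (hs0 t)
  have hr0 : ∀ t, 0 < r t := fun t => div_pos (mul_pos hκ (hmin0 t)) (he0 t)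
  have hrr : ∀ t, r (t + 1) ≤ (1 + 1 / p t ^ 4) * r t := fun t => by
    simp only [hr]
    rw [div_le_iff₀ (he0 (t + 1))]
    have h1 : min 1 (s (t + 1)) ≤ min 1 (s t) := min_le_min le_rfl (hs3 t)
    calc κ * min 1 (s (t + 1)) ≤ κ * min 1 (s t) := by gcongr
      _ = κ * min 1 (s t) / e t * e t := by
          have := (he0 t).ne'
          field_simp
      _ ≤ κ * min 1 (s t) / e t * ((1 + 1 / p t ^ 4) * e (t + 1)) :=
          mul_le_mul_of_nonneg_left (he2 t) (hr0 t).le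
      _ = _ := by ring
  have hre : ∀ t, r (t + 1) * e t ≤ 2 * κ * min 1 (s t) := fun t => by
    have h1 : r (t + 1) ≤ 2 * r t :=
      (hrr t).trans (mul_le_mul_of_nonneg_right (by linarith [hxi t]) (hr0 t).le)
    calc r (t + 1) * e t ≤ 2 * r t * e t := mul_le_mul_of_nonneg_right h1 (he0 t).le
      _ = 2 * κ * min 1 (s t) := by
          simp only [hr]
          have := (he0 t).ne'
          field_simp
  -- The two parts of `u` cover the initial divergence `r 0 * d₀` and the stationary level of the
  -- second-order error. The rate `k` is half of the drift that the noise leaves, the other half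
  -- paying for the growth of `r`.
  refine ⟨r, fun t => e t * s t / 8, fun t => 1 / (p t ^ 4) ^ 2,
    κ * d₀ / e 0 + 3 * K * s 0, ?_⟩
  refine
  { eta_pos := he0
    eta_anti := hea
    tau_pos := hs0
    small := fun t => ?_
    speed := fun t => ?_
    tau_zero := hs1
    tau_succ := fun t => ?_
    r_nonneg := fun t => (hr0 t).le
    r_small := fun t => ?_
    r_tau := fun t => ?_
    k_nonneg := fun t => by have := mul_pos (he0 t) (hs0 t); positivity
    k_le_one := fun t => by linarith [hsmall t]
    contract := fun t => ?_
    drift := fun t => ?_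
    init := ?_
    level := fun t => ?_
    w_nonneg := fun t => by positivity
    w_sum := hw
    one_le := by linarith }
  · have := mul_le_mul_of_nonneg_right (heη t) (by positivity : 0 ≤ 2 * K)
    linarith [hsmall t]
  · set σ := e t * s t with hσdef
    set y := 1 / p t ^ 4 with hy
    have hσ0 : 0 < σ := mul_pos (he0 t) (hs0 t)
    have hy0 : 0 < y := hxi0 t
    have hy1 : y ≤ 1 / 4 := hxi t
    have a0 : (1 - y) * e t ≤ e (t + 1) := by
      have h1 := mul_le_mul_of_nonneg_left (he2 t) (by linarith : 0 ≤ 1 - y)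
      have h2 : (1 - y) * ((1 + y) * e (t + 1)) ≤ e (t + 1) := by nlinarith [mul_nonneg (sq_nonneg y) (he0 (t + 1)).le]
      linarith
    have a1 : σ * (1 - y) ≤ e (t + 1) * s t := by
      have := mul_le_mul_of_nonneg_right a0 (hs0 t).le
      linarith
    have a2 : (1 - y) * s t ≤ s (t + 1) := by
      have h1 := mul_le_mul_of_nonneg_left (hs4 t) (by linarith : 0 ≤ 1 - y)
      have h2 : (1 - y) * ((1 + y) * s (t + 1)) ≤ s (t + 1) := by nlinarith [mul_nonneg (sq_nonneg y) (hs0 (t + 1)).le]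
      linarith
    have a3 : |s (t + 1) - s t| ≤ y * s t := by
      rw [abs_le]
      constructor
      · linarith
      · have := mul_pos hy0 (hs0 t)
        linarith [hs3 t]
    have a4 : e (t + 1) * |s (t + 1) - s t| ≤ y * σ := by
      calc _ ≤ e t * (y * s t) :=
            mul_le_mul (he1 t) a3 (abs_nonneg _) (he0 t).le
        _ = _ := by rw [hσdef]; ring
    have a5 : √K ≤ K := by
      rw [Real.sqrt_le_left (by linarith)]
      exact hK2
    have a6 : e (t + 1) * |s (t + 1) - s t| * √K ≤ y * σ * K :=
      mul_le_mul a4 a5 (Real.sqrt_nonneg _) (by positivity)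
    have a7 : σ * (1 - y) ≤ e (t + 1) * s (t + 1) := by
      have hxi' := hone t
      have h1 : e (t + 1) * s (t + 1) = η * τ * L (t + 1) / p (t + 1) ^ 4 := hσ (t + 1)
      have h2 : σ = η * τ * L t / p t ^ 4 := hσ t
      have h3 : (1 - y) / p t ^ 4 ≤ 1 / p (t + 1) ^ 4 := by
        rw [hp, div_le_div_iff₀ (hx0 t) (by linarith [hx0 t])]
        have h4 : y * p t ^ 4 = 1 := by
          exact one_div_mul_cancel (hx0 t).ne'
        nlinarith
      have h5 : 0 < η * τ := by positivity
      calc σ * (1 - y) = η * τ * L t * ((1 - y) / p t ^ 4) := by rw [h2]; ring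
        _ ≤ η * τ * L (t + 1) * (1 / p (t + 1) ^ 4) := by
            refine mul_le_mul ?_ h3 (div_nonneg (by linarith) (hx0 t).le)
              (mul_pos h5 (hLp _)).le
            exact mul_le_mul_of_nonneg_left (hLL t) h5.le
        _ = _ := by rw [h1]; ring
    have a8 : 120 * K * y ≤ σ := hσx' t
    have a9 : (1 + σ / 8 - e (t + 1) * s t) * (σ / 8) ≤ (1 + σ / 8 - σ * (1 - y)) * (σ / 8) :=
      mul_le_mul_of_nonneg_right (by linarith) (by linarith)
    have b1 : 8 * y * K + y ≤ σ * (7 / 8 - y) := by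
      have h1 : σ * (5 / 8) ≤ σ * (7 / 8 - y) := mul_le_mul_of_nonneg_left (by linarith) hσ0.le
      have h2 : y ≤ K * y := le_mul_of_one_le_left hy0.le hK
      linarith
    have b2 := mul_le_mul_of_nonneg_left b1 hσ0.le
    linarith
  · refine (hs4 t).trans (mul_le_mul_of_nonneg_right ?_ (hs0 _).le)
    linarith [hxi t]
  · have h1 : 0 ≤ 4 * K * (2 * (d₀ + 1) + 2) := by positivity
    have h2 : min 1 (s t) ≤ 1 := min_le_left _ _
    have h3 : 0 ≤ κ * (d₀ + 2) := by positivity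
    calc r (t + 1) * (e t * (4 * K * (2 * (d₀ + 1) + 2)))
        = r (t + 1) * e t * (4 * K * (2 * (d₀ + 1) + 2)) := by ring
      _ ≤ 2 * κ * min 1 (s t) * (4 * K * (2 * (d₀ + 1) + 2)) :=
          mul_le_mul_of_nonneg_right (hre t) h1
      _ ≤ 2 * κ * 1 * (4 * K ^ 2 * (2 * (d₀ + 1) + 2)) := by gcongr
      _ ≤ 1 := by linarith
  · have h1 : 0 ≤ 16 * K ^ 2 * (2 * (d₀ + 1) + 2) := by positivity
    have h2 : min 1 (s t) ≤ s t := min_le_right _ _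
    calc r (t + 1) * (e t * (16 * K ^ 2 * (2 * (d₀ + 1) + 2)))
        = r (t + 1) * e t * (16 * K ^ 2 * (2 * (d₀ + 1) + 2)) := by ring
      _ ≤ 2 * κ * min 1 (s t) * (16 * K ^ 2 * (2 * (d₀ + 1) + 2)) :=
          mul_le_mul_of_nonneg_right (hre t) h1
      _ ≤ 2 * κ * s t * (16 * K ^ 2 * (2 * (d₀ + 1) + 2)) := by gcongr
      _ = κ * (128 * K ^ 2 * (2 * (d₀ + 1) + 2)) * (s t / 4) := by ring
      _ = s t / 4 := by rw [hκ1, one_mul]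
  · have hσs := hsmall t
    have hσ0 : 0 < e t * s t := mul_pos (he0 t) (hs0 t)
    have h8 := hσx' t
    set σ := e t * s t
    have h1 : 1 / p t ^ 4 ≤ σ / 8 := by
      have := le_mul_of_one_le_left (hxi0 t).le hK
      linarith
    calc r (t + 1) * (1 - σ / 4) ≤ (1 + 1 / p t ^ 4) * r t * (1 - σ / 4) :=
          mul_le_mul_of_nonneg_right (hrr t) (by linarith)
      _ ≤ (1 + σ / 8) * r t * (1 - σ / 4) := by
          refine mul_le_mul_of_nonneg_right (mul_le_mul_of_nonneg_right ?_ (hr0 t).le)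
            (by linarith)
          linarith
      _ = (1 + σ / 8) * (1 - σ / 4) * r t := by ring
      _ ≤ (1 - σ / 8) * r t := by
          refine mul_le_mul_of_nonneg_right ?_ (hr0 t).le
          nlinarith
  · have hst : s t ≤ s 0 := hsa (Nat.zero_le t)
    -- In both regimes the bound is linear in `s t`, as needed for comparison with `k t = e t * s t
    -- / 8`.
    have h1 : min 1 (s t) * (s t + 2 * K) ^ 2 ≤ s t * (9 * K ^ 2 * s 0) := by
      rcases le_total (s t) 1 with h | h
      · rw [min_eq_right h]
        refine mul_le_mul_of_nonneg_left ?_ (hs0 t).le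
        calc (s t + 2 * K) ^ 2 ≤ (3 * K) ^ 2 :=
              pow_le_pow_left₀ (by linarith [hs0 t]) (by linarith) 2
          _ = 9 * K ^ 2 * 1 := by ring
          _ ≤ 9 * K ^ 2 * s 0 := by gcongr
      · rw [min_eq_left h, one_mul]
        have h2 : s t + 2 * K ≤ 3 * K * s t := by
          nlinarith
        calc (s t + 2 * K) ^ 2 ≤ (3 * K * s t) ^ 2 :=
              pow_le_pow_left₀ (by linarith [hs0 t]) h2 2
          _ = s t * (9 * K ^ 2 * s t) := by ring
          _ ≤ s t * (9 * K ^ 2 * s 0) := by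
              have := hs0 t
              gcongr
    have h3 : κ * K ^ 2 ≤ 1 / 512 := by
      have : κ * K ^ 2 * (128 * 4) ≤ κ * K ^ 2 * (128 * (2 * (d₀ + 1) + 2)) := by
        gcongr
        linarith
      linarith
    have h4 : 0 ≤ κ * d₀ / e 0 := by have := he0 0; positivity
    have h5 : 0 < e t * s t := mul_pos (he0 t) (hs0 t)
    calc r (t + 1) * ((9 * K + 1) * (e t * s t + e t * (2 * K)) ^ 2)
        = r (t + 1) * e t * ((9 * K + 1) * e t * (s t + 2 * K) ^ 2) := by ring
      _ ≤ 2 * κ * min 1 (s t) * ((9 * K + 1) * e t * (s t + 2 * K) ^ 2) :=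
          mul_le_mul_of_nonneg_right (hre t) (by have := he0 t; positivity)
      _ = 2 * κ * (9 * K + 1) * e t * (min 1 (s t) * (s t + 2 * K) ^ 2) := by ring
      _ ≤ 2 * κ * (10 * K) * e t * (s t * (9 * K ^ 2 * s 0)) := by
          have := he0 t
          have := hmin0 t
          gcongr
          linarith
      _ = 180 * (κ * K ^ 2) * (e t * s t) * K * s 0 := by ring
      _ ≤ 180 * (1 / 512) * (e t * s t) * K * s 0 := by
          have := hs0 0
          gcongr
      _ ≤ e t * s t / 8 * (3 * K * s 0) := by
          have : 0 < e t * s t * K * s 0 := mul_pos (mul_pos h5 hK0) (hs0 0)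
          linarith
      _ ≤ _ := mul_le_mul_of_nonneg_left (by linarith) (by linarith)
  · simp only [hr, min_eq_left hs01, mul_one]
    have h1 : κ / e 0 * d₀ = κ * d₀ / e 0 := by ring
    rw [h1]
    have := mul_pos hK0 (hs0 0)
    linarith
  · have key : κ * d₀ / e 0 + 3 * K * s 0 + 2 * L t ≤ r t * divLevel (d₀ + 1) s t := by
      unfold divLevel
      have hst : s t ≤ s 0 := hsa (Nat.zero_le t)
      split_ifs with h
      · simp only [hr, min_eq_left h, mul_one]
        have h1 : κ * d₀ / e 0 ≤ κ * d₀ / e t :=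
          div_le_div_of_nonneg_left (by positivity) (he0 t) (hea (Nat.zero_le t))
        -- The reason for `R = d₀ + 1`: the part `d₀` matches the initial divergence, and the extra
        -- `1` pays for everything else.
        have h2 : 3 * K * s 0 + 2 * L t ≤ κ / e t := by
          rw [le_div_iff₀ (he0 t)]
          have h3 : 3 * K * (e t * s 0) ≤ κ / 2 := by
            have h4 : e t * s 0 ≤ e 0 * s 0 :=
              mul_le_mul_of_nonneg_right (hea (Nat.zero_le t)) (hs0 0).le
            rw [hσ] at h4
            exact (mul_le_mul_of_nonneg_left h4 (by positivity)).trans hσ2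
          have h5 : e t * L t ≤ η * (L 0 / p 0) := by
            have h6 : L t / p t ≤ L 0 / p 0 := by
              simp only [hs, mul_div_assoc] at hst
              exact le_of_mul_le_mul_left hst hτ0
            have h7 : e t * L t ≤ η * (L t / p t) := by
              simp only [he]
              have h8 : η / p t ^ 3 * L t = η * (L t / p t ^ 3) := by ring
              rw [h8]
              refine mul_le_mul_of_nonneg_left ?_ hη.le
              exact div_le_div_of_nonneg_left (hLp t).le (hpp t)
                (le_self_pow₀ (hp0 t) (by norm_num))
            exact h7.trans (mul_le_mul_of_nonneg_left h6 hη.le)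
          linarith
        have h9 : κ / e t * (d₀ + 1) = κ * d₀ / e t + κ / e t := by ring
        rw [h9]
        linarith
      · push Not at h
        simp only [hr, min_eq_right h.le]
        have hLm : L 0 ≤ L t := monotone_nat_of_le_succ hLL (Nat.zero_le t)
        -- The powers of `p t` cancel. Each of the three terms to be dominated gets a third of the
        -- result, with `6912 = 3 * 48²`.
        have e1 : κ * s t / e t * (s t / 48) ^ 2 = κ * τ ^ 3 * L t ^ 3 / (2304 * η) := by
          simp only [he, hs]
          have := (hpp t).ne'
          field_simp
          ring
        rw [e1]
        have hLt := hLp t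
        have hL1 : 1 ≤ L t := by linarith [hL8 t]
        have c1 : κ * d₀ / e 0 ≤ κ * τ ^ 3 * L t ^ 3 / (6912 * η) := by
          have h1 : 6912 * d₀ * p 0 ^ 3 ≤ τ ^ 3 * L t ^ 3 := by
            have h2 : 6912 * d₀ ≤ (τ * L 0 / p 0) ^ 3 :=
              hs2.trans (le_self_pow₀ hs01 (by norm_num))
            have h3 : (τ * L 0 / p 0) ^ 3 * p 0 ^ 3 = (τ * L 0) ^ 3 := by
              have := (hpp 0).ne'
              field_simp
            have h4 := mul_le_mul_of_nonneg_right h2 (pow_pos (hpp 0) 3).le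
            rw [h3] at h4
            have h5 : (τ * L 0) ^ 3 ≤ (τ * L t) ^ 3 :=
              pow_le_pow_left₀ (mul_pos hτ0 (hLp 0)).le
                (mul_le_mul_of_nonneg_left hLm hτ0.le) 3
            rw [mul_pow τ (L t)] at h5
            exact h4.trans h5
          have h6 : κ * d₀ / e 0 = κ * (6912 * d₀ * p 0 ^ 3) / (6912 * η) := by
            simp only [he]
            have := (hpp 0).ne'
            field_simp
          rw [h6, mul_assoc κ (τ ^ 3)]
          gcongr
        have hLL2 : L t ≤ L t ^ 3 := le_self_pow₀ hL1 (by norm_num)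
        have hττ : τ ≤ τ ^ 3 := le_self_pow₀ hτ (by norm_num)
        have hκη : 20736 * K * η * (τ * L t) ≤ κ * (τ ^ 3 * L t ^ 3) := by
          gcongr
        have c2 : 3 * K * s 0 ≤ κ * τ ^ 3 * L t ^ 3 / (6912 * η) := by
          rw [le_div_iff₀ (by positivity)]
          have h1 : s 0 ≤ τ * L t := by
            simp only [hs]
            exact (div_le_self (mul_pos hτ0 (hLp 0)).le (hp0 0)).trans
              (mul_le_mul_of_nonneg_left hLm hτ0.le)
          have h2 : 3 * K * s 0 * (6912 * η) ≤ 3 * K * (τ * L t) * (6912 * η) := by gcongr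
          linarith
        have c3 : 2 * L t ≤ κ * τ ^ 3 * L t ^ 3 / (6912 * η) := by
          rw [le_div_iff₀ (by positivity)]
          have h1 : 1 * (η * L t) ≤ K * τ * (η * L t) := by
            gcongr
            nlinarith
          have : 0 < K * τ * (η * L t) := by positivity
          linarith
        have e2 : κ * τ ^ 3 * L t ^ 3 / (2304 * η) =
            3 * (κ * τ ^ 3 * L t ^ 3 / (6912 * η)) := by
          field_simp
          norm_num
        rw [e2]
        linarith
    calc Real.exp (κ * d₀ / e 0 + 3 * K * s 0)
        ≤ Real.exp (-(2 * L t) + r t * divLevel (d₀ + 1) s t) :=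
          Real.exp_le_exp.2 (by linarith)
      _ = Real.exp (-(2 * L t)) * Real.exp (r t * divLevel (d₀ + 1) s t) := Real.exp_add _ _
      _ ≤ _ := mul_le_mul_of_nonneg_right (hδ t) (Real.exp_pos _).le

end Schedule

section Schedule

set_option maxHeartbeats 1000000 in
/-- For a small enough constant, the parameters of the algorithm give a schedule, and `T₀` is
large. -/
theorem exists_isSchedule {K d₀ δ : ℝ} (hK : 1 ≤ K) (hd : 0 ≤ d₀) (hδ : 0 < δ) (hδ1 : δ < 1) :
    ∃ c : ℝ, 0 < c ∧ ∀ (η τ : ℝ) (T₀ : ℕ), 0 < η → 0 < τ → 1 < T₀ → 1 / (η * τ) ≤ c → η ≤ c →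
      η * τ ≤ T₀ / Real.log T₀ ^ 4 → T₀ ≤ Real.log (1 / δ) ^ 2 * τ ^ 4 →
      ∃ r k w : ℕ → ℝ, ∃ u : ℝ, IsSchedule K d₀ (d₀ + 1) δ (learningRate η T₀)
        (regStrength δ τ T₀) r k w u := by
  set κ := tempScale K d₀ with hκdef
  have hκ : 0 < κ := tempScale_pos hK hd
  set l := Real.log (1 / δ) with hl
  have hl0 : 0 < l := Real.log_pos (by rw [lt_div_iff₀ hδ]; linarith)
  have hK0 : 0 < K := by linarith
  -- Targets: `ε` bounds the initial product of learning rate and regularization, `N₁` is a lower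
  -- bound for the initial regularization, `N` is the size of `log T₀` that yields both, and `M` is
  -- the size of `η τ` that enforces it.
  set ε := min (1 / 16) (κ / (6 * K)) with hε
  have hε0 : 0 < ε := lt_min (by norm_num) (by positivity)
  set N₁ := max (16 * K) (6912 * d₀) with hN₁
  have hN₁0 : 0 < N₁ := lt_max_of_lt_left (by positivity)
  set N := max 8 (max (N₁ ^ 2) ((1 + l) / ε)) with hN
  have hlog2 : 0 < Real.log 2 := Real.log_pos one_lt_two
  set M := Real.exp N / Real.log 2 ^ 4 + 1 with hM
  have hM0 : 0 < M := by positivity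
  have hpos1 : 0 < κ / (20736 * K) := by positivity
  have hpos2 : 0 < κ / (4 * (4 + l)) := by positivity
  have hpos3 : 0 < 1 / (32 * K) := by positivity
  have hpos4 : 0 < 1 / (15 * K) := by positivity
  have hpos5 : 0 < 1 / M := by positivity
  refine ⟨min (κ / (20736 * K)) (min (κ / (4 * (4 + l))) (min (1 / (32 * K))
    (min (1 / (15 * K)) (1 / M)))), 
    lt_min hpos1 (lt_min hpos2 (lt_min hpos3 (lt_min hpos4 hpos5))), ?_⟩
  intro η τ T₀ hη hτ hT hc1 hc2 hc3 hc4
  simp only [le_min_iff] at hc1 hc2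
  obtain ⟨-, -, -, hc1a, hc1b⟩ := hc1
  obtain ⟨hc2a, hc2b, hc2c, hc2d, -⟩ := hc2
  have hητ0 : 0 < η * τ := mul_pos hη hτ
  have hητ : 15 * K ≤ η * τ := (one_div_le_one_div hητ0 (by positivity)).1 hc1a
  have hητM : M ≤ η * τ := (one_div_le_one_div hητ0 hM0).1 hc1b
  have hT' : (2 : ℝ) ≤ T₀ := by exact_mod_cast hT
  -- Otherwise the upper bound `T₀ / log T₀ ^ 4` on `η τ` would be smaller than `M`.
  have hlogT : N ≤ Real.log T₀ := by
    by_contra h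
    push Not at h
    have h1 : (T₀ : ℝ) ≤ Real.exp N := by
      rw [← Real.log_le_iff_le_exp (by linarith)]
      exact h.le
    have h2 : (T₀ : ℝ) / Real.log T₀ ^ 4 ≤ Real.exp N / Real.log 2 ^ 4 := by
      have : Real.log 2 ≤ Real.log T₀ := Real.log_le_log (by norm_num) hT'
      gcongr
    linarith
  have hlam8 : 8 ≤ Real.log T₀ := (le_max_left _ _).trans hlogT
  have hlamN : N₁ ^ 2 ≤ Real.log T₀ :=
    ((le_max_left _ _).trans (le_max_right _ _)).trans hlogT
  have hlamε : (1 + l) / ε ≤ Real.log T₀ :=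
    ((le_max_right _ _).trans (le_max_right _ _)).trans hlogT
  set lam := Real.log T₀ with hlam
  have hT9 : (9 : ℝ) ≤ T₀ := by
    have := Real.log_le_sub_one_of_pos (by linarith : (0 : ℝ) < T₀)
    linarith
  have hτ1 : 1 ≤ τ := by
    have h1 : η ≤ 1 := hc2d.trans (by
      rw [div_le_one (by positivity)]
      linarith)
    by_contra h
    push Not at h
    have : η * τ ≤ 1 * 1 := by gcongr
    linarith
  have hx : ∀ t : ℕ, (9 : ℝ) ≤ (t : ℝ) + T₀ := fun t => by
    have : (0 : ℝ) ≤ t := Nat.cast_nonneg t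
    linarith
  set p : ℕ → ℝ := fun t => ((t : ℝ) + T₀) ^ (1 / 4 : ℝ) with hp
  have hp4 : ∀ t, p t ^ 4 = (t : ℝ) + T₀ := fun t => by
    simp only [hp]
    rw [← Real.rpow_natCast, ← Real.rpow_mul (by linarith [hx t])]
    norm_num
  have hpp : ∀ t, 0 < p t := fun t => Real.rpow_pos_of_pos (by linarith [hx t]) _
  have hp1 : ∀ t, 1 ≤ p t := fun t => Real.one_le_rpow (by linarith [hx t]) (by norm_num)
  set L : ℕ → ℝ := fun t => Real.log (((t : ℝ) + T₀) / δ) with hL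
  have hLl : ∀ t, L t = Real.log ((t : ℝ) + T₀) + l := fun t => by
    simp only [hL, hl]
    rw [Real.log_div (by linarith [hx t]) hδ.ne', one_div, Real.log_inv]
    ring
  have hL0 : L 0 = lam + l := by
    rw [hLl]
    simp [hlam]
  have hLL : ∀ t, L t ≤ L (t + 1) := fun t => by
    rw [hLl, hLl]
    have : Real.log ((t : ℝ) + T₀) ≤ Real.log (((t + 1 : ℕ) : ℝ) + T₀) :=
      Real.log_le_log (by linarith [hx t]) (by push_cast; linarith)
    linarith
  have hL8 : ∀ t, 8 ≤ L t := fun t => by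
    have := monotone_nat_of_le_succ hLL (Nat.zero_le t)
    linarith
  have hη_eq : learningRate η T₀ = fun t => η / p t ^ 3 := by
    funext t
    simp only [learningRate, hp]
    rw [← Real.rpow_natCast, ← Real.rpow_mul (by linarith [hx t]),
      Real.rpow_neg (by linarith [hx t]), ← div_eq_mul_inv]
    norm_num
  have hτ_eq : regStrength δ τ T₀ = fun t => τ * L t / p t := by
    funext t
    simp only [regStrength, hp, hL]
    rw [Real.rpow_neg (by linarith [hx t]), ← div_eq_mul_inv]
  rw [hη_eq, hτ_eq]
  have hp04 : p 0 ^ 4 = T₀ := by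
    rw [hp4]
    simp
  have hσ0 : η * τ * L 0 / p 0 ^ 4 ≤ ε := by
    have hlam1 : 1 ≤ lam := by linarith
    rw [hp04, hL0]
    calc η * τ * (lam + l) / T₀ ≤ T₀ / lam ^ 4 * (lam + l) / T₀ := by gcongr
      _ = (lam + l) / lam ^ 4 := by
          have : (T₀ : ℝ) ≠ 0 := by linarith
          field_simp
      _ ≤ (lam * (1 + l)) / lam ^ 4 := by
          gcongr
          nlinarith
      _ = (1 + l) / lam ^ 3 := by
          field_simp
      _ ≤ (1 + l) / lam := by
          gcongr
          exact le_self_pow₀ hlam1 (by norm_num)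
      _ ≤ ε := by
          rw [div_le_iff₀ (by linarith)]
          rw [div_le_iff₀ hε0] at hlamε
          linarith
  -- From `√T₀ ≤ l τ²`, the square of the initial regularization is at least `L 0 ^ 2 / l`, hence at
  -- least `log T₀`.
  have hs0 : N₁ ≤ τ * L 0 / p 0 := by
    have h1 : (p 0 ^ 2) ^ 2 ≤ (l * τ ^ 2) ^ 2 := by
      calc (p 0 ^ 2) ^ 2 = p 0 ^ 4 := by ring
        _ = (T₀ : ℝ) := hp04
        _ ≤ l ^ 2 * τ ^ 4 := hc4
        _ = _ := by ring
    have h2 : p 0 ^ 2 ≤ l * τ ^ 2 := le_of_pow_le_pow_left₀ two_ne_zero (by positivity) h1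
    refine le_of_pow_le_pow_left₀ two_ne_zero
      (div_nonneg (mul_nonneg hτ.le (by linarith [hL8 0])) (hpp 0).le) ?_
    rw [div_pow, le_div_iff₀ (pow_pos (hpp 0) 2)]
    calc N₁ ^ 2 * p 0 ^ 2 ≤ lam * (l * τ ^ 2) := by
          have := hpp 0
          gcongr
      _ ≤ (lam + l) * ((lam + l) * τ ^ 2) := by
          gcongr <;> linarith
      _ = (τ * L 0) ^ 2 := by rw [hL0]; ring
  refine isSchedule_of_root hK hd hη hτ1 hητ (fun t => by rw [hp4]; linarith [hx t]) hp1
    (fun t => by rw [hp4, hp4]; push_cast; ring) hL8 hLL (fun t => ?_) ?_ ?_ ?_ ?_ ?_ ?_ ?_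
    (fun t => ?_) (fun n => ?_)
  · rw [hLl, hLl, hp4]
    have hxt := hx t
    have e1 : Real.log (((t + 1 : ℕ) : ℝ) + T₀) =
        Real.log ((t : ℝ) + T₀) + Real.log (1 + 1 / ((t : ℝ) + T₀)) := by
      rw [← Real.log_mul (by linarith) (by positivity)]
      congr 1
      have : (t : ℝ) + T₀ ≠ 0 := by linarith
      field_simp
      push_cast
      ring
    have h1 := Real.log_le_sub_one_of_pos (by positivity : 0 < 1 + 1 / ((t : ℝ) + T₀))
    rw [e1]
    linarith
  · rw [le_div_iff₀ (by positivity)] at hc2c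
    linarith
  · rw [le_div_iff₀ (by positivity)] at hc2a
    linarith
  · have h1 : L 0 / p 0 ≤ 4 + l := by
      rw [div_le_iff₀ (hpp 0), hL0]
      have h2 : lam = 4 * Real.log (p 0) := by
        rw [hlam, ← hp04, Real.log_pow]
        norm_num
      have h3 := Real.log_le_sub_one_of_pos (hpp 0)
      have h4 := mul_le_mul_of_nonneg_left (hp1 0) hl0.le
      linarith
    have h2 := mul_le_mul_of_nonneg_left h1 hη.le
    rw [le_div_iff₀ (by positivity)] at hc2b
    linarith
  · exact hσ0.trans (min_le_left _ _)
  · have h1 : η * τ * L 0 / p 0 ^ 4 ≤ κ / (6 * K) := hσ0.trans (min_le_right _ _)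
    rw [le_div_iff₀ (by positivity)] at h1
    linarith
  · exact (le_max_left _ _).trans hs0
  · exact (le_max_right _ _).trans hs0
  · rw [hp4]
    have hxt := hx t
    -- The square `δ²` is weakened to `δ`, as `δ < 1`.
    have h1 : Real.exp (-(2 * L t)) = (δ / ((t : ℝ) + T₀)) ^ 2 := by
      have h2 : -(2 * L t) = Real.log ((δ / ((t : ℝ) + T₀)) ^ 2) := by
        simp only [hL]
        rw [Real.log_pow, ← inv_div, Real.log_inv]
        push_cast
        ring
      rw [h2, Real.exp_log (by positivity)]
    rw [h1, div_pow, div_eq_mul_one_div]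
    gcongr
    nlinarith
  · simp only [hp4]
    exact sum_inv_sq_le_one hT n

end Schedule

/-! ### Marginals of a Markov chain graded by depth. -/

section Chain

variable {W : Type*}

/-- The weight of a trajectory of a Markov chain with initial weights `q` and kernel `k`. -/
def chainWeight (q : W → ℝ) (k : W → W → ℝ) {n : ℕ} (z : Fin n → W) : ℝ :=
  ∏ h : Fin n, if (h : ℕ) = 0 then q (z h)
    else k (z ⟨(h : ℕ) - 1, lt_of_le_of_lt (Nat.sub_le _ _) h.isLt⟩) (z h)

lemma chainWeight_snoc_succ (q : W → ℝ) (k : W → W → ℝ) {n : ℕ} (z : Fin (n + 1) → W) (w : W) :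
    chainWeight q k (Fin.snoc z w : Fin (n + 2) → W) =
      chainWeight q k z * k (z (Fin.last n)) w := by
  unfold chainWeight
  rw [Fin.prod_univ_castSucc]
  congr 1
  · refine Finset.prod_congr rfl fun h _ => ?_
    have h1 : (Fin.snoc z w : Fin (n + 2) → W) h.castSucc = z h := Fin.snoc_castSucc ..
    have h2 : (Fin.snoc z w : Fin (n + 2) → W)
        ⟨((h.castSucc : Fin (n + 2)) : ℕ) - 1,
          lt_of_le_of_lt (Nat.sub_le _ _) h.castSucc.isLt⟩ =
        z ⟨(h : ℕ) - 1, lt_of_le_of_lt (Nat.sub_le _ _) h.isLt⟩ :=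
      Fin.snoc_castSucc (α := fun _ => W) w z
        ⟨(h : ℕ) - 1, lt_of_le_of_lt (Nat.sub_le _ _) h.isLt⟩
    rw [h1, h2]
    rfl
  · have h1 : (Fin.snoc z w : Fin (n + 2) → W) (Fin.last (n + 1)) = w := Fin.snoc_last ..
    have h2 : (Fin.snoc z w : Fin (n + 2) → W)
        ⟨((Fin.last (n + 1) : Fin (n + 2)) : ℕ) - 1,
          lt_of_le_of_lt (Nat.sub_le _ _) (Fin.last (n + 1)).isLt⟩ = z (Fin.last n) :=
      Fin.snoc_castSucc (α := fun _ => W) w z (Fin.last n)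
    rw [h1, h2]
    simp

/-- Time and depth agree along every trajectory of nonzero weight. The kernel has total mass one
only before the last depth, so this is needed to sum out later states. -/
lemma chainWeight_support {q : W → ℝ} {k : W → W → ℝ} {d : W → ℕ} (hq : ∀ w, q w ≠ 0 → d w = 0)
    (hk : ∀ w w', k w w' ≠ 0 → d w' = d w + 1) {n : ℕ} {z : Fin n → W}
    (hz : chainWeight q k z ≠ 0) (h : Fin n) : d (z h) = h := by
  have hz' := Finset.prod_ne_zero_iff.1 hz
  obtain ⟨j, hj⟩ := h
  induction j with
  | zero =>
    have := hz' ⟨0, hj⟩ (Finset.mem_univ _)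
    simp only [if_true] at this
    exact hq _ this
  | succ j ih =>
    have := hz' ⟨j + 1, hj⟩ (Finset.mem_univ _)
    simp only [Nat.add_eq_zero_iff, one_ne_zero, and_false, if_false, Nat.add_sub_cancel] at this
    have h1 := hk _ _ this
    rw [h1, ih (by omega)]

/-- The marginals of a Markov chain. -/
theorem sum_chainWeight_mul [Fintype W] {q : W → ℝ} {k : W → W → ℝ} {d : W → ℕ} {marg : ℕ → W → ℝ} {N : ℕ}
    (hq : ∀ w, q w ≠ 0 → d w = 0) (hk : ∀ w w', k w w' ≠ 0 → d w' = d w + 1)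
    (hk1 : ∀ w, d w + 1 < N → ∑ w', k w w' = 1) (h0 : ∀ w, marg 0 w = q w)
    (hs : ∀ j w', marg (j + 1) w' = ∑ w, marg j w * k w w') (n : ℕ) (hn : n ≤ N)
    (j : Fin n) (f : W → ℝ) :
    ∑ z : Fin n → W, chainWeight q k z * f (z j) = ∑ w, marg j w * f w := by
  induction n generalizing f with
  | zero => exact j.elim0
  | succ n ih =>
    cases n with
    | zero =>
      obtain rfl : j = 0 := Fin.ext (by omega)
      rw [← (Equiv.funUnique (Fin 1) W).symm.sum_comp]
      refine Finset.sum_congr rfl fun w _ => ?_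
      simp [chainWeight, h0]
    | succ n =>
      rw [← (Fin.snocEquiv (fun _ : Fin (n + 2) => W)).sum_comp, Fintype.sum_prod_type_right]
      have e : ∀ (w : W) (z : Fin (n + 1) → W),
          (Fin.snocEquiv (fun _ : Fin (n + 2) => W)) (w, z) = Fin.snoc z w := fun w z => rfl
      simp only [e]
      refine Fin.lastCases ?_ (fun j => ?_) j
      · have h1 : ∀ (z : Fin (n + 1) → W) (w : W),
            (Fin.snoc z w : Fin (n + 2) → W) (Fin.last (n + 1)) = w := fun z w =>
          Fin.snoc_last ..
        simp only [h1, chainWeight_snoc_succ]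
        rw [Finset.sum_comm]
        refine Finset.sum_congr rfl fun w _ => ?_
        rw [← Finset.sum_mul, ih (by omega) (Fin.last n) fun w' => k w' w]
        congr 1
        exact (hs n w).symm
      · have h1 : ∀ (z : Fin (n + 1) → W) (w : W),
            (Fin.snoc z w : Fin (n + 2) → W) j.castSucc = z j := fun z w =>
          Fin.snoc_castSucc ..
        simp only [h1, chainWeight_snoc_succ]
        rw [Fin.val_castSucc, ← ih (by omega) j f]
        refine Finset.sum_congr rfl fun z _ => ?_
        rw [← Finset.sum_mul, ← Finset.mul_sum]
        by_cases hz : chainWeight q k z = 0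
        · rw [hz, zero_mul]
        · have h2 := chainWeight_support hq hk hz (Fin.last n)
          rw [hk1 _ (by rw [h2, Fin.val_last]; omega), mul_one]

end Chain

/-! ### Sequence forms as a polytope, and optimality of the mirror step. -/

namespace DecisionTree

variable {X A : Type*} (T : DecisionTree X A)

/-- The mass `m` is conserved along the tree, with mass `c` entering at initial points. -/
def Conserves [Fintype A] (c : ℝ) (m : X → A → ℝ) : Prop :=
  ∀ x, ∑ a, m x a = (T.prev x).elim c fun p => m p.1 p.2

lemma seqForm_eq (μ : X → A → ℝ) (x : X) (a : A) :
    T.seqForm μ x a = μ x a * (T.prev x).elim 1 fun p => T.seqForm μ p.1 p.2 := by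
  rw [seqForm]
  congr 1
  split <;> rename_i h <;> rw [h] <;> rfl

lemma depth_induction {motive : X → Prop} (h0 : ∀ x, T.prev x = none → motive x)
    (h1 : ∀ x p, T.prev x = some p → motive p.1 → motive x) (x : X) : motive x := by
  have : ∀ n x, T.depth x = n → motive x := by
    intro n
    induction n with
    | zero =>
      intro x hx
      rcases h : T.prev x with _ | p
      · exact h0 x h
      · have := T.depth_of_some x p h
        omega
    | succ n ih =>
      intro x hx
      rcases h : T.prev x with _ | p
      · exact h0 x h
      · have := T.depth_of_some x p h
        exact h1 x p h (ih p.1 (by omega))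
  exact this _ x rfl

variable {T}

lemma Conserves.add [Fintype A] {c d : ℝ} {m n : X → A → ℝ} (hm : T.Conserves c m)
    (hn : T.Conserves d n) : T.Conserves (c + d) (m + n) := by
  intro x
  simp only [Pi.add_apply, Finset.sum_add_distrib, hm x, hn x]
  cases T.prev x <;> rfl

lemma Conserves.smul [Fintype A] {c : ℝ} {m : X → A → ℝ} (r : ℝ) (hm : T.Conserves c m) :
    T.Conserves (r * c) (r • m) := by
  intro x
  simp only [Pi.smul_apply, smul_eq_mul, ← Finset.mul_sum, hm x]
  cases T.prev x <;> rfl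

lemma Conserves.sub [Fintype A] {c d : ℝ} {m n : X → A → ℝ} (hm : T.Conserves c m)
    (hn : T.Conserves d n) : T.Conserves (c - d) (m - n) := by
  intro x
  simp only [Pi.sub_apply, Finset.sum_sub_distrib, hm x, hn x]
  cases T.prev x <;> rfl

lemma conserves_seqForm [Fintype A] {μ : X → A → ℝ} (hμ : IsPolicy μ) :
    T.Conserves 1 (T.seqForm μ) := by
  intro x
  simp only [T.seqForm_eq μ x, ← Finset.sum_mul, hμ.2 x, one_mul]

lemma seqForm_nonneg [Fintype A] {μ : X → A → ℝ} (hμ : IsPolicy μ) (x : X) :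
    ∀ a, 0 ≤ T.seqForm μ x a := by
  refine T.depth_induction (motive := fun x => ∀ a, 0 ≤ T.seqForm μ x a) ?_ ?_ x
  · intro x h a
    rw [seqForm_eq, h]
    simpa using hμ.1 x a
  · intro x p h ih a
    rw [seqForm_eq, h]
    exact mul_nonneg (hμ.1 x a) (ih p.2)

lemma seqForm_pos [Fintype A] {μ : X → A → ℝ} (hμ : IsInteriorPolicy μ) (x : X) :
    ∀ a, 0 < T.seqForm μ x a := by
  refine T.depth_induction (motive := fun x => ∀ a, 0 < T.seqForm μ x a) ?_ ?_ x
  · intro x h a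
    rw [seqForm_eq, h]
    simpa using hμ.2 x a
  · intro x p h ih a
    rw [seqForm_eq, h]
    exact mul_pos (hμ.2 x a) (ih p.2)

lemma Conserves.le_one [Fintype A] {m : X → A → ℝ} (hm : T.Conserves 1 m)
    (h0 : ∀ x a, 0 ≤ m x a) (x : X) : ∀ a, m x a ≤ 1 := by
  have hle : ∀ x a, m x a ≤ (T.prev x).elim 1 fun p => m p.1 p.2 := fun x a => by
    rw [← hm x]
    exact Finset.single_le_sum (f := fun a => m x a) (fun b _ => h0 x b) (Finset.mem_univ a)
  refine T.depth_induction (motive := fun x => ∀ a, m x a ≤ 1) ?_ ?_ x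
  · intro x h a
    have := hle x a
    rwa [h] at this
  · intro x p h ih a
    have := hle x a
    rw [h] at this
    exact this.trans (ih p.2)

lemma seqForm_uniformPolicy [Fintype A] (x : X) :
    ∀ a, T.seqForm (uniformPolicy X A) x a = (1 / (Fintype.card A : ℝ)) ^ (T.depth x + 1) := by
  refine T.depth_induction (motive := fun x => ∀ a, T.seqForm (uniformPolicy X A) x a =
    (1 / (Fintype.card A : ℝ)) ^ (T.depth x + 1)) ?_ ?_ x
  · intro x h a
    rw [seqForm_eq, h, T.depth_of_none x h]
    simp [uniformPolicy]
  · intro x p h ih a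
    rw [seqForm_eq, h, T.depth_of_some x p h, pow_succ']
    simp only [Option.elim_some, ih p.2]
    rfl

/-- Every positive conserved vector is the sequence form of an interior policy. -/
lemma Conserves.exists_policy [Fintype A] {m : X → A → ℝ} (hm : T.Conserves 1 m)
    (h0 : ∀ x a, 0 < m x a) : ∃ κ, IsInteriorPolicy κ ∧ T.seqForm κ = m := by
  have hin : ∀ x, 0 < (T.prev x).elim 1 fun p => m p.1 p.2 := fun x => by
    cases T.prev x with
    | none => exact one_pos
    | some p => exact h0 _ _
  set κ : X → A → ℝ := fun x a => m x a / (T.prev x).elim 1 fun p => m p.1 p.2 with hκ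
  refine ⟨κ, ⟨⟨fun x a => (div_pos (h0 x a) (hin x)).le, fun x => ?_⟩,
    fun x a => div_pos (h0 x a) (hin x)⟩, ?_⟩
  · simp only [hκ, ← Finset.sum_div, hm x]
    exact div_self (hin x).ne'
  · have : ∀ x, ∀ a, T.seqForm κ x a = m x a := fun x =>
      T.depth_induction (motive := fun x => ∀ a, T.seqForm κ x a = m x a)
        (fun x h a => by
          rw [seqForm_eq, h]
          simp [hκ, h])
        (fun x p h ih a => by
          rw [seqForm_eq, h]
          simp only [hκ, h, Option.elim_some]
          rw [ih p.2]
          exact div_mul_cancel₀ _ (h0 _ _).ne') x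
    funext x a
    exact this x a

/-- First-order optimality of the mirror step. -/
theorem IsMirrorStep.sum_eq_zero [Fintype X] [Fintype A] {c τ : ℝ} {f μ μ' : X → A → ℝ}
    (h : T.IsMirrorStep c (f + τ • logBarrierGrad (T.seqForm μ)) μ μ') {w : X → A → ℝ}
    (hw : T.Conserves 0 w) :
    ∑ x, ∑ a, (1 / T.seqForm μ' x a - (1 - c * τ) / T.seqForm μ x a - c * f x a) * w x a
      = 0 := by
  set m := T.seqForm μ
  set m' := T.seqForm μ' with hm'
  have hpos : ∀ x a, 0 < m' x a := fun x => seqForm_pos h.1 x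
  have hcons : T.Conserves 1 m' := conserves_seqForm h.1.1
  set ξ := f + τ • logBarrierGrad m with hξ
  set φ : ℝ → ℝ := fun s => logBarrierDiv (m' + s • w) m + c * pairing ξ (m' + s • w) with hφ
  have hev : ∀ᶠ s : ℝ in nhds 0, ∀ x a, 0 < (m' + s • w) x a := by
    rw [Filter.eventually_all]
    intro x
    rw [Filter.eventually_all]
    intro a
    have : ContinuousAt (fun s : ℝ => (m' + s • w) x a) 0 := by
      simp only [Pi.add_apply, Pi.smul_apply, smul_eq_mul]
      fun_prop
    exact this.eventually_const_lt (by simpa using hpos x a)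
  have hloc : IsLocalMin φ 0 := by
    filter_upwards [hev] with s hs
    have hc : T.Conserves 1 (m' + s • w) := by
      have := hcons.add (hw.smul s)
      simpa using this
    -- Minimality over policies becomes minimality on a segment of sequence forms, because the
    -- perturbed vector is again the sequence form of an interior policy.
    obtain ⟨κ, hκ, hκm⟩ := hc.exists_policy hs
    have h1 := isMinOn_iff.1 h.2 κ hκ
    simp only [hκm] at h1
    simpa only [hφ, zero_smul, add_zero] using h1
  have hlin : ∀ g : X → A → ℝ, HasDerivAt (fun s : ℝ => pairing g (m' + s • w))
      (∑ x, ∑ a, g x a * w x a) 0 := by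
    intro g
    unfold pairing
    refine HasDerivAt.fun_sum fun x _ => HasDerivAt.fun_sum fun a _ => ?_
    have h1 : HasDerivAt (fun s : ℝ => m' x a + s * w x a) (w x a) 0 := by
      simpa using ((hasDerivAt_id (0 : ℝ)).mul_const (w x a)).const_add (m' x a)
    exact h1.const_mul (g x a)
  have hbar : HasDerivAt (fun s : ℝ => logBarrier (m' + s • w))
      (-∑ x, ∑ a, w x a / m' x a) 0 := by
    unfold logBarrier
    refine HasDerivAt.fun_neg (HasDerivAt.fun_sum fun x _ => HasDerivAt.fun_sum fun a _ => ?_)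
    have h1 : HasDerivAt (fun s : ℝ => m' x a + s * w x a) (w x a) 0 := by
      simpa using ((hasDerivAt_id (0 : ℝ)).mul_const (w x a)).const_add (m' x a)
    have h2 := h1.log (by simpa using (hpos x a).ne')
    simpa using h2
  have hsub : ∀ s : ℝ, pairing (logBarrierGrad m) (m' + s • w - m) =
      pairing (logBarrierGrad m) (m' + s • w) - pairing (logBarrierGrad m) m := by
    intro s
    simp only [pairing, Pi.sub_apply, mul_sub, Finset.sum_sub_distrib]
  have hder : HasDerivAt φ (-∑ x, ∑ a, w x a / m' x a
      - ∑ x, ∑ a, logBarrierGrad m x a * w x a + c * ∑ x, ∑ a, ξ x a * w x a) 0 := by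
    simp only [hφ, logBarrierDiv, hsub]
    exact ((hbar.sub_const _).sub ((hlin _).sub_const _)).add ((hlin ξ).const_mul c)
  have hzero := hloc.hasDerivAt_eq_zero hder
  rw [Finset.mul_sum, ← Finset.sum_neg_distrib, ← Finset.sum_sub_distrib,
    ← Finset.sum_add_distrib] at hzero
  rw [← neg_eq_zero, ← hzero, ← Finset.sum_neg_distrib]
  refine Finset.sum_congr rfl fun x _ => ?_
  rw [Finset.mul_sum, ← Finset.sum_neg_distrib, ← Finset.sum_neg_distrib,
    ← Finset.sum_sub_distrib, ← Finset.sum_add_distrib]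
  refine Finset.sum_congr rfl fun a _ => ?_
  simp only [hξ, logBarrierGrad, Pi.add_apply, Pi.smul_apply, smul_eq_mul]
  ring

end DecisionTree

/-! ### Occupation weights, the law of an episode, and unbiasedness. -/

namespace ExtensiveGame

variable {S X Y A B : Type*} [Fintype S] (G : ExtensiveGame S X Y A B)

/-- The probability that the environment leads to the state `s`, given the actions on the path
to `s`. -/
noncomputable def reach (G : ExtensiveGame S X Y A B) (s : S) : ℝ :=
  match _h : G.tree.prev s with
  | none => 1
  | some p => G.reach p.1 * G.trans p.1 p.2.1 p.2.2 s
termination_by G.tree.depth s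
decreasing_by
  have := G.tree.depth_of_some s p _h
  omega

lemma reach_eq (s : S) : G.reach s =
    (G.tree.prev s).elim 1 fun p => G.reach p.1 * G.trans p.1 p.2.1 p.2.2 s := by
  rw [reach]
  split <;> rename_i h <;> rw [h] <;> rfl

lemma reach_nonneg (s : S) : 0 ≤ G.reach s := by
  refine G.tree.depth_induction (motive := fun s => 0 ≤ G.reach s) ?_ ?_ s
  · intro s h
    rw [reach_eq, h]
    exact zero_le_one
  · intro s p h ih
    rw [reach_eq, h]
    exact mul_nonneg ih (G.trans_nonneg _ _ _ _)

lemma depth_infoMin (s : S) : G.minTree.depth (G.infoMin s) = G.tree.depth s := by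
  refine G.tree.depth_induction
    (motive := fun s => G.minTree.depth (G.infoMin s) = G.tree.depth s) ?_ ?_ s
  · intro s h
    have h1 := G.recall_min s
    rw [h] at h1
    rw [G.tree.depth_of_none s h, G.minTree.depth_of_none _ h1]
  · intro s p h ih
    have h1 := G.recall_min s
    rw [h] at h1
    rw [G.tree.depth_of_some s p h, G.minTree.depth_of_some _ _ h1]
    simp [ih]

lemma depth_infoMax (s : S) : G.maxTree.depth (G.infoMax s) = G.tree.depth s := by
  refine G.tree.depth_induction
    (motive := fun s => G.maxTree.depth (G.infoMax s) = G.tree.depth s) ?_ ?_ s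
  · intro s h
    have h1 := G.recall_max s
    rw [h] at h1
    rw [G.tree.depth_of_none s h, G.maxTree.depth_of_none _ h1]
  · intro s p h ih
    have h1 := G.recall_max s
    rw [h] at h1
    rw [G.tree.depth_of_some s p h, G.maxTree.depth_of_some _ _ h1]
    simp [ih]

lemma depth_eq_zero_iff (s : S) : G.tree.depth s = 0 ↔ s = G.root := by
  rw [← G.prev_eq_none_iff]
  constructor
  · intro h
    rcases h1 : G.tree.prev s with _ | p
    · rfl
    · have := G.tree.depth_of_some s p h1
      omega
  · exact G.tree.depth_of_none s

/-- The weight of a state and two actions: `reach s` times the sequence-form weights. -/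
noncomputable def occ (m : X → A → ℝ) (n : Y → B → ℝ) (w : S × A × B) : ℝ :=
  G.reach w.1 * m (G.infoMin w.1) w.2.1 * n (G.infoMax w.1) w.2.2

lemma sum_prod_prod {α β γ M : Type*} [Fintype α] [Fintype β] [Fintype γ] [AddCommMonoid M]
    (f : α × β × γ → M) : ∑ w, f w = ∑ s, ∑ a, ∑ b, f (s, a, b) := by
  rw [Fintype.sum_prod_type]
  exact Finset.sum_congr rfl fun s _ => Fintype.sum_prod_type _

lemma sum_estimateMin_mul [Fintype X] [Fintype A] (μ : X → A → ℝ) (z : G.Play) (w : X → A → ℝ) :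
    ∑ x, ∑ a, G.estimateMin μ z x a * w x a =
      ∑ h, G.playLoss z h / G.minTree.seqForm μ (G.infoMin (z h).1) (z h).2.1 *
        w (G.infoMin (z h).1) (z h).2.1 := by
  classical
  simp only [estimateMin, Finset.sum_mul]
  rw [Finset.sum_congr rfl fun x _ => Finset.sum_comm, Finset.sum_comm]
  refine Finset.sum_congr rfl fun h _ => ?_
  rw [Finset.sum_eq_single (G.infoMin (z h).1), Finset.sum_eq_single (z h).2.1]
  · simp
  · intro a _ ha
    simp [Ne.symm ha]
  · simp
  · intro x _ hx
    simp [Ne.symm hx]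
  · simp

lemma sum_estimateMax_mul [Fintype Y] [Fintype B] (ν : Y → B → ℝ) (z : G.Play) (w : Y → B → ℝ) :
    ∑ y, ∑ b, G.estimateMax ν z y b * w y b =
      ∑ h, (1 - G.playLoss z h) / G.maxTree.seqForm ν (G.infoMax (z h).1) (z h).2.2 *
        w (G.infoMax (z h).1) (z h).2.2 := by
  classical
  simp only [estimateMax, Finset.sum_mul]
  rw [Finset.sum_congr rfl fun x _ => Finset.sum_comm, Finset.sum_comm]
  refine Finset.sum_congr rfl fun h _ => ?_
  rw [Finset.sum_eq_single (G.infoMax (z h).1), Finset.sum_eq_single (z h).2.2]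
  · simp
  · intro a _ ha
    simp [Ne.symm ha]
  · simp
  · intro x _ hx
    simp [Ne.symm hx]
  · simp

lemma estimateMin_nonneg [Fintype A] {μ : X → A → ℝ} (hμ : IsInteriorPolicy μ) (z : G.Play) (x : X) (a : A) :
    0 ≤ G.estimateMin μ z x a := by
  classical
  refine Finset.sum_nonneg fun h _ => ?_
  split_ifs
  · exact div_nonneg (G.loss_mem _ _ _).1 (DecisionTree.seqForm_pos hμ x a).le
  · exact le_rfl

lemma estimateMax_nonneg [Fintype B] {ν : Y → B → ℝ} (hν : IsInteriorPolicy ν) (z : G.Play) (y : Y) (b : B) :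
    0 ≤ G.estimateMax ν z y b := by
  classical
  refine Finset.sum_nonneg fun h _ => ?_
  split_ifs
  · exact div_nonneg (sub_nonneg.2 (G.loss_mem _ _ _).2) (DecisionTree.seqForm_pos hν y b).le
  · exact le_rfl

lemma sum_estimateMin_mul_self_le [Fintype X] [Fintype A] {μ : X → A → ℝ} (hμ : IsInteriorPolicy μ) (z : G.Play) :
    ∑ x, ∑ a, G.estimateMin μ z x a * G.minTree.seqForm μ x a ≤ G.H := by
  rw [sum_estimateMin_mul]
  calc _ ≤ ∑ _h : Fin G.H, (1 : ℝ) := by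
        refine Finset.sum_le_sum fun h _ => ?_
        rw [div_mul_cancel₀ _ (DecisionTree.seqForm_pos hμ _ _).ne']
        exact (G.loss_mem _ _ _).2
    _ = _ := by simp

lemma sum_estimateMax_mul_self_le [Fintype Y] [Fintype B] {ν : Y → B → ℝ} (hν : IsInteriorPolicy ν) (z : G.Play) :
    ∑ y, ∑ b, G.estimateMax ν z y b * G.maxTree.seqForm ν y b ≤ G.H := by
  rw [sum_estimateMax_mul]
  calc _ ≤ ∑ _h : Fin G.H, (1 : ℝ) := by
        refine Finset.sum_le_sum fun h _ => ?_
        rw [div_mul_cancel₀ _ (DecisionTree.seqForm_pos hν _ _).ne']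
        exact sub_le_self _ (G.loss_mem _ _ _).1
    _ = _ := by simp

variable [Fintype A] [Fintype B]

/-- Perfect recall: the predecessors of both information sets of `s` come from the same predecessor
of `s`, so the two conservation laws multiply. -/
lemma sum_occ_actions {c d : ℝ} {m : X → A → ℝ} {n : Y → B → ℝ} (hm : G.minTree.Conserves c m)
    (hn : G.maxTree.Conserves d n) (s : S) :
    ∑ a, ∑ b, G.occ m n (s, a, b) =
      (G.tree.prev s).elim (c * d) fun p => G.trans p.1 p.2.1 p.2.2 s * G.occ m n p := by
  have h1 : ∑ a, ∑ b, G.occ m n (s, a, b) =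
      G.reach s * ((∑ a, m (G.infoMin s) a) * ∑ b, n (G.infoMax s) b) := by
    simp only [occ]
    rw [Finset.sum_mul_sum, Finset.mul_sum]
    refine Finset.sum_congr rfl fun a _ => ?_
    rw [Finset.mul_sum]
    exact Finset.sum_congr rfl fun b _ => by ring
  rw [h1, hm, hn, G.recall_min, G.recall_max, reach_eq]
  rcases h : G.tree.prev s with _ | p
  · simp
  · simp only [Option.elim_some, Option.map_some, occ]
    ring

open Classical in
/-- Conservation of mass at every depth. -/
theorem sum_occ_depth {c d : ℝ} {m : X → A → ℝ} {n : Y → B → ℝ} (hm : G.minTree.Conserves c m)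
    (hn : G.maxTree.Conserves d n) (h : ℕ) (hh : h < G.H) :
    ∑ w : S × A × B, (if G.tree.depth w.1 = h then G.occ m n w else 0) = c * d := by
  have key : ∀ h, ∑ w : S × A × B, (if G.tree.depth w.1 = h then G.occ m n w else 0) =
      ∑ s, if G.tree.depth s = h then ((G.tree.prev s).elim (c * d)
        fun p => G.trans p.1 p.2.1 p.2.2 s * G.occ m n p) else 0 := by
    intro h
    rw [sum_prod_prod]
    refine Finset.sum_congr rfl fun s _ => ?_
    rw [← G.sum_occ_actions hm hn s]
    by_cases hs : G.tree.depth s = h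
    · simp only [hs, if_true]
    · simp only [hs, if_false, Finset.sum_const_zero]
  induction h with
  | zero =>
    rw [key, Finset.sum_eq_single G.root]
    · rw [if_pos ((G.depth_eq_zero_iff _).2 rfl), (G.prev_eq_none_iff _).2 rfl]
      rfl
    · intro s _ hs
      rw [if_neg fun h => hs ((G.depth_eq_zero_iff _).1 h)]
    · simp
  | succ h ih =>
    refine (key _).trans (Eq.trans ?_ (ih (by omega)))
    -- The predecessor is the only triple with nonzero transition to `s`, so it may be replaced by a
    -- sum over all triples; then the sums are exchanged.
    have h1 : ∀ s, (if G.tree.depth s = h + 1 then ((G.tree.prev s).elim (c * d)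
        fun p => G.trans p.1 p.2.1 p.2.2 s * G.occ m n p) else 0) =
        ∑ w : S × A × B, if G.tree.depth w.1 = h then
          G.trans w.1 w.2.1 w.2.2 s * G.occ m n w else 0 := by
      intro s
      have hne : ∀ w : S × A × B, G.tree.prev s ≠ some w → G.trans w.1 w.2.1 w.2.2 s = 0 := by
        intro w hw
        by_contra h0
        exact hw (G.trans_tree _ _ _ _ h0)
      rcases hp : G.tree.prev s with _ | p
      · rw [if_neg (by rw [G.tree.depth_of_none s hp]; omega)]
        refine (Finset.sum_eq_zero fun w _ => ?_).symm
        rw [hne w (by rw [hp]; simp), zero_mul, ite_self]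
      · rw [Finset.sum_eq_single p]
        · rw [G.tree.depth_of_some s p hp]
          simp
        · intro w _ hw
          rw [hne w (by rw [hp]; simpa using hw.symm), zero_mul, ite_self]
        · simp
    rw [Finset.sum_congr rfl fun s _ => h1 s, Finset.sum_comm]
    refine Finset.sum_congr rfl fun w _ => ?_
    by_cases hw : G.tree.depth w.1 = h
    · simp only [hw, if_true]
      rw [← Finset.sum_mul, G.trans_sum _ _ _ (by omega), one_mul]
    · simp only [hw, if_false, Finset.sum_const_zero]

lemma sum_occ_eq_sum_depth (g : S × A × B → ℝ) :
    ∑ w, g w = ∑ h : Fin G.H, ∑ w, if G.tree.depth w.1 = h then g w else 0 := by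
  rw [Finset.sum_comm]
  refine Finset.sum_congr rfl fun w _ => ?_
  rw [Finset.sum_eq_single ⟨G.tree.depth w.1, G.depth_lt w.1⟩]
  · simp
  · intro h _ hh
    rw [if_neg]
    intro h1
    exact hh (Fin.ext h1.symm)
  · simp

theorem sum_occ {c d : ℝ} {m : X → A → ℝ} {n : Y → B → ℝ} (hm : G.minTree.Conserves c m)
    (hn : G.maxTree.Conserves d n) : ∑ w, G.occ m n w = G.H * (c * d) := by
  rw [G.sum_occ_eq_sum_depth]
  have : ∀ h : Fin G.H, ∑ w : S × A × B,
      (if G.tree.depth w.1 = (h : ℕ) then G.occ m n w else 0) = c * d := fun h => by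
    rw [← G.sum_occ_depth hm hn h h.isLt]
  simp [this]

open Classical in
/-- The law of a play at depth `h`. -/
theorem sum_playProb_mul {μ : X → A → ℝ} {ν : Y → B → ℝ} (hμ : IsPolicy μ) (hν : IsPolicy ν)
    (h : Fin G.H) (f : S × A × B → ℝ) :
    ∑ z : G.Play, G.playProb μ ν z * f (z h) =
      ∑ w : S × A × B, (if G.tree.depth w.1 = h then
        G.occ (G.minTree.seqForm μ) (G.maxTree.seqForm ν) w else 0) * f w := by
  -- An episode is a Markov chain on triples (state, actions) whose marginal at depth `h` is `occ`
  -- restricted to that depth.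
  set q : S × A × B → ℝ := fun w => (if w.1 = G.root then 1 else 0) *
    μ (G.infoMin w.1) w.2.1 * ν (G.infoMax w.1) w.2.2 with hq
  set k : S × A × B → S × A × B → ℝ := fun w w' => G.trans w.1 w.2.1 w.2.2 w'.1 *
    μ (G.infoMin w'.1) w'.2.1 * ν (G.infoMax w'.1) w'.2.2 with hk
  set o := G.occ (G.minTree.seqForm μ) (G.maxTree.seqForm ν) with ho
  have hplay : ∀ z : G.Play, G.playProb μ ν z = chainWeight q k z := by
    intro z
    refine Finset.prod_congr rfl fun j _ => ?_
    unfold arrivalProb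
    by_cases h1 : (j : ℕ) = 0
    · rw [if_pos h1, if_pos h1]
    · rw [if_neg h1, if_neg h1]
  have ho_eq : ∀ w, o w = ((G.tree.prev w.1).elim 1 fun p =>
      G.trans p.1 p.2.1 p.2.2 w.1 * o p) * μ (G.infoMin w.1) w.2.1 *
        ν (G.infoMax w.1) w.2.2 := by
    intro w
    simp only [ho, occ]
    rw [DecisionTree.seqForm_eq, DecisionTree.seqForm_eq, reach_eq, G.recall_min, G.recall_max]
    rcases G.tree.prev w.1 with _ | p
    · simp
    · simp only [Option.elim_some, Option.map_some]
      ring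
  simp only [hplay]
  refine sum_chainWeight_mul (d := fun w => G.tree.depth w.1) (N := G.H)
    (marg := fun j w => if G.tree.depth w.1 = j then o w else 0) ?_ ?_ ?_ ?_ ?_ G.H le_rfl h f
  · intro w hw
    rw [depth_eq_zero_iff]
    by_contra h0
    exact hw (by simp [hq, h0])
  · intro w w' hw
    have : G.trans w.1 w.2.1 w.2.2 w'.1 ≠ 0 := fun h0 => hw (by simp [hk, h0])
    exact G.tree.depth_of_some _ _ (G.trans_tree _ _ _ _ this)
  · intro w hw
    rw [sum_prod_prod]
    simp only [hk, ← Finset.mul_sum, hμ.2, hν.2, mul_one]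
    exact G.trans_sum _ _ _ hw
  · intro w
    by_cases h0 : w.1 = G.root
    · rw [if_pos ((G.depth_eq_zero_iff _).2 h0), ho_eq, (G.prev_eq_none_iff _).2 h0]
      simp [hq, h0]
    · rw [if_neg fun h1 => h0 ((G.depth_eq_zero_iff _).1 h1)]
      simp [hq, h0]
  · intro j w'
    have hne : ∀ w : S × A × B, G.tree.prev w'.1 ≠ some w →
        G.trans w.1 w.2.1 w.2.2 w'.1 = 0 := by
      intro w hw
      by_contra h0
      exact hw (G.trans_tree _ _ _ _ h0)
    rcases hp : G.tree.prev w'.1 with _ | p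
    · rw [if_neg (by rw [G.tree.depth_of_none _ hp]; omega)]
      refine (Finset.sum_eq_zero fun w _ => ?_).symm
      simp [hk, hne w (by rw [hp]; simp)]
    · rw [Finset.sum_eq_single p, G.tree.depth_of_some _ p hp, ho_eq w', hp]
      · simp only [hk, Option.elim_some, Nat.add_right_cancel_iff]
        split_ifs
        · ring
        · simp
      · intro w _ hw
        simp [hk, hne w (by rw [hp]; simpa using hw.symm)]
      · simp

lemma playProb_nonneg {μ : X → A → ℝ} {ν : Y → B → ℝ} (hμ : IsPolicy μ) (hν : IsPolicy ν)
    (z : G.Play) : 0 ≤ G.playProb μ ν z := by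
  refine Finset.prod_nonneg fun h _ => mul_nonneg (mul_nonneg ?_ (hμ.1 _ _)) (hν.1 _ _)
  unfold arrivalProb
  split_ifs
  · exact zero_le_one
  · exact le_rfl
  · exact G.trans_nonneg _ _ _ _

lemma sum_playProb {μ : X → A → ℝ} {ν : Y → B → ℝ} (hμ : IsPolicy μ) (hν : IsPolicy ν) :
    ∑ z : G.Play, G.playProb μ ν z = 1 := by
  have h := G.sum_playProb_mul hμ hν ⟨0, G.H_pos⟩ fun _ => 1
  simp only [mul_one] at h
  rw [h]
  have := G.sum_occ_depth (DecisionTree.conserves_seqForm (T := G.minTree) hμ)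
    (DecisionTree.conserves_seqForm (T := G.maxTree) hν) 0 G.H_pos
  simpa using this

lemma sum_playProb_mul_sum {μ : X → A → ℝ} {ν : Y → B → ℝ} (hμ : IsPolicy μ) (hν : IsPolicy ν)
    (f : S × A × B → ℝ) :
    ∑ z : G.Play, G.playProb μ ν z * ∑ h, f (z h) =
      ∑ w, G.occ (G.minTree.seqForm μ) (G.maxTree.seqForm ν) w * f w := by
  classical
  simp only [Finset.mul_sum]
  rw [Finset.sum_comm]
  simp only [G.sum_playProb_mul hμ hν]
  rw [G.sum_occ_eq_sum_depth fun w =>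
    G.occ (G.minTree.seqForm μ) (G.maxTree.seqForm ν) w * f w]
  refine Finset.sum_congr rfl fun h _ => Finset.sum_congr rfl fun w _ => ?_
  by_cases hw : G.tree.depth w.1 = h <;> simp [hw]

/-- The bilinear form of the game on sequence forms. -/
noncomputable def bilin (m : X → A → ℝ) (n : Y → B → ℝ) : ℝ :=
  ∑ w : S × A × B, G.occ m n w * G.loss w.1 w.2.1 w.2.2

lemma value_eq {μ : X → A → ℝ} {ν : Y → B → ℝ} (hμ : IsPolicy μ) (hν : IsPolicy ν) :
    G.value μ ν = G.bilin (G.minTree.seqForm μ) (G.maxTree.seqForm ν) :=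
  G.sum_playProb_mul_sum hμ hν fun w => G.loss w.1 w.2.1 w.2.2

lemma bilin_add_left (m m' : X → A → ℝ) (n : Y → B → ℝ) :
    G.bilin (m + m') n = G.bilin m n + G.bilin m' n := by
  simp only [bilin, occ, Pi.add_apply, ← Finset.sum_add_distrib]
  exact Finset.sum_congr rfl fun w _ => by ring

lemma bilin_add_right (m : X → A → ℝ) (n n' : Y → B → ℝ) :
    G.bilin m (n + n') = G.bilin m n + G.bilin m n' := by
  simp only [bilin, occ, Pi.add_apply, ← Finset.sum_add_distrib]
  exact Finset.sum_congr rfl fun w _ => by ring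

lemma bilin_smul_left (r : ℝ) (m : X → A → ℝ) (n : Y → B → ℝ) :
    G.bilin (r • m) n = r * G.bilin m n := by
  simp only [bilin, occ, Pi.smul_apply, smul_eq_mul, Finset.mul_sum]
  exact Finset.sum_congr rfl fun w _ => by ring

lemma bilin_smul_right (r : ℝ) (m : X → A → ℝ) (n : Y → B → ℝ) :
    G.bilin m (r • n) = r * G.bilin m n := by
  simp only [bilin, occ, Pi.smul_apply, smul_eq_mul, Finset.mul_sum]
  exact Finset.sum_congr rfl fun w _ => by ring

lemma abs_bilin_le {m u : X → A → ℝ} {n v : Y → B → ℝ} (hm : G.minTree.Conserves 1 m)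
    (hn : G.maxTree.Conserves 1 n) (hu : ∀ x a, |u x a| ≤ m x a) (hv : ∀ y b, |v y b| ≤ n y b) :
    |G.bilin u v| ≤ G.H := by
  calc |G.bilin u v| ≤ ∑ w : S × A × B, |G.occ u v w * G.loss w.1 w.2.1 w.2.2| :=
        Finset.abs_sum_le_sum_abs _ _
    _ ≤ ∑ w, G.occ m n w := by
        refine Finset.sum_le_sum fun w _ => ?_
        have hl := G.loss_mem w.1 w.2.1 w.2.2
        simp only [occ, abs_mul, abs_of_nonneg (G.reach_nonneg w.1), abs_of_nonneg hl.1]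
        have h0 := G.reach_nonneg w.1
        have h1 := hu (G.infoMin w.1) w.2.1
        have h2 := hv (G.infoMax w.1) w.2.2
        have h3 : 0 ≤ m (G.infoMin w.1) w.2.1 := (abs_nonneg _).trans h1
        calc _ ≤ G.reach w.1 * |u (G.infoMin w.1) w.2.1| * |v (G.infoMax w.1) w.2.2| * 1 := by
              gcongr
              exact hl.2
          _ ≤ _ := by
              rw [mul_one]
              gcongr
    _ = G.H := by rw [G.sum_occ hm hn]; simp

/-- Every depth below `H` carries total mass one, so it contains a state; by perfect recall,
information sets at different depths are different. -/
lemma height_le_card [Fintype X] [Nonempty A] [Nonempty B] : G.H ≤ Fintype.card X := by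
  classical
  have hex : ∀ h : Fin G.H, ∃ s, G.tree.depth s = h := by
    intro h
    by_contra hne
    push Not at hne
    have hμ : IsPolicy (uniformPolicy X A) :=
      ⟨fun _ _ => by unfold uniformPolicy; positivity, fun _ => by simp [uniformPolicy]⟩
    have hν : IsPolicy (uniformPolicy Y B) :=
      ⟨fun _ _ => by unfold uniformPolicy; positivity, fun _ => by simp [uniformPolicy]⟩
    have := G.sum_occ_depth (DecisionTree.conserves_seqForm (T := G.minTree) hμ)
      (DecisionTree.conserves_seqForm (T := G.maxTree) hν) h h.isLt
    rw [Finset.sum_eq_zero fun w _ => if_neg (hne w.1)] at this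
    norm_num at this
  choose s hs using hex
  have hinj : Function.Injective fun h : Fin G.H => G.infoMin (s h) := by
    intro h h' he
    have := congrArg G.minTree.depth he
    simp only [depth_infoMin, hs] at this
    exact Fin.ext this
  simpa using Fintype.card_le_of_injective _ hinj

lemma expect_estimateMin [Fintype X] {μ : X → A → ℝ} {ν : Y → B → ℝ} (hμ : IsInteriorPolicy μ)
    (hν : IsPolicy ν) (w : X → A → ℝ) :
    ∑ z, G.playProb μ ν z * ∑ x, ∑ a, G.estimateMin μ z x a * w x a =
      G.bilin w (G.maxTree.seqForm ν) := by
  simp only [sum_estimateMin_mul, playLoss]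
  refine (G.sum_playProb_mul_sum hμ.1 hν fun v => G.loss v.1 v.2.1 v.2.2 /
    G.minTree.seqForm μ (G.infoMin v.1) v.2.1 * w (G.infoMin v.1) v.2.1).trans ?_
  refine Finset.sum_congr rfl fun v _ => ?_
  have := (DecisionTree.seqForm_pos (T := G.minTree) hμ (G.infoMin v.1) v.2.1).ne'
  simp only [occ]
  field_simp

/-- Against a tangent vector the constant loss `1` has total occupation `H * (1 * 0) = 0`, so the
loss `1 - ℓ` acts as `-ℓ`. -/
lemma expect_estimateMax [Fintype Y] {μ : X → A → ℝ} {ν : Y → B → ℝ} (hμ : IsPolicy μ)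
    (hν : IsInteriorPolicy ν) {w : Y → B → ℝ} (hw : G.maxTree.Conserves 0 w) :
    ∑ z, G.playProb μ ν z * ∑ y, ∑ b, G.estimateMax ν z y b * w y b =
      -G.bilin (G.minTree.seqForm μ) w := by
  simp only [sum_estimateMax_mul, playLoss]
  refine (G.sum_playProb_mul_sum hμ hν.1 fun v => (1 - G.loss v.1 v.2.1 v.2.2) /
    G.maxTree.seqForm ν (G.infoMax v.1) v.2.2 * w (G.infoMax v.1) v.2.2).trans ?_
  have h0 := G.sum_occ (DecisionTree.conserves_seqForm (T := G.minTree) hμ) hw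
  rw [mul_zero, mul_zero] at h0
  rw [← zero_sub, ← h0, bilin, ← Finset.sum_sub_distrib]
  refine Finset.sum_congr rfl fun v _ => ?_
  have := (DecisionTree.seqForm_pos (T := G.maxTree) hν (G.infoMax v.1) v.2.2).ne'
  simp only [occ]
  field_simp

end ExtensiveGame

/-! ### The game as a saddle-point problem. -/

section Joint

variable {X Y A B : Type*}

/-- The pair of a min-player vector and a max-player vector, as one vector. -/
def joint (m : X → A → ℝ) (n : Y → B → ℝ) : (X × A) ⊕ (Y × B) → ℝ :=
  Sum.elim (fun i => m i.1 i.2) fun j => n j.1 j.2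

/-- The min-player part of a joint vector. -/
def minPart : ((X × A) ⊕ (Y × B) → ℝ) →ₗ[ℝ] X → A → ℝ where
  toFun z := fun x a => z (Sum.inl (x, a))
  map_add' _ _ := rfl
  map_smul' _ _ := rfl

/-- The max-player part of a joint vector. -/
def maxPart : ((X × A) ⊕ (Y × B) → ℝ) →ₗ[ℝ] Y → B → ℝ where
  toFun z := fun y b => z (Sum.inr (y, b))
  map_add' _ _ := rfl
  map_smul' _ _ := rfl

lemma sum_joint [Fintype X] [Fintype Y] [Fintype A] [Fintype B] (g : (X × A) ⊕ (Y × B) → ℝ) :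
    ∑ i, g i = ∑ x, ∑ a, g (Sum.inl (x, a)) + ∑ y, ∑ b, g (Sum.inr (y, b)) := by
  rw [Fintype.sum_sum_type, Fintype.sum_prod_type, Fintype.sum_prod_type]

end Joint

namespace DecisionTree

variable {X A : Type*} [Fintype A] (T : DecisionTree X A)

/-- The vectors of zero total mass: the directions of the set of sequence forms. -/
def tangent : Submodule ℝ (X → A → ℝ) where
  carrier := {w | T.Conserves 0 w}
  add_mem' hv hw := by simpa using Conserves.add hv hw
  zero_mem' x := by cases h : T.prev x <;> simp
  smul_mem' r w hw := by simpa using Conserves.smul r hw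

lemma isClosed_conserves (c : ℝ) : IsClosed {m : X → A → ℝ | T.Conserves c m} := by
  simp only [Conserves, Set.ofPred_forall]
  refine isClosed_iInter fun x => isClosed_eq (by fun_prop) ?_
  cases T.prev x with
  | none => exact continuous_const
  | some p => exact (continuous_apply p.2).comp (continuous_apply p.1)

end DecisionTree

namespace ExtensiveGame

variable {S X Y A B : Type*} [Fintype S] [Fintype X] [Fintype Y] [Fintype A] [Fintype B]

/-- The saddle-point problem of the game on sequence forms. -/
noncomputable def saddle (G : ExtensiveGame S X Y A B) [Nonempty A] [Nonempty B] :
    SaddleProblem ((X × A) ⊕ (Y × B)) where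
  V := G.minTree.tangent.comap minPart ⊓ G.maxTree.tangent.comap maxPart
  Q := {z | (∀ i, 0 ≤ z i) ∧ G.minTree.Conserves 1 (minPart z) ∧
    G.maxTree.Conserves 1 (maxPart z)}
  isCompact := by
    refine (isCompact_Icc (a := (0 : (X × A) ⊕ (Y × B) → ℝ)) (b := 1)).of_isClosed_subset ?_ ?_
    · refine IsClosed.inter ?_ (IsClosed.inter ?_ ?_)
      · exact isClosed_Ici (a := (0 : (X × A) ⊕ (Y × B) → ℝ))
      · exact (G.minTree.isClosed_conserves 1).preimage
          (LinearMap.continuous_of_finiteDimensional minPart)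
      · exact (G.maxTree.isClosed_conserves 1).preimage
          (LinearMap.continuous_of_finiteDimensional maxPart)
    · rintro z ⟨h0, h1, h2⟩
      refine ⟨h0, ?_⟩
      rintro (⟨x, a⟩ | ⟨y, b⟩)
      · exact h1.le_one (fun x a => h0 _) x a
      · exact h2.le_one (fun x a => h0 _) y b
  nonneg z hz := hz.1
  le_one := by
    rintro z ⟨h0, h1, h2⟩ (⟨x, a⟩ | ⟨y, b⟩)
    · exact h1.le_one (fun x a => h0 _) x a
    · exact h2.le_one (fun x a => h0 _) y b
  sub_mem z hz z' hz' := by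
    refine ⟨?_, ?_⟩
    · have := hz.2.1.sub hz'.2.1
      rwa [sub_self] at this
    · have := hz.2.2.sub hz'.2.2
      rwa [sub_self] at this
  add_mem z hz w hw h := by
    refine ⟨h, ?_, ?_⟩
    · have := hz.2.1.add hw.1
      rwa [add_zero] at this
    · have := hz.2.2.add hw.2
      rwa [add_zero] at this
  -- The sign convention makes the form at `z` the joint expected loss vector: the min-player's loss
  -- minus the max-player's gain in the direction `w`.
  form := LinearMap.mk₂ ℝ
    (fun z w => G.bilin (minPart w) (maxPart z) - G.bilin (minPart z) (maxPart w))
    (fun z z' w => by simp only [map_add, bilin_add_left, bilin_add_right]; ring)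
    (fun r z w => by
      simp only [map_smul, bilin_smul_left, bilin_smul_right, smul_eq_mul]; ring)
    (fun z w w' => by simp only [map_add, bilin_add_left, bilin_add_right]; ring)
    (fun r z w => by
      simp only [map_smul, bilin_smul_left, bilin_smul_right, smul_eq_mul]; ring)
  form_self u := sub_self _
  -- Each of the two bilinear terms is at most `H`, and `H` is at most the number of coordinates.
  bound := 2 * (Fintype.card ((X × A) ⊕ (Y × B)) : ℝ)
  one_le_bound := by
    have : 0 < Fintype.card ((X × A) ⊕ (Y × B)) :=
      Fintype.card_pos_iff.2 ⟨Sum.inl (G.infoMin G.root, Classical.arbitrary A)⟩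
    have : (1 : ℝ) ≤ (Fintype.card ((X × A) ⊕ (Y × B)) : ℝ) := by exact_mod_cast this
    linarith
  abs_form_le z hz z' hz' u w hu hw := by
    have h1 := G.abs_bilin_le hz'.2.1 hz.2.2 (u := minPart w) (v := maxPart u)
      (fun x a => hw _) fun y b => hu _
    have h2 := G.abs_bilin_le hz.2.1 hz'.2.2 (u := minPart u) (v := maxPart w)
      (fun x a => hu _) fun y b => hw _
    have h3 : (G.H : ℝ) ≤ (Fintype.card ((X × A) ⊕ (Y × B)) : ℝ) := by
      have h4 := G.height_le_card
      have h5 : Fintype.card X ≤ Fintype.card ((X × A) ⊕ (Y × B)) := by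
        rw [Fintype.card_sum, Fintype.card_prod]
        have := Nat.le_mul_of_pos_right (Fintype.card X) (Fintype.card_pos (α := A))
        omega
      exact_mod_cast h4.trans h5
    calc _ ≤ |G.bilin (minPart w) (maxPart u)| + |G.bilin (minPart u) (maxPart w)| := abs_sub _ _
      _ ≤ _ := by linarith

variable (G : ExtensiveGame S X Y A B) [Nonempty A] [Nonempty B]

lemma joint_seqForm_mem {μ : X → A → ℝ} {ν : Y → B → ℝ} (hμ : IsPolicy μ) (hν : IsPolicy ν) :
    joint (G.minTree.seqForm μ) (G.maxTree.seqForm ν) ∈ G.saddle.Q := by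
  refine ⟨?_, DecisionTree.conserves_seqForm hμ, DecisionTree.conserves_seqForm hν⟩
  rintro (⟨x, a⟩ | ⟨y, b⟩)
  · exact DecisionTree.seqForm_nonneg hμ x a
  · exact DecisionTree.seqForm_nonneg hν y b

lemma exploitabilityGap_le {μ : X → A → ℝ} {ν : Y → B → ℝ} (hμ : IsPolicy μ) (hν : IsPolicy ν)
    {g : ℝ} (h : ∀ z' ∈ G.saddle.Q,
      G.saddle.form (joint (G.minTree.seqForm μ) (G.maxTree.seqForm ν))
        (joint (G.minTree.seqForm μ) (G.maxTree.seqForm ν) - z') ≤ g) :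
    G.exploitabilityGap μ ν ≤ g := by
  have key : ∀ ν', IsPolicy ν' → ∀ μ', IsPolicy μ' → G.value μ ν' - g ≤ G.value μ' ν := by
    intro ν' hν' μ' hμ'
    have h1 := h _ (G.joint_seqForm_mem hμ' hν')
    rw [map_sub, G.saddle.form_self, zero_sub] at h1
    have h2 : G.saddle.form (joint (G.minTree.seqForm μ) (G.maxTree.seqForm ν))
        (joint (G.minTree.seqForm μ') (G.maxTree.seqForm ν')) =
        G.value μ' ν - G.value μ ν' := by
      rw [G.value_eq hμ' hν, G.value_eq hμ hν']
      rfl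
    linarith
  have h1 : sSup ((fun ν' => G.value μ ν') '' {ν' | IsPolicy ν'}) - g ≤
      sInf ((fun μ' => G.value μ' ν) '' {μ' | IsPolicy μ'}) := by
    refine le_csInf ⟨_, μ, hμ, rfl⟩ ?_
    rintro _ ⟨μ', hμ', rfl⟩
    rw [sub_le_iff_le_add]
    refine csSup_le ⟨_, ν, hν, rfl⟩ ?_
    rintro _ ⟨ν', hν', rfl⟩
    have := key ν' hν' μ' hμ'
    simp only
    linarith
  unfold exploitabilityGap
  linarith

end ExtensiveGame

/-! ### Measurability and the final assembly. -/

lemma ExtensiveGame.joint_seqForm_pos {S X Y A B : Type*} [Fintype S] [Fintype A] [Fintype B]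
    (G : ExtensiveGame S X Y A B)
    {μ : X → A → ℝ} {ν : Y → B → ℝ} (hμ : IsInteriorPolicy μ)
    (hν : IsInteriorPolicy ν) (i : (X × A) ⊕ (Y × B)) :
    0 < joint (G.minTree.seqForm μ) (G.maxTree.seqForm ν) i := by
  rcases i with ⟨x, a⟩ | ⟨y, b⟩
  · exact DecisionTree.seqForm_pos hμ x a
  · exact DecisionTree.seqForm_pos hν y b

lemma measurable_seqForm {X A Ω : Type*} {m : MeasurableSpace Ω} (T : DecisionTree X A)
    {μ : Ω → X → A → ℝ} (hμ : ∀ x a, Measurable fun ω => μ ω x a) (x : X) :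
    ∀ a, Measurable fun ω => T.seqForm (μ ω) x a := by
  refine T.depth_induction
    (motive := fun x => ∀ a, Measurable fun ω => T.seqForm (μ ω) x a) ?_ ?_ x
  · intro x h a
    simp only [T.seqForm_eq _ x, h, Option.elim_none, mul_one]
    exact hμ x a
  · intro x p h ih a
    simp only [T.seqForm_eq _ x, h, Option.elim_some]
    exact (hμ x a).mul (ih p.2)

lemma ExtensiveGame.measurable_estimateMin {S X Y A B Ω : Type*} [Fintype S]
    {m : MeasurableSpace Ω} (G : ExtensiveGame S X Y A B) {μ : Ω → X → A → ℝ}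
    (hμ : ∀ x a, Measurable fun ω => μ ω x a) (z : G.Play) (x : X) (a : A) :
    Measurable fun ω => G.estimateMin (μ ω) z x a := by
  unfold estimateMin
  refine Finset.measurable_fun_sum _ fun h _ => ?_
  split_ifs
  · exact measurable_const.div (measurable_seqForm G.minTree hμ x a)
  · exact measurable_const

lemma ExtensiveGame.measurable_estimateMax {S X Y A B Ω : Type*} [Fintype S]
    {m : MeasurableSpace Ω} (G : ExtensiveGame S X Y A B) {ν : Ω → Y → B → ℝ}
    (hν : ∀ y b, Measurable fun ω => ν ω y b) (z : G.Play) (y : Y) (b : B) :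
    Measurable fun ω => G.estimateMax (ν ω) z y b := by
  unfold estimateMax
  refine Finset.measurable_fun_sum _ fun h _ => ?_
  split_ifs
  · exact measurable_const.div (measurable_seqForm G.maxTree hν y b)
  · exact measurable_const

theorem mainTheorem2 (K : ℕ) (δ : ℝ) (hδ : 0 < δ) :
    ∃ c : ℝ, 0 < c ∧
      ∀ (S X Y A B : Type*) [Fintype S] [Fintype X] [Fintype Y] [Fintype A] [Fintype B]
        (G : ExtensiveGame S X Y A B)
        (_ : Fintype.card A * Fintype.card X + Fintype.card B * Fintype.card Y = K)
        (η τ : ℝ) (T₀ : ℕ) (_ : 0 < η) (_ : 0 < τ) (_ : 1 < T₀)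
        (_ : 1 / (η * τ) ≤ c) (_ : η ≤ c)
        (_ : η * τ ≤ T₀ / Real.log T₀ ^ 4) (_ : T₀ ≤ Real.log (1 / δ) ^ 2 * τ ^ 4)
        (Ω : Type*) (mΩ : MeasurableSpace Ω) (P : Measure Ω) [IsProbabilityMeasure P]
        (ℱ : Filtration ℕ mΩ) (Z : ℕ → Ω → G.Play)
        (μ : ℕ → Ω → X → A → ℝ) (ν : ℕ → Ω → Y → B → ℝ)
        (_ : G.IsRun δ η τ T₀ P ℱ Z μ ν),
        1 - δ ≤ P.real {ω | ∀ t : ℕ,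
          G.exploitabilityGap (μ t ω) (ν t ω) ≤
            2 * K * τ * Real.log (((t : ℝ) + T₀) / δ) * ((t : ℝ) + T₀) ^ (-(1 / 4) : ℝ)} := by
  rcases le_or_gt 1 δ with hδ1 | hδ1
  · exact ⟨1, one_pos, fun _ _ _ _ _ _ _ _ _ _ _ _ _ _ _ _ _ _ _ _ _ _ _ _ _ _ _ _ _ _ _ =>
      le_trans (by linarith) measureReal_nonneg⟩
  -- The case `K = 0` is void: the root lies in an information set, and a policy there needs an
  -- action.
  rcases Nat.eq_zero_or_pos K with hK0 | hK0
  · refine ⟨1, one_pos, ?_⟩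
    intro S X Y A B _ _ _ _ _ G hcard η τ T₀ _ _ _ _ _ _ _ Ω mΩ P _ ℱ Z μ ν hrun
    exfalso
    obtain ⟨ω⟩ := nonempty_of_isProbabilityMeasure P
    have hA : Nonempty A := by
      by_contra hA
      rw [not_nonempty_iff] at hA
      have := (hrun.step_min 0 ω).1.1.2 (G.infoMin G.root)
      simp at this
    have h1 : 0 < Fintype.card A := Fintype.card_pos
    have h2 : 0 < Fintype.card X := Fintype.card_pos_iff.2 ⟨G.infoMin G.root⟩
    have := Nat.mul_pos h1 h2
    omega
  have hK1 : (1 : ℝ) ≤ K := by exact_mod_cast hK0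
  -- A lower bound for the uniform sequence form that depends on `K` alone, as there are at most `K`
  -- actions and `K` levels; this keeps `c` independent of the game.
  set m : ℝ := (1 / (K : ℝ)) ^ K with hm
  have hm0 : 0 < m := by positivity
  obtain ⟨c, hc0, hc⟩ := exists_isSchedule (K := K) (d₀ := K * m⁻¹) (δ := δ) hK1 (by positivity)
    hδ hδ1
  refine ⟨c, hc0, ?_⟩
  intro S X Y A B _ _ _ _ _ G hcard η τ T₀ hη hτ hT h1 h2 h3 h4 Ω mΩ P _ ℱ Z μ ν hrun
  obtain ⟨r, k, w, u, hsch⟩ := hc η τ T₀ hη hτ hT h1 h2 h3 h4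
  obtain ⟨ω₀⟩ := nonempty_of_isProbabilityMeasure P
  have hA : Nonempty A := by
    by_contra hA
    rw [not_nonempty_iff] at hA
    have := (hrun.step_min 0 ω₀).1.1.2 (G.infoMin G.root)
    simp at this
  have hB : Nonempty B := by
    by_contra hB
    rw [not_nonempty_iff] at hB
    have := (hrun.step_max 0 ω₀).1.1.2 (G.infoMax G.root)
    simp at this
  have hcardI : (K : ℝ) = (Fintype.card ((X × A) ⊕ (Y × B)) : ℝ) := by
    rw [Fintype.card_sum, Fintype.card_prod, Fintype.card_prod, ← hcard]
    push_cast
    ring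
  have hXpos : 0 < Fintype.card X := Fintype.card_pos_iff.2 ⟨G.infoMin G.root⟩
  have hYpos : 0 < Fintype.card Y := Fintype.card_pos_iff.2 ⟨G.infoMax G.root⟩
  have hAK : Fintype.card A ≤ K := by
    have := Nat.le_mul_of_pos_right (Fintype.card A) hXpos
    omega
  have hBK : Fintype.card B ≤ K := by
    have := Nat.le_mul_of_pos_right (Fintype.card B) hYpos
    omega
  have hHK : G.H ≤ K := by
    have := Nat.le_mul_of_pos_left (Fintype.card X) (Fintype.card_pos (α := A))
    have := G.height_le_card
    omega
  have hμi : ∀ t ω, IsInteriorPolicy (μ t ω) := by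
    intro t ω
    cases t with
    | zero =>
      rw [hrun.start_min ω]
      refine ⟨⟨fun _ _ => ?_, fun _ => ?_⟩, fun _ _ => ?_⟩ <;> unfold uniformPolicy
      · positivity
      · simp
      · positivity
    | succ t => exact (hrun.step_min t ω).1
  have hνi : ∀ t ω, IsInteriorPolicy (ν t ω) := by
    intro t ω
    cases t with
    | zero =>
      rw [hrun.start_max ω]
      refine ⟨⟨fun _ _ => ?_, fun _ => ?_⟩, fun _ _ => ?_⟩ <;> unfold uniformPolicy
      · positivity
      · simp
      · positivity
    | succ t => exact (hrun.step_max t ω).1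
  have hpow : ∀ (n d : ℕ), 0 < n → n ≤ K → d < G.H → m ≤ (1 / (n : ℝ)) ^ (d + 1) := by
    intro n d hn hnK hd
    have hn' : (0 : ℝ) < n := by exact_mod_cast hn
    have hnK' : (n : ℝ) ≤ K := by exact_mod_cast hnK
    calc m ≤ (1 / (K : ℝ)) ^ (d + 1) :=
          pow_le_pow_of_le_one (by positivity) (by rw [div_le_one (by linarith)]; exact hK1)
            (by omega)
      _ ≤ _ := pow_le_pow_left₀ (by positivity) (one_div_le_one_div_of_le hn' hnK') _
  set z : ℕ → Ω → (X × A) ⊕ (Y × B) → ℝ := fun t ω =>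
    joint (G.minTree.seqForm (μ t ω)) (G.maxTree.seqForm (ν t ω)) with hz
  set f : ℕ → G.Play → Ω → (X × A) ⊕ (Y × B) → ℝ := fun t j ω =>
    joint (G.estimateMin (μ t ω) j) (G.estimateMax (ν t ω) j) with hf
  have hzm : ∀ t i, Measurable[ℱ t] fun ω => z t ω i := by
    rintro t (⟨x, a⟩ | ⟨y, b⟩)
    · exact measurable_seqForm (m := ℱ t) G.minTree (hrun.measurable_min t) x a
    · exact measurable_seqForm (m := ℱ t) G.maxTree (hrun.measurable_max t) y b
  have main := G.saddle.gap_le_of_isSchedule (P := P) (ℱ := ℱ) (K := K) (m := m) (z := z)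
    (f := f) (Z := Z) (p := fun t j ω => G.playProb (μ t ω) (ν t ω) j)
    hcardI (by rw [hcardI]; rfl) hδ hm0 hsch
    (fun t j => ℱ.le _ _ (hrun.measurable_play t j))
    (fun t j => by
      refine Finset.measurable_fun_prod _ fun h _ => ?_
      exact (measurable_const.mul (hrun.measurable_min t _ _)).mul (hrun.measurable_max t _ _))
    (fun t j ω => G.playProb_nonneg (hμi t ω).1 (hνi t ω).1 j)
    (fun t ω => G.sum_playProb (hμi t ω).1 (hνi t ω).1)
    hrun.law_play hzm
    (fun t ω => G.joint_seqForm_mem (hμi t ω).1 (hνi t ω).1)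
    (fun t ω => G.joint_seqForm_pos (hμi t ω) (hνi t ω))
    (fun ω ω' => by simp only [hz, hrun.start_min, hrun.start_max])
    (by
      rintro ω (⟨x, a⟩ | ⟨y, b⟩)
      · obtain ⟨s, rfl⟩ := G.infoMin_surjective x
        have : z 0 ω (Sum.inl (G.infoMin s, a)) =
            (1 / (Fintype.card A : ℝ)) ^ (G.tree.depth s + 1) := by
          rw [← G.depth_infoMin s, ← DecisionTree.seqForm_uniformPolicy (T := G.minTree) _ a,
            ← hrun.start_min ω]
          rfl
        rw [this]
        exact hpow _ _ Fintype.card_pos hAK (G.depth_lt s)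
      · obtain ⟨s, rfl⟩ := G.infoMax_surjective y
        have : z 0 ω (Sum.inr (G.infoMax s, b)) =
            (1 / (Fintype.card B : ℝ)) ^ (G.tree.depth s + 1) := by
          rw [← G.depth_infoMax s, ← DecisionTree.seqForm_uniformPolicy (T := G.maxTree) _ b,
            ← hrun.start_max ω]
          rfl
        rw [this]
        exact hpow _ _ Fintype.card_pos hBK (G.depth_lt s))
    (by
      rintro t j (⟨x, a⟩ | ⟨y, b⟩)
      · exact G.measurable_estimateMin (m := ℱ t) (hrun.measurable_min t) j x a
      · exact G.measurable_estimateMax (m := ℱ t) (hrun.measurable_max t) j y b)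
    (by
      rintro t j ω (⟨x, a⟩ | ⟨y, b⟩)
      · exact G.estimateMin_nonneg (hμi t ω) j x a
      · exact G.estimateMax_nonneg (hνi t ω) j y b)
    (fun t j ω => by
      rw [sum_joint]
      have a1 := G.sum_estimateMin_mul_self_le (hμi t ω) j
      have a2 := G.sum_estimateMax_mul_self_le (hνi t ω) j
      have a3 : G.saddle.bound = 2 * (K : ℝ) := by rw [hcardI]; rfl
      have a4 : (G.H : ℝ) ≤ K := by exact_mod_cast hHK
      rw [a3]
      exact (add_le_add a1 a2).trans (by linarith))
    (fun t ω x hx => by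
      have a1 := G.expect_estimateMin (hμi t ω) (hνi t ω).1 (minPart x)
      have a2 := G.expect_estimateMax (hμi t ω).1 (hνi t ω) hx.2
      calc _ = ∑ j, (G.playProb (μ t ω) (ν t ω) j *
              (∑ x', ∑ a, G.estimateMin (μ t ω) j x' a * minPart x x' a)
            + G.playProb (μ t ω) (ν t ω) j *
              (∑ y, ∑ b, G.estimateMax (ν t ω) j y b * maxPart x y b)) := by
            refine Finset.sum_congr rfl fun j _ => ?_
            rw [sum_joint, ← mul_add]
            rfl
        _ = G.bilin (minPart x) (G.maxTree.seqForm (ν t ω))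
              + -G.bilin (G.minTree.seqForm (μ t ω)) (maxPart x) := by
            rw [Finset.sum_add_distrib, a1, a2]
        _ = _ := by rw [← sub_eq_add_neg]; rfl)
    (fun t ω x hx => by
      have a1 := (hrun.step_min t ω).sum_eq_zero hx.1
      have a2 := (hrun.step_max t ω).sum_eq_zero hx.2
      rw [sum_joint]
      refine Eq.trans ?_ ((congrArg₂ (· + ·) a1 a2).trans (add_zero 0))
      rfl)
  refine main.trans (measureReal_mono ?_ (measure_ne_top _ _))
  intro ω hω t
  have hreg : 2 * K * τ * Real.log (((t : ℝ) + T₀) / δ) * ((t : ℝ) + T₀) ^ (-(1 / 4) : ℝ) =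
      2 * K * regStrength δ τ T₀ t := by
    unfold regStrength
    ring
  rw [hreg]
  refine G.exploitabilityGap_le (hμi t ω).1 (hνi t ω).1 fun z' hz' => ?_
  -- For regularization at least `1`, the trivial bound `2 K` on the form is enough.
  rcases lt_or_ge (regStrength δ τ T₀ t) 1 with hlt | hge
  · exact hω t hlt z' hz'
  · have hzQ := G.joint_seqForm_mem (hμi t ω).1 (hνi t ω).1
    rw [map_sub, G.saddle.form_self, zero_sub]
    have a1 := G.saddle.abs_form_le _ hzQ _ hz' _ _
      (fun i => (abs_of_nonneg (G.saddle.nonneg _ hzQ i)).le)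
      (fun i => (abs_of_nonneg (G.saddle.nonneg _ hz' i)).le)
    have a3 : G.saddle.bound = 2 * (K : ℝ) := by rw [hcardI]; rfl
    rw [a3] at a1
    have a4 := (abs_le.1 a1).1
    have a5 := mul_le_mul_of_nonneg_left hge (by linarith : 0 ≤ 2 * (K : ℝ))
    linarith
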